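/- Let $k$ be a field, $H$ a coquasitriangular Hopf algebra over $k$ with universal $r$-form $\mathbf r$ and antipode $S_H$, and let $\mathcal M^H$ be the category of right $H$-comodules, braided by $v\otimes w\mapsto \mathbf r(v_{(1)},w_{(1)})\,w_{(0)}\otimes v_{(0)}$. Here $\mathbf r$ is convolution invertible and satisfies $$yx=\mathbf r(x_{(1)},y_{(1)})\,x_{(2)}y_{(2)}\,\mathbf r^{-1}(x_{(3)},y_{(3)}),\quad \mathbf r(xy,z)=\mathbf r(x,z_{(1)})\mathbf r(y,z_{(2)}),\quad \mathbf r(x,yz)=\mathbf r(x_{(1)},z)\mathbf r(x_{(2)},y).$$ Let $A$ be a Hopf algebra in $\mathcal M^H$ with comultiplication $\Delta_A(a)=a_{[1]}\otimes a_{[2]}$, counit $\varepsilon$, antipode $S_A$ and coaction $a\mapsto a_{(0)}\otimes a_{(1)}$. Let ${}_\varepsilon k$ be the trivial left $A$-module with the trivial coaction, ${}_A\mathcal M^H$ the category of left $A$-modules in $\mathcal M^H$, and $A^e=A\otimes A^{\rm op}$ (ordinary opposite algebra). Assume that ${}_\varepsilon k$ is of type $\mathrm{FP}_\infty$ in ${}_A\mathcal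 M^H$: it has a resolution $P_*\to{}_\varepsilon k$ in ${}_A\mathcal M^H$ such that each $P_n$ is a direct summand in ${}_A\mathcal M^H$ of a free module $A\otimes V$, where $V$ is an object of $\mathcal M^H$ that has a left dual. Let $P_*$ be any such resolution. Then $S_H$ is bijective and, for each $n\ge 0$: 1. there is a right $H$-comodule structure $[f]\mapsto [f]_{(0)}\otimes[f]_{(1)}=[f_{(0)}]\otimes f_{(1)}$ on $\mathrm{Ext}^n_A({}_\varepsilon k,A)$, where, for a cocycle $f\in\mathrm{Hom}_A(P_n,A)$, the element $f_{(0)}\otimes f_{(1)}$ is a finite sum of tensors of cocycles with elements of $H$ and is determined by $$f_{(0)}(x)\otimes f_{(1)}=f(x_{(0)})_{(0)}\otimes S_H^{-1}(x_{(1)})\,f(x_{(0)})_{(1)}\qquad(x\in P_n);$$ 2. the formula $$([f]\otimes a')\cdot(a\otimes b)=([f]\cdot a_{[1]})_{(0)}\otimes b\,a'\,S_A^2(a_{[2](0)})\;\mathbf r\big[a_{[2](1)},\,S_H(a_{[2](2)})\,S_H\big(([f]\cdot a_{[1]})_{(1)}\big)\big],$$ in which $[f]\cdot a$ is the right $A$-action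 induced by right multiplication in $A$, defines a right $A^e$-module structure on $\mathrm{Ext}^n_A({}_\varepsilon k,A)\otimes A$; 3. with this structure there is an isomorphism of right $A^e$-modules $$H^n(A,{}_AA\otimes A_A)\;\cong\;\mathrm{Ext}^n_A({}_\varepsilon k,A)\otimes A,$$ where $H^n(A,{}_AA\otimes A_A)=\mathrm{Ext}^n_{A^e}(A,A^e)$ has the right $A^e$-module structure induced by right multiplication in $A^e$. -/

import Mathlib

open CategoryTheory TensorProduct Coalgebra
open scoped ModuleCat.Algebra

universe u

namespace BraidedHoch

noncomputable section

/-! ### Right comodules over a Hopf algebra -/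

section Comodules

variable {k H : Type u} [Field k] [Ring H] [HopfAlgebra k H]
variable {V W X : Type u} [AddCommGroup V] [Module k V] [AddCommGroup W] [Module k W]
  [AddCommGroup X] [Module k X]

/-- `ρ : V → V ⊗ H` is a right `H`-comodule structure: it is coassociative and counital. -/
structure IsRightCoaction (ρ : V →ₗ[k] V ⊗[k] H) : Prop where
  coassoc : ρ.rTensor H ∘ₗ ρ =
    (TensorProduct.assoc k V H H).symm.toLinearMap ∘ₗ (comul (R := k) (A := H)).lTensor V ∘ₗ ρ
  counit : (counit (R := k) (A := H)).lTensor V ∘ₗ ρ = (TensorProduct.mk k V k).flip 1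

/-- `f : V → W` is a morphism of right `H`-comodules. -/
def IsColinear (ρ : V →ₗ[k] V ⊗[k] H) (σ : W →ₗ[k] W ⊗[k] H) (f : V →ₗ[k] W) : Prop :=
  σ ∘ₗ f = f.rTensor H ∘ₗ ρ

variable (H) in
/-- The trivial coaction `v ↦ v ⊗ 1`. On `k` this is the unit object of the category of
comodules. -/
def trivialCoaction (V : Type u) [AddCommGroup V] [Module k V] : V →ₗ[k] V ⊗[k] H :=
  (TensorProduct.mk k V H).flip 1

/-- The tensor product of comodules: `v ⊗ w ↦ v₍₀₎ ⊗ w₍₀₎ ⊗ v₍₁₎ w₍₁₎`. -/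
def tensorCoaction (ρ : V →ₗ[k] V ⊗[k] H) (σ : W →ₗ[k] W ⊗[k] H) :
    V ⊗[k] W →ₗ[k] (V ⊗[k] W) ⊗[k] H :=
  (LinearMap.mul' k H).lTensor (V ⊗[k] W) ∘ₗ
    (TensorProduct.tensorTensorTensorComm k V H W H).toLinearMap ∘ₗ TensorProduct.map ρ σ

/-- The comodule `(V, ρ)` has a left dual in the monoidal category of right `H`-comodules:
there are a comodule `V*` and colinear maps `V* ⊗ V → k` and `k → V ⊗ V*` which satisfy the two
zigzag identities. -/
def HasLeftDual (ρ : V →ₗ[k] V ⊗[k] H) : Prop :=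
  ∃ (D : Type u) (_ : AddCommGroup D) (_ : Module k D) (σ : D →ₗ[k] D ⊗[k] H)
    (ev : D ⊗[k] V →ₗ[k] k) (coev : k →ₗ[k] V ⊗[k] D),
    IsRightCoaction σ ∧
    IsColinear (tensorCoaction σ ρ) (trivialCoaction H k) ev ∧
    IsColinear (trivialCoaction H k) (tensorCoaction ρ σ) coev ∧
    (TensorProduct.rid k V).toLinearMap ∘ₗ ev.lTensor V ∘ₗ
      (TensorProduct.assoc k V D V).toLinearMap ∘ₗ coev.rTensor V ∘ₗ
      (TensorProduct.lid k V).symm.toLinearMap = LinearMap.id ∧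
    (TensorProduct.lid k D).toLinearMap ∘ₗ ev.rTensor D ∘ₗ
      (TensorProduct.assoc k D V D).symm.toLinearMap ∘ₗ coev.lTensor D ∘ₗ
      (TensorProduct.rid k D).symm.toLinearMap = LinearMap.id

end Comodules

/-! ### Coquasitriangular Hopf algebras -/

/-- A universal `r`-form on the Hopf algebra `H`: with it, `H` is a coquasitriangular Hopf
algebra. The products in `invRight`, `invLeft` and `mul_comm` are convolution products of linear
maps on the coalgebra `H ⊗ H`, with scalars seen in `H` through `k → H` in `mul_comm`. -/
structure UniversalRForm (k H : Type u) [Field k] [Ring H] [HopfAlgebra k H] where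
  /-- the form `r` -/
  r : H ⊗[k] H →ₗ[k] k
  /-- the convolution inverse of `r` -/
  rInv : H ⊗[k] H →ₗ[k] k
  invRight : WithConv.toConv r * WithConv.toConv rInv = 1
  invLeft : WithConv.toConv rInv * WithConv.toConv r = 1
  /-- `y x = r(x₍₁₎, y₍₁₎) x₍₂₎ y₍₂₎ r⁻¹(x₍₃₎, y₍₃₎)` -/
  mul_comm : WithConv.toConv (LinearMap.mul' k H ∘ₗ (TensorProduct.comm k H H).toLinearMap) =
    WithConv.toConv (Algebra.linearMap k H ∘ₗ r) * WithConv.toConv (LinearMap.mul' k H) *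
      WithConv.toConv (Algebra.linearMap k H ∘ₗ rInv)
  /-- `r(x y, z) = r(x, z₍₁₎) r(y, z₍₂₎)` -/
  mul_left : ∀ x y z : H, r ((x * y) ⊗ₜ[k] z) =
    LinearMap.mul' k k (TensorProduct.map (r ∘ₗ TensorProduct.mk k H H x)
      (r ∘ₗ TensorProduct.mk k H H y) (comul (R := k) z))
  /-- `r(x, y z) = r(x₍₁₎, z) r(x₍₂₎, y)` -/
  mul_right : ∀ x y z : H, r (x ⊗ₜ[k] (y * z)) =
    LinearMap.mul' k k (TensorProduct.map (r ∘ₗ (TensorProduct.mk k H H).flip z)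
      (r ∘ₗ (TensorProduct.mk k H H).flip y) (comul (R := k) x))

section Braiding

variable {k H : Type u} [Field k] [Ring H] [HopfAlgebra k H]
variable {V W : Type u} [AddCommGroup V] [Module k V] [AddCommGroup W] [Module k W]

/-- The braiding `v ⊗ w ↦ r(v₍₁₎, w₍₁₎) w₍₀₎ ⊗ v₍₀₎` of the category of right comodules. -/
def braiding (R : UniversalRForm k H) (ρ : V →ₗ[k] V ⊗[k] H) (σ : W →ₗ[k] W ⊗[k] H) :
    V ⊗[k] W →ₗ[k] W ⊗[k] V :=
  (TensorProduct.rid k (W ⊗[k] V)).toLinearMap ∘ₗ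
    TensorProduct.map (TensorProduct.comm k V W).toLinearMap R.r ∘ₗ
    (TensorProduct.tensorTensorTensorComm k V H W H).toLinearMap ∘ₗ TensorProduct.map ρ σ

/-- The multiplication `(A ⊗ A) ⊗ (A ⊗ A) → A ⊗ A` of the braided tensor product algebra of an
algebra with itself, for a braiding `c : A ⊗ A → A ⊗ A`: the maps are
`(m ⊗ m) ∘ (id ⊗ c ⊗ id)`. -/
def braidedTensorMul {A : Type u} [Ring A] [Algebra k A] (c : A ⊗[k] A →ₗ[k] A ⊗[k] A) :
    (A ⊗[k] A) ⊗[k] (A ⊗[k] A) →ₗ[k] A ⊗[k] A :=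
  TensorProduct.map (LinearMap.mul' k A) (LinearMap.mul' k A) ∘ₗ
    (TensorProduct.assoc k A A (A ⊗[k] A)).symm.toLinearMap ∘ₗ
    ((TensorProduct.assoc k A A A).toLinearMap ∘ₗ c.rTensor A ∘ₗ
      (TensorProduct.assoc k A A A).symm.toLinearMap).lTensor A ∘ₗ
    (TensorProduct.assoc k A A (A ⊗[k] A)).toLinearMap

end Braiding

/-! ### Hopf algebras in the braided category of comodules -/

/-- A Hopf algebra in the braided category of right `H`-comodules, the braiding being the one of
the universal `r`-form `R`. The underlying algebra and the underlying coalgebra of the object are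
the instances `Algebra k A` and `Coalgebra k A`. -/
structure BraidedHopfAlgebra {k H : Type u} [Field k] [Ring H] [HopfAlgebra k H]
    (R : UniversalRForm k H) (A : Type u) [Ring A] [Algebra k A] [Coalgebra k A] where
  /-- the `H`-comodule structure -/
  coact : A →ₗ[k] A ⊗[k] H
  isRightCoaction : IsRightCoaction coact
  mul_colinear : IsColinear (tensorCoaction coact coact) coact (LinearMap.mul' k A)
  unit_colinear : IsColinear (trivialCoaction H k) coact (Algebra.linearMap k A)
  comul_colinear : IsColinear coact (tensorCoaction coact coact) (comul (R := k) (A := A))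
  counit_colinear : IsColinear coact (trivialCoaction H k) (counit (R := k) (A := A))
  comul_one : comul (R := k) (1 : A) = 1 ⊗ₜ[k] 1
  comul_mul : ∀ a b : A, comul (R := k) (a * b) =
    braidedTensorMul (braiding R coact coact) (comul (R := k) a ⊗ₜ[k] comul (R := k) b)
  counit_one : counit (R := k) (1 : A) = 1
  counit_mul : ∀ a b : A, counit (R := k) (a * b) = counit (R := k) a * counit (R := k) b
  /-- the antipode -/
  antipode : A →ₗ[k] A
  antipode_colinear : IsColinear coact coact antipode
  antipode_left : LinearMap.mul' k A ∘ₗ antipode.rTensor A ∘ₗ comul (R := k) (A := A) =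
    Algebra.linearMap k A ∘ₗ counit (R := k) (A := A)
  antipode_right : LinearMap.mul' k A ∘ₗ antipode.lTensor A ∘ₗ comul (R := k) (A := A) =
    Algebra.linearMap k A ∘ₗ counit (R := k) (A := A)

section Modules

variable {k H : Type u} [Field k] [Ring H] [HopfAlgebra k H] {R : UniversalRForm k H}
variable {A : Type u} [Ring A] [Algebra k A] [Coalgebra k A] (B : BraidedHopfAlgebra R A)
variable {M : Type u} [AddCommGroup M] [Module k M] [Module A M] [IsScalarTower k A M]

/-- The coaction `ρ` makes the `A`-module `M` an `A`-module in the category of `H`-comodules: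
it is a comodule structure and the action `A ⊗ M → M` is colinear. -/
structure IsHopfModule (ρ : M →ₗ[k] M ⊗[k] H) : Prop where
  isRightCoaction : IsRightCoaction ρ
  smul_colinear : IsColinear (tensorCoaction B.coact ρ) ρ
    (TensorProduct.lift (Algebra.lsmul k k M).toLinearMap : A ⊗[k] M →ₗ[k] M)

/-- The module `(M, ρ)` is finite relative projective: as an `A`-module in the category of
`H`-comodules it is a direct summand of a free module `A ⊗ V`, with `V` a comodule that has a left
dual. -/
def IsFiniteRelProjective (ρ : M →ₗ[k] M ⊗[k] H) : Prop :=
  ∃ (V : Type u) (_ : AddCommGroup V) (_ : Module k V) (σ : V →ₗ[k] V ⊗[k] H)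
    (i : M →ₗ[A] A ⊗[k] V) (p : A ⊗[k] V →ₗ[A] M),
    IsRightCoaction σ ∧ HasLeftDual σ ∧
    IsColinear ρ (tensorCoaction B.coact σ) (i.restrictScalars k) ∧
    IsColinear (tensorCoaction B.coact σ) ρ (p.restrictScalars k) ∧
    p ∘ₗ i = LinearMap.id

variable {B} in
theorem IsFiniteRelProjective.projective {ρ : M →ₗ[k] M ⊗[k] H}
    (h : IsFiniteRelProjective B ρ) : Module.Projective A M := by
  obtain ⟨V, _, _, _, i, p, _, _, _, _, hip⟩ := h
  exact Module.Projective.of_split i p hip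

/-- The counit of `A` as a ring morphism `A → k`. -/
def counitRingHom : A →+* k where
  toFun := counit (R := k) (A := A)
  map_one' := B.counit_one
  map_mul' := B.counit_mul
  map_zero' := map_zero _
  map_add' := map_add _

/-- The trivial left `A`-module: `k` on which `A` acts through the counit. -/
def trivialModule : ModuleCat.{u} A :=
  (ModuleCat.restrictScalars (counitRingHom B)).obj (ModuleCat.of k k)

/-- A resolution of the module `(M, ρM)` by finite relative projective modules, in the category of
`A`-modules in `H`-comodules. The module `(M, ρM)` is of type `FP_∞` if and only if there is such a
resolution. (The forgetful functor from this category to `A`-modules is exact and reflects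
exactness, so exactness is required of the underlying `A`-modules.) -/
structure FiniteRelProjResolution (M : ModuleCat.{u} A) (ρM : M →ₗ[k] M ⊗[k] H) where
  /-- the underlying complex of `A`-modules -/
  complex : ChainComplex (ModuleCat.{u} A) ℕ
  /-- the augmentation -/
  π : complex ⟶ (ChainComplex.single₀ (ModuleCat.{u} A)).obj M
  /-- the augmented complex is exact -/
  quasiIso : QuasiIso π
  /-- the coactions on the terms of the complex -/
  coact : ∀ n, complex.X n →ₗ[k] complex.X n ⊗[k] H
  isHopfModule : ∀ n, IsHopfModule B (coact n)
  isFiniteRelProjective : ∀ n, IsFiniteRelProjective B (coact n)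
  d_colinear : ∀ n, IsColinear (coact (n + 1)) (coact n)
    ((complex.d (n + 1) n).hom.restrictScalars k)
  π_colinear : IsColinear (coact 0) ρM
    ((show complex.X 0 ⟶ M from π.f 0).hom.restrictScalars k)

variable {B} in
/-- The underlying projective resolution of the underlying `A`-module. -/
def FiniteRelProjResolution.toProjectiveResolution {M : ModuleCat.{u} A} {ρM : M →ₗ[k] M ⊗[k] H}
    (P : FiniteRelProjResolution B M ρM) : ProjectiveResolution M where
  complex := P.complex
  projective n := by
    have := (P.isFiniteRelProjective n).projective
    exact (IsProjective.iff_projective (P.complex.X n)).1 this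
  π := P.π
  quasiIso := P.quasiIso

end Modules

/-! ### Right module structures on Ext spaces -/

section RightAction

variable {S : Type u} [Ring S]

/-- Right multiplication by `s`, as an endomorphism of the left `S`-module `S`. -/
def rightMul (s : S) : ModuleCat.of S S ⟶ ModuleCat.of S S :=
  ModuleCat.ofHom (LinearMap.toSpanSingleton S S s)

theorem rightMul_one : rightMul (1 : S) = 𝟙 _ := by
  ext; simp [rightMul]

theorem rightMul_mul (s t : S) : rightMul (s * t) = rightMul s ≫ rightMul t := by
  ext; simp [rightMul]

theorem rightMul_add (s t : S) : rightMul (s + t) = rightMul s + rightMul t := by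
  ext; simp [rightMul]

theorem rightMul_zero : rightMul (0 : S) = 0 := by
  ext; simp [rightMul]

/-- The right `S`-module structure on `Ext^n_S(M, S)` induced by right multiplication in `S`. -/
instance extRightModule (M : ModuleCat.{u} S) (n : ℕ) :
    Module Sᵐᵒᵖ (Abelian.Ext M (ModuleCat.of S S) n) where
  smul s x := x.comp (Abelian.Ext.mk₀ (rightMul s.unop)) (add_zero n)
  one_smul x := by
    change x.comp (Abelian.Ext.mk₀ (rightMul (1 : S))) (add_zero n) = x
    rw [rightMul_one, Abelian.Ext.comp_mk₀_id]
  mul_smul s t x := by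
    change x.comp (Abelian.Ext.mk₀ (rightMul (t.unop * s.unop))) (add_zero n) =
      (x.comp (Abelian.Ext.mk₀ (rightMul t.unop)) (add_zero n)).comp
        (Abelian.Ext.mk₀ (rightMul s.unop)) (add_zero n)
    rw [rightMul_mul, Abelian.Ext.comp_assoc_of_third_deg_zero, Abelian.Ext.mk₀_comp_mk₀]
  smul_zero s := by apply Abelian.Ext.zero_comp
  smul_add s x y := by apply Abelian.Ext.add_comp
  add_smul s t x := by
    change x.comp (Abelian.Ext.mk₀ (rightMul (s.unop + t.unop))) (add_zero n) =
      x.comp (Abelian.Ext.mk₀ (rightMul s.unop)) (add_zero n) +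
        x.comp (Abelian.Ext.mk₀ (rightMul t.unop)) (add_zero n)
    rw [rightMul_add, Abelian.Ext.mk₀_add, Abelian.Ext.comp_add]
  zero_smul x := by
    change x.comp (Abelian.Ext.mk₀ (rightMul (0 : S))) (add_zero n) = 0
    rw [rightMul_zero, Abelian.Ext.mk₀_zero, Abelian.Ext.comp_zero]

theorem op_smul_ext {M : ModuleCat.{u} S} {n : ℕ} (s : S)
    (x : Abelian.Ext M (ModuleCat.of S S) n) :
    MulOpposite.op s • x = x.comp (Abelian.Ext.mk₀ (rightMul s)) (add_zero n) := rfl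

/-- For a class `ξ ∈ Ext^n_S(M, S)`, the map `S → Ext^n_S(M, S)`, `s ↦ ξ · s`. -/
def extActionMap {k : Type u} [Field k] [Algebra k S] {M : ModuleCat.{u} S} {n : ℕ}
    (ξ : Abelian.Ext M (ModuleCat.of S S) n) :
    S →ₗ[k] Abelian.Ext M (ModuleCat.of S S) n where
  toFun s := MulOpposite.op s • ξ
  map_add' s t := by rw [MulOpposite.op_add, add_smul]
  map_smul' c s := by
    rw [op_smul_ext, op_smul_ext, RingHom.id_apply, Abelian.Ext.smul_eq_comp_mk₀,
      Abelian.Ext.comp_assoc_of_third_deg_zero, Abelian.Ext.mk₀_comp_mk₀]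
    congr 2
    ext
    change (1 : S) * (c • s) = algebraMap k S c * ((1 : S) * s)
    rw [one_mul, one_mul, Algebra.smul_def]

end RightAction

/-! ### Hochschild cohomology with coefficients in `A ⊗ A` -/

section Hochschild

variable (k A : Type u) [Field k] [Ring A] [Algebra k A]

/-- The bimodule `A`, as a left module over the enveloping algebra `A ⊗ Aᵒᵖ`:
`(a ⊗ b) · x = a x b`. -/
def regularBimodule : ModuleCat.{u} (A ⊗[k] Aᵐᵒᵖ) :=
  letI : Module (A ⊗[k] Aᵐᵒᵖ) A := TensorProduct.Algebra.module
  ModuleCat.of (A ⊗[k] Aᵐᵒᵖ) A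

/-- The Hochschild cohomology `H^n(A, A ⊗ A)`, that is `Ext^n` over the enveloping algebra
`A ⊗ Aᵒᵖ` from `A` to the enveloping algebra. The coefficient bimodule is `A ⊗ A` with
`a · (x ⊗ y) · b = a x ⊗ y b`, identified with the left module `A ⊗ Aᵒᵖ`. The right module
structure over the enveloping algebra is the one of `extRightModule`, induced by
`(x ⊗ y) · (a ⊗ b) = x a ⊗ b y`. -/
abbrev HochschildCohomology (n : ℕ) : Type u :=
  Abelian.Ext (regularBimodule k A) (ModuleCat.of (A ⊗[k] Aᵐᵒᵖ) (A ⊗[k] Aᵐᵒᵖ)) n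

end Hochschild

/-! ### The coaction on `Ext^n_A(M, A)` and the action on `Ext^n_A(M, A) ⊗ A` -/

section Coaction

variable {k H : Type u} [Field k] [Ring H] [HopfAlgebra k H] {R : UniversalRForm k H}
variable {A : Type u} [Ring A] [Algebra k A] [Coalgebra k A] (B : BraidedHopfAlgebra R A)

/-- For `f : M → A`, the map `x ↦ f(x₍₀₎)₍₀₎ ⊗ S⁻¹(x₍₁₎) f(x₍₀₎)₍₁₎`; the linear map `Sinv` stands
for the inverse of the antipode of `H`. -/
def homCoaction (Sinv : H →ₗ[k] H) {M : Type u} [AddCommGroup M] [Module k M] [Module A M]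
    [IsScalarTower k A M] (ρ : M →ₗ[k] M ⊗[k] H) (f : M →ₗ[A] A) : M →ₗ[k] A ⊗[k] H :=
  (LinearMap.mul' k H ∘ₗ (TensorProduct.comm k H H).toLinearMap).lTensor A ∘ₗ
    (TensorProduct.assoc k A H H).toLinearMap ∘ₗ
    TensorProduct.map (B.coact ∘ₗ f.restrictScalars k) Sinv ∘ₗ ρ

variable {B} in
/-- `δ` is the coaction of `H` on `Ext^n_A(M, A)` that is induced by the resolution `P`:
for each cocycle `f : P_n → A` there are finitely many cocycles `f_i : P_n → A` and elements
`h_i ∈ H` with `∑ f_i(x) ⊗ h_i = f(x₍₀₎)₍₀₎ ⊗ S⁻¹(x₍₁₎) f(x₍₀₎)₍₁₎` for all `x ∈ P_n`, and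
`δ [f] = ∑ [f_i] ⊗ h_i`. Since each class is the class of a cocycle, and since `∑ f_i ⊗ h_i` is
determined by `f`, there is at most one such `δ`. -/
def IsInducedCoaction (Sinv : H →ₗ[k] H) {M : ModuleCat.{u} A} {ρM : M →ₗ[k] M ⊗[k] H}
    (P : FiniteRelProjResolution B M ρM) (n : ℕ)
    (δ : Abelian.Ext M (ModuleCat.of A A) n →ₗ[k] Abelian.Ext M (ModuleCat.of A A) n ⊗[k] H) :
    Prop :=
  ∀ (f : P.complex.X n ⟶ ModuleCat.of A A) (hf : P.complex.d (n + 1) n ≫ f = 0),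
    ∃ (m : ℕ) (g : Fin m → (P.complex.X n ⟶ ModuleCat.of A A)) (h : Fin m → H)
      (hg : ∀ i, P.complex.d (n + 1) n ≫ g i = 0),
      (∀ x : P.complex.X n, ∑ i, (g i).hom x ⊗ₜ[k] h i =
        homCoaction B Sinv (P.coact n) f.hom x) ∧
      δ (P.toProjectiveResolution.extMk f (n + 1) rfl hf) =
        ∑ i, P.toProjectiveResolution.extMk (g i) (n + 1) rfl (hg i) ⊗ₜ[k] h i

/-- The map `h ⊗ (u ⊗ v) ↦ r(u, S(v) S(h))`. -/
def rTwist (R : UniversalRForm k H) : H ⊗[k] (H ⊗[k] H) →ₗ[k] k :=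
  R.r ∘ₗ (LinearMap.mul' k H ∘ₗ
      TensorProduct.map (HopfAlgebra.antipode k (A := H)) (HopfAlgebra.antipode k)).lTensor H ∘ₗ
    (TensorProduct.assoc k H H H).toLinearMap ∘ₗ
    (TensorProduct.comm k H (H ⊗[k] H)).toLinearMap

theorem rTwist_tmul (R : UniversalRForm k H) (h u v : H) :
    rTwist R (h ⊗ₜ (u ⊗ₜ v)) =
      R.r (u ⊗ₜ (HopfAlgebra.antipode k v * HopfAlgebra.antipode k h)) := rfl

/-- The map `(e ⊗ h) ⊗ (x ⊗ (u ⊗ v)) ↦ r(u, S(v) S(h)) e ⊗ b a' S_A²(x)`. -/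
def twistContract (E : Type u) [AddCommGroup E] [Module k E] (a' b : A) :
    (E ⊗[k] H) ⊗[k] (A ⊗[k] (H ⊗[k] H)) →ₗ[k] E ⊗[k] A :=
  (TensorProduct.rid k (E ⊗[k] A)).toLinearMap ∘ₗ
    TensorProduct.map
      ((LinearMap.mulLeft k (b * a') ∘ₗ B.antipode ∘ₗ B.antipode).lTensor E) (rTwist R) ∘ₗ
    (TensorProduct.tensorTensorTensorComm k E H A (H ⊗[k] H)).toLinearMap

theorem twistContract_tmul (E : Type u) [AddCommGroup E] [Module k E] (a' b : A)
    (e : E) (h : H) (x : A) (u v : H) :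
    twistContract B E a' b ((e ⊗ₜ h) ⊗ₜ (x ⊗ₜ (u ⊗ₜ v))) =
      R.r (u ⊗ₜ (HopfAlgebra.antipode k v * HopfAlgebra.antipode k h)) •
        (e ⊗ₜ[k] (b * a' * B.antipode (B.antipode x))) := rfl

/-- The element `(ξ · a₍₁₎)₍₀₎ ⊗ b a' S_A²(a₍₂₎₍₀₎) r(a₍₂₎₍₁₎, S_H(a₍₂₎₍₂₎) S_H((ξ · a₍₁₎)₍₁₎))` of
`Ext^n_A(M, A) ⊗ A`, where the outermost indices of `a` are those of the comultiplication of `A`,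
the other indices are those of the coactions of `H`, and `δ` is the coaction on `Ext^n_A(M, A)`. -/
def twistedAction {M : ModuleCat.{u} A} {n : ℕ}
    (δ : Abelian.Ext M (ModuleCat.of A A) n →ₗ[k] Abelian.Ext M (ModuleCat.of A A) n ⊗[k] H)
    (ξ : Abelian.Ext M (ModuleCat.of A A) n) (a' a b : A) :
    Abelian.Ext M (ModuleCat.of A A) n ⊗[k] A :=
  twistContract B _ a' b
    (TensorProduct.map (δ ∘ₗ extActionMap ξ)
      ((comul (R := k) (A := H)).lTensor A ∘ₗ B.coact) (comul (R := k) a))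

end Coaction

end

end BraidedHoch

/-! The strategy is to build, from the resolution of the trivial module, a resolution of the
bimodule `A`, and to compute its dual explicitly.

Bijectivity of the antipode of `H`: the Drinfeld functional u(x) = r(x₁, S x₂) is convolution
invertible and conjugation by it turns S² into the identity (`sw_drinfeld`, `sw_drinfeld_inv`), so
S² is invertible, hence so is S.

Write a ◁ h = r(a₍₁₎, h) a₍₀₎. With this right action `A` is a Yetter-Drinfeld module algebra, the
braiding is y ⊗ z ↦ z₍₀₎ ⊗ (y ◁ z₍₁₎), and the braided antipode satisfies S(ab) = S(b₍₀₎) S(a ◁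
b₍₁₎) (`antipode_mul`). For an `A`-module M in comodules, M ⊗ A becomes a bimodule by a · (p ⊗ x) ·
b = a₁ p₍₀₎ ⊗ (a₂ ◁ p₍₁₎) x b. This construction is exact because `k` is a field, sends the trivial
module to `A`, and sends A ⊗ V to the free module A^e ⊗ V (`ofFree_bijective`). Hence P ⊗ A is a
projective resolution of the bimodule `A`.

The key map `phi` : Hom_A(M, A) ⊗ A → Hom_{A^e}(M ⊗ A, A^e) sends f ⊗ y to p ⊗ x ↦ f₍₀₎(p)₁ ⊗ y
S(f₍₀₎(p)₂ ◁ S(f₍₁₎)) x. It is natural in M. It is injective because an explicit contraction with S²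
recovers f(p) ⊗ y (`phiRetract_phiFun`). It is surjective for finite relative projective M: the
image is stable under right multiplication by A^e, and on A ⊗ V it contains the coordinate forms
(`phi_freeForm`). The stability is the precise identity `phiFun_twistedMul`: right multiplication by
a ⊗ b in A^e corresponds under `phi` to the twisted formula of the theorem, at the level of
cochains. The square of the antipode appears there because S²(a₂) must cancel S(a₁), which is S
applied to a₁ S(a₂).

Finiteness also gives Hom_A(M, A) ⊗ H = Hom_A(M, A ⊗ H), which produces the coaction on cochains; it
is compatible with the differentials. Since tensoring over a field is exact, the coaction passes to
cocycles and to Ext, and the cohomology of Hom_A(P, A) ⊗ A is Ext ⊗ A. The isomorphism of complexes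
`phi` therefore identifies Ext ⊗ A with Hochschild cohomology, and the action transported along it
is the stated one.

Computations are done with Sweedler sums `sw t F`; the (multi)linearity of `F` is a side goal for
`fun_prop`. -/

namespace BraidedHoch

noncomputable section

set_option linter.unusedSectionVars false

section

/-! ### Sweedler sums -/

/-- Linearity over `k` of a function, as a proposition about the bare function. -/
@[fun_prop]
structure Lin (k : Type*) [Field k] {V U : Type*} [AddCommGroup V] [Module k V] [AddCommGroup U]
    [Module k U] (f : V → U) : Prop where
  map_add' : ∀ x y, f (x + y) = f x + f y
  map_smul' : ∀ (c : k) x, f (c • x) = c • f x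

section Sweedler

variable {k : Type*} [Field k] {V W X U U' V' W' : Type*} [AddCommGroup V] [Module k V]
  [AddCommGroup W] [Module k W] [AddCommGroup X] [Module k X] [AddCommGroup U] [Module k U]
  [AddCommGroup U'] [Module k U'] [AddCommGroup V'] [Module k V'] [AddCommGroup W'] [Module k W']

namespace Lin

/-- The bundled linear map of a linear function. -/
def toLinearMap {f : V → U} (h : Lin k f) : V →ₗ[k] U := ⟨⟨f, h.map_add'⟩, h.map_smul'⟩

@[simp] theorem toLinearMap_apply {f : V → U} (h : Lin k f) (x : V) : h.toLinearMap x = f x := rfl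

theorem map_zero' {f : V → U} (h : Lin k f) : f 0 = 0 := h.toLinearMap.map_zero

@[fun_prop] theorem id' : Lin k (fun x : V => x) := ⟨fun _ _ => rfl, fun _ _ => rfl⟩

@[fun_prop] theorem comp {g : U → U'} {f : V → U} (hg : Lin k g) (hf : Lin k f) :
    Lin k (fun x => g (f x)) :=
  ⟨fun x y => by rw [hf.map_add', hg.map_add'], fun c x => by rw [hf.map_smul', hg.map_smul']⟩

@[fun_prop] theorem coe (L : V →ₗ[k] U) : Lin k (fun x => L x) := ⟨L.map_add, L.map_smul⟩

theorem coe_left {f : V → U →ₗ[k] U'} (hf : Lin k f) (u : U) : Lin k (fun x => f x u) :=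
  ⟨fun x y => by rw [hf.map_add', LinearMap.add_apply],
    fun c x => by rw [hf.map_smul', LinearMap.smul_apply]⟩

@[fun_prop] theorem mul_const {A : Type*} [Ring A] [Algebra k A] {f : V → A} (hf : Lin k f)
    (a : A) : Lin k (fun x => f x * a) :=
  ⟨fun x y => by rw [hf.map_add', add_mul], fun c x => by rw [hf.map_smul', smul_mul_assoc]⟩

@[fun_prop] theorem const_mul {A : Type*} [Ring A] [Algebra k A] {f : V → A} (hf : Lin k f)
    (a : A) : Lin k (fun x => a * f x) :=
  ⟨fun x y => by rw [hf.map_add', mul_add], fun c x => by rw [hf.map_smul', mul_smul_comm]⟩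

@[fun_prop] theorem smul_const {f : V → k} (hf : Lin k f) (a : U) : Lin k (fun x => f x • a) :=
  ⟨fun x y => by rw [hf.map_add', add_smul], fun c x => by rw [hf.map_smul', smul_assoc]⟩

@[fun_prop] theorem asmul_const {A : Type*} [Ring A] [Algebra k A] [Module A U]
    [IsScalarTower k A U] {f : V → A} (hf : Lin k f) (a : U) : Lin k (fun x => f x • a) :=
  ⟨fun x y => by rw [hf.map_add', add_smul], fun c x => by rw [hf.map_smul', smul_assoc]⟩

@[fun_prop] theorem const_asmul {A : Type*} [Ring A] [Algebra k A] [Module A U]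
    [IsScalarTower k A U] {f : V → U} (hf : Lin k f) (a : A) : Lin k (fun x => a • f x) :=
  ⟨fun x y => by rw [hf.map_add', smul_add],
    fun c x => by rw [hf.map_smul', ← algebraMap_smul A c (f x), ← algebraMap_smul A c (a • f x),
      smul_smul, smul_smul, Algebra.commutes]⟩

@[fun_prop] theorem tmul_const {f : V → W} (hf : Lin k f) (a : U) : Lin k (fun x => f x ⊗ₜ[k] a) :=
  ⟨fun x y => by rw [hf.map_add', add_tmul], fun c x => by rw [hf.map_smul', smul_tmul']⟩

@[fun_prop] theorem const_tmul {f : V → W} (hf : Lin k f) (a : U) : Lin k (fun x => a ⊗ₜ[k] f x) :=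
  ⟨fun x y => by rw [hf.map_add', tmul_add], fun c x => by rw [hf.map_smul', tmul_smul]⟩

end Lin

theorem exists_rep (t : V ⊗[k] W) :
    ∃ l : List (V × W), t = (l.map fun p => p.1 ⊗ₜ[k] p.2).sum := by
  induction t with
  | zero => exact ⟨[], rfl⟩
  | tmul x y => exact ⟨[(x, y)], by simp⟩
  | add s t hs ht =>
    obtain ⟨l, rfl⟩ := hs
    obtain ⟨l', rfl⟩ := ht
    exact ⟨l ++ l', by simp⟩

/-- The Sweedler sum `∑ F xᵢ yᵢ` for a tensor `t = ∑ xᵢ ⊗ yᵢ`. It depends on the chosen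
presentation of `t` only if `F` is not bilinear. -/
def sw (t : V ⊗[k] W) (F : V → W → U) : U := ((exists_rep t).choose.map fun p => F p.1 p.2).sum

/-- The chosen presentation depends on `t` alone, so linear maps pass through the sum with no
bilinearity assumption on `F`. -/
theorem Lin.map_sw {g : U → U'} (hg : Lin k g) (t : V ⊗[k] W) (F : V → W → U) :
    g (sw t F) = sw t fun x y => g (F x y) := by
  unfold sw
  generalize (exists_rep t).choose = l
  induction l with
  | nil => simpa using hg.map_zero'
  | cons p l ih => simp [hg.map_add', ih]

theorem sw_congr {t : V ⊗[k] W} {F G : V → W → U} (h : ∀ x y, F x y = G x y) : sw t F = sw t G := by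
  unfold sw
  simp only [h]

/-- For bilinear `F` the sum is the value at `t` of the induced linear map, hence independent of the
presentation. Every rewriting that changes the tensor itself rests on this. -/
theorem sw_eq (t : V ⊗[k] W) {F : V → W → U} (h1 : ∀ y, Lin k fun x => F x y)
    (h2 : ∀ x, Lin k fun y => F x y) :
    sw t F = TensorProduct.lift (LinearMap.mk₂ k F (fun x x' y => (h1 y).map_add' x x')
      (fun c x y => (h1 y).map_smul' c x) (fun x y y' => (h2 x).map_add' y y')
      (fun c x y => (h2 x).map_smul' c y)) t := by
  conv_rhs => rw [(exists_rep t).choose_spec]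
  unfold sw
  generalize (exists_rep t).choose = l
  induction l with
  | nil => simp
  | cons p l ih => simp [ih]

@[fun_prop] theorem Lin.sw_fun {t : V ⊗[k] W} {F : X → V → W → U}
    (h : ∀ v w, Lin k fun x => F x v w) : Lin k fun x => sw t (F x) := by
  unfold sw
  generalize (exists_rep t).choose = l
  induction l with
  | nil => exact ⟨by simp, by simp⟩
  | cons p l ih =>
    exact ⟨fun x y => by simpa [(h _ _).map_add', ih.map_add'] using by abel,
      fun c x => by simpa [(h _ _).map_smul'] using ih.map_smul' c x⟩

@[fun_prop] theorem Lin.sw_arg {t : X → V ⊗[k] W} {F : V → W → U} (ht : Lin k t)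
    (h1 : ∀ y, Lin k fun x => F x y) (h2 : ∀ x, Lin k fun y => F x y) :
    Lin k fun x => sw (t x) F := by
  simp only [sw_eq _ h1 h2]
  fun_prop

theorem sw_self (t : V ⊗[k] W) : sw t (fun x y => x ⊗ₜ[k] y) = t :=
  (exists_rep t).choose_spec.symm

theorem apply_eq_sw (L : V ⊗[k] W →ₗ[k] U) (t : V ⊗[k] W) :
    L t = sw t fun x y => L (x ⊗ₜ y) := by
  conv_lhs => rw [← sw_self t]
  exact (Lin.coe L).map_sw t _

theorem sw_tmul (v : V) (w : W) {F : V → W → U} (h1 : ∀ y, Lin k fun x => F x y)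
    (h2 : ∀ x, Lin k fun y => F x y) : sw (v ⊗ₜ[k] w) F = F v w := by
  rw [sw_eq _ h1 h2]; simp

/-- Sweedler sums over a Sweedler sum. -/
theorem sw_sw (t : V ⊗[k] W) (G : V → W → V' ⊗[k] W') {F : V' → W' → U}
    (h1 : ∀ y, Lin k fun x => F x y) (h2 : ∀ x, Lin k fun y => F x y) :
    sw (sw t G) F = sw t fun x y => sw (G x y) F :=
  (Lin.sw_arg Lin.id' h1 h2).map_sw t G

/-- Both sides are finite double sums over two fixed lists, so no linearity is needed. The lists
must not depend on the variables of the other sum. -/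
theorem sw_comm (t : V ⊗[k] W) (s : V' ⊗[k] W') (F : V → W → V' → W' → U) :
    (sw t fun v w => sw s fun x y => F v w x y) = sw s fun x y => sw t fun v w => F v w x y := by
  unfold sw
  generalize (exists_rep t).choose = l
  generalize (exists_rep s).choose = l'
  induction l with
  | nil => simp
  | cons p l ih => simp [ih, List.sum_map_add]

/-- The standard reduction to pure tensors: two linear functions of `t` are compared by rewriting
both as sums over the same presentation and applying `sw_congr`. -/
theorem Lin.tensor_eq {f : V ⊗[k] W → U} (hf : Lin k f) (t : V ⊗[k] W) :
    f t = sw t fun x y => f (x ⊗ₜ y) :=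
  apply_eq_sw hf.toLinearMap t

theorem sw_map (L : V →ₗ[k] V') (M : W →ₗ[k] W') (t : V ⊗[k] W) {F : V' → W' → U}
    (h1 : ∀ y, Lin k fun x => F x y) (h2 : ∀ x, Lin k fun y => F x y) :
    sw (TensorProduct.map L M t) F = sw t fun x y => F (L x) (M y) := by
  refine (Lin.tensor_eq (f := fun t => sw (TensorProduct.map L M t) F) (by fun_prop) t).trans
    (sw_congr fun x y => ?_)
  rw [TensorProduct.map_tmul, sw_tmul _ _ h1 h2]

theorem sw_rTensor (L : V →ₗ[k] V') (t : V ⊗[k] W) {F : V' → W → U}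
    (h1 : ∀ y, Lin k fun x => F x y) (h2 : ∀ x, Lin k fun y => F x y) :
    sw (L.rTensor W t) F = sw t fun x y => F (L x) y :=
  sw_map L LinearMap.id t h1 h2

theorem sw_lTensor (M : W →ₗ[k] W') (t : V ⊗[k] W) {F : V → W' → U}
    (h1 : ∀ y, Lin k fun x => F x y) (h2 : ∀ x, Lin k fun y => F x y) :
    sw (M.lTensor V t) F = sw t fun x y => F x (M y) :=
  sw_map LinearMap.id M t h1 h2

theorem sw_flip (t : V ⊗[k] W) {F : W → V → U}
    (h1 : ∀ y, Lin k fun x => F x y) (h2 : ∀ x, Lin k fun y => F x y) :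
    sw (TensorProduct.comm k V W t) F = sw t fun x y => F y x := by
  refine (Lin.tensor_eq (f := fun t => sw ((TensorProduct.comm k V W).toLinearMap t) F)
    (by fun_prop) t).trans (sw_congr fun x y => ?_)
  rw [LinearEquiv.coe_coe, TensorProduct.comm_tmul, sw_tmul _ _ h1 h2]

theorem sw_assoc (s : (V ⊗[k] W) ⊗[k] X) {F : V → W → X → U} (h1 : ∀ y z, Lin k fun x => F x y z)
    (h2 : ∀ x z, Lin k fun y => F x y z) (h3 : ∀ x y, Lin k fun z => F x y z) :
    (sw (TensorProduct.assoc k V W X s) fun x t => sw t fun y z => F x y z) =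
      sw s fun t z => sw t fun x y => F x y z := by
  refine (Lin.tensor_eq (f := fun s => sw ((TensorProduct.assoc k V W X).toLinearMap s)
    fun x t => sw t fun y z => F x y z) (by fun_prop) s).trans (sw_congr fun t z => ?_)
  refine (Lin.tensor_eq (f := fun t => sw ((TensorProduct.assoc k V W X).toLinearMap (t ⊗ₜ z))
    fun x t => sw t fun y z => F x y z) (by fun_prop) t).trans (sw_congr fun x y => ?_)
  rw [LinearEquiv.coe_coe, TensorProduct.assoc_tmul, sw_tmul, sw_tmul]
  all_goals intros; fun_prop

theorem sw_assoc_symm (s : V ⊗[k] (W ⊗[k] X)) {F : V → W → X → U}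
    (h1 : ∀ y z, Lin k fun x => F x y z)
    (h2 : ∀ x z, Lin k fun y => F x y z) (h3 : ∀ x y, Lin k fun z => F x y z) :
    (sw ((TensorProduct.assoc k V W X).symm s) fun t z => sw t fun x y => F x y z) =
      sw s fun x t => sw t fun y z => F x y z := by
  rw [← sw_assoc _ h1 h2 h3, LinearEquiv.apply_symm_apply]

end Sweedler

section Coalg

variable {k C V : Type*} [Field k] [AddCommGroup C] [Module k C] [Coalgebra k C]
  {U : Type*} [AddCommGroup U] [Module k U]

theorem sw_coassoc (c : C) {F : C → C → C → U} (h1 : ∀ y z, Lin k fun x => F x y z)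
    (h2 : ∀ x z, Lin k fun y => F x y z) (h3 : ∀ x y, Lin k fun z => F x y z) :
    (sw (comul (R := k) c) fun x z => sw (comul (R := k) x) fun x y => F x y z) =
      sw (comul (R := k) c) fun x y => sw (comul (R := k) y) fun y z => F x y z := by
  have key := congrArg (fun t => sw t fun x t => sw t fun y z => F x y z)
    (Coalgebra.coassoc_apply (R := k) c)
  rw [sw_assoc _ h1 h2 h3, sw_rTensor, sw_lTensor] at key
  · exact key
  all_goals intros; fun_prop

theorem sw_counit_left (c : C) {F : C → U} (h : Lin k F) :
    (sw (comul (R := k) c) fun x y => counit (R := k) x • F y) = F c := by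
  have key := congrArg (fun t => sw t fun x y => x • F y)
    (Coalgebra.rTensor_counit_comul (R := k) c)
  rw [sw_rTensor, sw_tmul] at key
  · simpa using key
  all_goals intros; fun_prop

theorem sw_counit_right (c : C) {F : C → U} (h : Lin k F) :
    (sw (comul (R := k) c) fun x y => counit (R := k) y • F x) = F c := by
  have key := congrArg (fun t => sw t fun x y => y • F x)
    (Coalgebra.lTensor_counit_comul (R := k) c)
  rw [sw_lTensor, sw_tmul] at key
  · simpa using key
  all_goals intros; fun_prop

end Coalg

section Hopf

variable {k H : Type u} [Field k] [Ring H] [HopfAlgebra k H]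
  {U : Type*} [AddCommGroup U] [Module k U]

theorem sw_comul_mul (x y : H) {F : H → H → U}
    (h1 : ∀ y, Lin k fun x => F x y) (h2 : ∀ x, Lin k fun y => F x y) :
    sw (comul (R := k) (x * y)) F = sw (comul (R := k) x) fun x x' =>
      sw (comul (R := k) y) fun y y' => F (x * y) (x' * y') := by
  rw [Bialgebra.comul_mul]
  generalize comul (R := k) x = s
  generalize comul (R := k) y = t
  refine (Lin.tensor_eq (f := fun s => sw (s * t) F) (by fun_prop) s).trans
    (sw_congr fun x x' => ?_)
  refine (Lin.tensor_eq (f := fun t => sw (_ * t) F) (by fun_prop) t).trans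
    (sw_congr fun y y' => ?_)
  rw [Algebra.TensorProduct.tmul_mul_tmul, sw_tmul _ _ h1 h2]

theorem sw_comul_one {F : H → H → U}
    (h1 : ∀ y, Lin k fun x => F x y) (h2 : ∀ x, Lin k fun y => F x y) :
    sw (comul (R := k) (1 : H)) F = F 1 1 := by
  rw [Bialgebra.comul_one, Algebra.TensorProduct.one_def, sw_tmul _ _ h1 h2]

theorem sw_antipode_mul (F : H → U) (h : Lin k F) (x : H) :
    (sw (comul (R := k) x) fun x y => F (HopfAlgebra.antipode k x * y)) =
      counit (R := k) x • F 1 := by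
  have key := congrArg F (HopfAlgebra.mul_antipode_rTensor_comul_apply (R := k) x)
  have e := Lin.tensor_eq (f := fun t => F (LinearMap.mul' k H
    ((HopfAlgebra.antipode k).rTensor H t))) (by fun_prop) (comul (R := k) x)
  simpa [Algebra.algebraMap_eq_smul_one, h.map_smul'] using e.symm.trans key

theorem sw_mul_antipode (F : H → U) (h : Lin k F) (x : H) :
    (sw (comul (R := k) x) fun x y => F (x * HopfAlgebra.antipode k y)) =
      counit (R := k) x • F 1 := by
  have key := congrArg F (HopfAlgebra.mul_antipode_lTensor_comul_apply (R := k) x)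
  have e := Lin.tensor_eq (f := fun t => F (LinearMap.mul' k H
    ((HopfAlgebra.antipode k).lTensor H t))) (by fun_prop) (comul (R := k) x)
  simpa [Algebra.algebraMap_eq_smul_one, h.map_smul'] using e.symm.trans key

end Hopf

end

section

/-! ### Convolution identities in `H` and first properties of the `r`-form -/

section Hopf

variable {k H : Type u} [Field k] [Ring H] [HopfAlgebra k H]
  {U : Type*} [AddCommGroup U] [Module k U]

local notation "Δ" => comul (R := k)
local notation "ε" => counit (R := k)
local notation "S" => HopfAlgebra.antipode k (A := H)

theorem conv_apply {C T : Type*} [AddCommGroup C] [Module k C] [Coalgebra k C] [Ring T]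
    [Algebra k T] (f g : WithConv (C →ₗ[k] T)) (c : C) :
    (f * g).ofConv c = sw (Δ c) fun x y => f.ofConv x * g.ofConv y := by
  rw [LinearMap.convMul_def]
  refine (apply_eq_sw (LinearMap.mul' k T ∘ₗ TensorProduct.map f.ofConv g.ofConv) (Δ c)).trans
    (sw_congr fun x y => ?_)
  simp

theorem sw_comul_tmul {C D : Type*} [AddCommGroup C] [Module k C] [Coalgebra k C]
    [AddCommGroup D] [Module k D] [Coalgebra k D] (c : C) (d : D) {F : C ⊗[k] D → C ⊗[k] D → U}
    (h1 : ∀ y, Lin k fun x => F x y) (h2 : ∀ x, Lin k fun y => F x y) :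
    sw (Δ (c ⊗ₜ[k] d)) F = sw (Δ c) fun c c' => sw (Δ d) fun d d' =>
      F (c ⊗ₜ d) (c' ⊗ₜ d') := by
  have e : Δ (c ⊗ₜ[k] d) = TensorProduct.tensorTensorTensorComm k C C D D (Δ c ⊗ₜ Δ d) := rfl
  rw [e]
  refine (Lin.tensor_eq (f := fun t => sw ((TensorProduct.tensorTensorTensorComm k C C D D).toLinearMap
    (t ⊗ₜ Δ d)) F) (by fun_prop) (Δ c)).trans (sw_congr fun x y => ?_)
  refine (Lin.tensor_eq (f := fun t => sw ((TensorProduct.tensorTensorTensorComm k C C D D).toLinearMap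
    (_ ⊗ₜ t)) F) (by fun_prop) (Δ d)).trans (sw_congr fun x' y' => ?_)
  rw [LinearEquiv.coe_coe, TensorProduct.tensorTensorTensorComm_tmul, sw_tmul _ _ h1 h2]

/-- The antipode is an anti-coalgebra map. -/
theorem sw_comul_antipode (x : H) {F : H → H → U}
    (h1 : ∀ y, Lin k fun x => F x y) (h2 : ∀ x, Lin k fun y => F x y) :
    sw (Δ (S x)) F = sw (Δ x) fun x y => F (S y) (S x) := by
  -- Uniqueness of convolution inverses in Hom(H, H ⊗ H): Δ ∘ S is a left inverse of Δ, and (S ⊗ S)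
  -- ∘ τ ∘ Δ, with τ the flip, is a right inverse.
  let f : WithConv (H →ₗ[k] H ⊗[k] H) := WithConv.toConv (comul ∘ₗ S)
  let g : WithConv (H →ₗ[k] H ⊗[k] H) := WithConv.toConv comul
  let h : WithConv (H →ₗ[k] H ⊗[k] H) := WithConv.toConv
    (TensorProduct.map S S ∘ₗ (TensorProduct.comm k H H).toLinearMap ∘ₗ comul)
  have hfg : f * g = 1 := by
    apply WithConv.ofConv_injective
    ext x
    rw [conv_apply]
    change (sw (Δ x) fun x y => Δ (S x) * Δ y) = algebraMap _ _ (ε x)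
    simp only [← Bialgebra.comul_mul]
    rw [sw_antipode_mul (fun x => Δ x) (by fun_prop), Bialgebra.comul_one,
      Algebra.algebraMap_eq_smul_one]
  have hgh : g * h = 1 := by
    apply WithConv.ofConv_injective
    ext x
    rw [conv_apply]
    have e : ∀ y, h.ofConv y = sw (Δ y) fun u v => S v ⊗ₜ S u := fun y => by
      rw [← sw_self (h.ofConv y)]
      change sw (TensorProduct.map S S (TensorProduct.comm k H H (Δ y))) _ = _
      rw [sw_map, sw_flip]
      all_goals intros; fun_prop
    calc (sw (Δ x) fun x y => g.ofConv x * h.ofConv y)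
        = sw (Δ x) fun x y => sw (Δ x) fun a b => sw (Δ y) fun u v => (a * S v) ⊗ₜ (b * S u) :=
          sw_congr fun x y => by
            rw [e, (Lin.const_mul Lin.id' _).map_sw]
            change (sw (Δ y) fun u v => Δ x * _) = _
            rw [sw_comm]
            refine sw_congr fun u v => ?_
            conv_lhs => rw [← sw_self (Δ x)]
            rw [(Lin.mul_const Lin.id' _).map_sw]
            simp only [Algebra.TensorProduct.tmul_mul_tmul]
      _ = sw (Δ x) fun a y => sw (Δ y) fun b y => sw (Δ y) fun u v =>
            (a * S v) ⊗ₜ (b * S u) := by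
          rw [sw_coassoc]
          all_goals intros; fun_prop
      _ = sw (Δ x) fun a y => sw (Δ y) fun y v => sw (Δ y) fun b u =>
            (a * S v) ⊗ₜ (b * S u) :=
          sw_congr fun a y => by
            rw [sw_coassoc]
            all_goals intros; fun_prop
      _ = sw (Δ x) fun a y => (a * S y) ⊗ₜ 1 := sw_congr fun a y => by
          rw [← sw_counit_left (F := fun v => (a * S v) ⊗ₜ[k] (1 : H)) _ (by fun_prop)]
          exact sw_congr fun y v =>
            sw_mul_antipode (fun t => (a * S v) ⊗ₜ[k] t) (by fun_prop) y
      _ = _ := by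
          rw [sw_mul_antipode (fun t => t ⊗ₜ[k] (1 : H)) (by fun_prop)]
          change _ = algebraMap _ _ (ε x)
          rw [Algebra.algebraMap_eq_smul_one, Algebra.TensorProduct.one_def]
  have key : Δ (S x) = TensorProduct.map S S (TensorProduct.comm k H H (Δ x)) :=
    congrArg (fun f => f.ofConv x) (left_inv_eq_right_inv hfg hgh)
  rw [key, sw_map, sw_flip]
  all_goals intros; fun_prop

namespace UniversalRForm

variable (R : UniversalRForm k H)

theorem sw_r_rInv (x y : H) :
    (sw (Δ x) fun x x' => sw (Δ y) fun y y' => R.r (x ⊗ₜ y) * R.rInv (x' ⊗ₜ y')) = ε x * ε y := by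
  have key := congrArg (fun f => f.ofConv (x ⊗ₜ y)) R.invRight
  simp only [conv_apply] at key
  rw [sw_comul_tmul] at key
  · refine key.trans ?_
    change ε y • ε x = _
    rw [smul_eq_mul, _root_.mul_comm]
  all_goals intros; fun_prop

theorem r_mul_left (x y z : H) :
    R.r ((x * y) ⊗ₜ z) = sw (Δ z) fun z z' => R.r (x ⊗ₜ z) * R.r (y ⊗ₜ z') := by
  rw [R.mul_left]
  exact apply_eq_sw (LinearMap.mul' k k ∘ₗ TensorProduct.map (R.r ∘ₗ TensorProduct.mk k H H x)
    (R.r ∘ₗ TensorProduct.mk k H H y)) (Δ z)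

theorem r_mul_right (x y z : H) :
    R.r (x ⊗ₜ (y * z)) = sw (Δ x) fun x x' => R.r (x ⊗ₜ z) * R.r (x' ⊗ₜ y) := by
  rw [R.mul_right]
  exact apply_eq_sw (LinearMap.mul' k k ∘ₗ TensorProduct.map
    (R.r ∘ₗ (TensorProduct.mk k H H).flip z) (R.r ∘ₗ (TensorProduct.mk k H H).flip y)) (Δ x)

/-- This is the commutation axiom convolved on the right with `r`, which removes `rInv`. In this
form it exchanges the two orders of multiplication at the price of moving `r` to the other legs. -/
theorem sw_r_comm (x y : H) (F : H → U) (hF : Lin k F) :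
    (sw (Δ x) fun x x' => sw (Δ y) fun y y' => R.r (x' ⊗ₜ y') • F (y * x)) =
      sw (Δ x) fun x x' => sw (Δ y) fun y y' => R.r (x ⊗ₜ y) • F (x' * y') := by
  have hinv : WithConv.toConv (Algebra.linearMap k H ∘ₗ R.rInv) *
      WithConv.toConv (Algebra.linearMap k H ∘ₗ R.r) = 1 := by
    have e := LinearMap.algHom_comp_convMul_distrib (Algebra.ofId k H) (WithConv.toConv R.rInv)
      (WithConv.toConv R.r)
    rw [R.invLeft] at e
    apply WithConv.ofConv_injective
    refine Eq.trans e.symm ?_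
    ext x
    rfl
  have e := congrArg (· * WithConv.toConv (Algebra.linearMap k H ∘ₗ R.r)) R.mul_comm
  simp only [mul_assoc, hinv, mul_one] at e
  have key := congrArg (fun f => F (f.ofConv (x ⊗ₜ y))) e
  simp only [conv_apply] at key
  rw [sw_comul_tmul, sw_comul_tmul, hF.map_sw, hF.map_sw] at key
  · simp only [hF.map_sw] at key
    simpa [← Algebra.smul_def, ← Algebra.commutes, hF.map_smul'] using key
  all_goals intros; fun_prop

/-! ### The antipode of a coquasitriangular Hopf algebra -/

/-- An idempotent with a right inverse in a monoid is the identity. It applies to r(1, -) and r(-,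
1), whose idempotence is the multiplicativity of `r` at 1 = 1 · 1. -/
theorem _root_.BraidedHoch.eq_counit_of_idempotent {C : Type*} [AddCommGroup C] [Module k C]
    [Coalgebra k C] {f g : C →ₗ[k] k} (hf : ∀ z, f z = sw (Δ z) fun x y => f x * f y)
    (hg : ∀ z, (sw (Δ z) fun x y => f x * g y) = ε z) (z : C) : f z = ε z := by
  have h1 : WithConv.toConv f * WithConv.toConv g = 1 := by
    apply WithConv.ofConv_injective
    ext z
    rw [conv_apply]
    exact hg z
  have h2 : WithConv.toConv f * WithConv.toConv f = WithConv.toConv f := by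
    apply WithConv.ofConv_injective
    ext z
    rw [conv_apply]
    exact (hf z).symm
  have h3 : WithConv.toConv f = 1 := by
    calc WithConv.toConv f = WithConv.toConv f * (WithConv.toConv f * WithConv.toConv g) := by
          rw [h1, mul_one]
      _ = 1 := by rw [← mul_assoc, h2, h1]
  exact congrArg (fun f => f.ofConv z) h3

theorem r_one_left (z : H) : R.r (1 ⊗ₜ z) = ε z := by
  refine eq_counit_of_idempotent (f := R.r ∘ₗ TensorProduct.mk k H H 1)
    (g := R.rInv ∘ₗ TensorProduct.mk k H H 1) (fun z => ?_) (fun z => ?_) z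
  · have := R.r_mul_left 1 1 z
    rwa [mul_one] at this
  · have := R.sw_r_rInv 1 z
    rw [sw_comul_one, Bialgebra.counit_one, one_mul] at this
    · exact this
    all_goals intros; fun_prop

theorem r_one_right (z : H) : R.r (z ⊗ₜ 1) = ε z := by
  refine eq_counit_of_idempotent (f := R.r ∘ₗ (TensorProduct.mk k H H).flip 1)
    (g := R.rInv ∘ₗ (TensorProduct.mk k H H).flip 1) (fun z => ?_) (fun z => ?_) z
  · have := R.r_mul_right z 1 1
    rwa [mul_one] at this
  · have := R.sw_r_rInv z 1
    rw [Bialgebra.counit_one, mul_one] at this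
    refine Eq.trans (sw_congr fun x y => ?_) this
    rw [sw_comul_one]
    · rfl
    all_goals intros; fun_prop

/-- Since r(x₁, y₁) r(S x₂, y₂) = r(x₁ S x₂, y) = ε(x) ε(y), the form r(S -, -) is a right inverse
of `r`. -/
theorem rInv_eq (x y : H) : R.rInv (x ⊗ₜ y) = R.r (S x ⊗ₜ y) := by
  have h : WithConv.toConv R.r * WithConv.toConv (R.r ∘ₗ (HopfAlgebra.antipode k).rTensor H) = 1 := by
    apply WithConv.ofConv_injective
    refine TensorProduct.ext' fun x y => ?_
    rw [conv_apply, sw_comul_tmul]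
    · calc (sw (Δ x) fun x x' => sw (Δ y) fun y y' => R.r (x ⊗ₜ y) * R.r (S x' ⊗ₜ y'))
          = sw (Δ x) fun x x' => R.r ((x * S x') ⊗ₜ y) := sw_congr fun x x' => by
            rw [R.r_mul_left]
        _ = ε x • ε y := by
            rw [sw_mul_antipode (fun t => R.r (t ⊗ₜ y)) (by fun_prop), r_one_left]
        _ = ε y • ε x := _root_.mul_comm _ _
    all_goals intros; fun_prop
  exact congrArg (fun f => f.ofConv (x ⊗ₜ y)) (left_inv_eq_right_inv R.invLeft h)

/-- Both `r` and r(S -, S -) are inverse to `rInv` = r(S -, -): the product of `rInv` with r(S -, S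
-) collapses through y₁ S(y₂) in the second argument. -/
theorem r_antipode_antipode (x y : H) : R.r (S x ⊗ₜ S y) = R.r (x ⊗ₜ y) := by
  have h : WithConv.toConv R.rInv * WithConv.toConv (R.r ∘ₗ
      TensorProduct.map (HopfAlgebra.antipode k) (HopfAlgebra.antipode k)) = 1 := by
    apply WithConv.ofConv_injective
    refine TensorProduct.ext' fun x y => ?_
    rw [conv_apply, sw_comul_tmul]
    · calc (sw (Δ x) fun x x' => sw (Δ y) fun y y' => R.rInv (x ⊗ₜ y) * R.r (S x' ⊗ₜ S y'))
          = sw (Δ y) fun y y' => sw (Δ x) fun x x' => R.r (S x' ⊗ₜ S y') * R.r (S x ⊗ₜ y) := by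
            rw [sw_comm]
            exact sw_congr fun y y' => sw_congr fun x x' => by rw [rInv_eq, _root_.mul_comm]
        _ = sw (Δ y) fun y y' => R.r (S x ⊗ₜ (y * S y')) := sw_congr fun y y' => by
            rw [R.r_mul_right, sw_comul_antipode]
            all_goals intros; fun_prop
        _ = ε y • ε x := by
            rw [sw_mul_antipode (fun t => R.r (S x ⊗ₜ t)) (by fun_prop), r_one_right,
              HopfAlgebra.counit_antipode]
    all_goals intros; fun_prop
  exact (congrArg (fun f => f.ofConv (x ⊗ₜ y)) (left_inv_eq_right_inv R.invRight h)).symm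

/-- The functional `x ↦ r(x₍₁₎, S(x₍₂₎))`. -/
def drinfeld : H →ₗ[k] k := Lin.toLinearMap (k := k)
  (f := fun x => sw (Δ x) fun x y => R.r (x ⊗ₜ S y)) (by fun_prop)

/-- The convolution inverse `x ↦ r(S²(x₍₁₎), x₍₂₎)` of `drinfeld`. -/
def drinfeldInv : H →ₗ[k] k := Lin.toLinearMap (k := k)
  (f := fun x => sw (Δ x) fun x y => R.r (S (S x) ⊗ₜ y)) (by fun_prop)

theorem drinfeld_apply (x : H) : R.drinfeld x = sw (Δ x) fun x y => R.r (x ⊗ₜ S y) := rfl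

theorem drinfeldInv_apply (x : H) : R.drinfeldInv x = sw (Δ x) fun x y => R.r (S (S x) ⊗ₜ y) := rfl

/-- The relation u(x₂) x₁ = u(x₁) S²(x₂). It comes from the commutation of x₁ with S(x₂), multiplied
on the left by S²(x₃): on one side S²(x₃) cancels against a factor S, on the other the leg of x₁
does. -/
theorem sw_drinfeld (x : H) (F : H → U) (hF : Lin k F) :
    (sw (Δ x) fun x y => R.drinfeld y • F x) =
      sw (Δ x) fun x y => R.drinfeld x • F (S (S y)) := by
  have key : (sw (Δ x) fun a b => sw (Δ b) fun t w => sw (Δ a) fun a a' => sw (Δ (S t)) fun s s' =>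
      R.r (a' ⊗ₜ s') • F (S (S w) * (s * a))) =
      sw (Δ x) fun a b => sw (Δ b) fun t w => sw (Δ a) fun a a' => sw (Δ (S t)) fun s s' =>
      R.r (a ⊗ₜ s) • F (S (S w) * (a' * s')) :=
    sw_congr fun a b => sw_congr fun t w =>
      R.sw_r_comm a (S t) (fun y => F (S (S w) * y)) (by fun_prop)
  refine Eq.trans (Eq.symm ?_) (key.trans ?_)
  · calc (sw (Δ x) fun a b => sw (Δ b) fun t w => sw (Δ a) fun a a' => sw (Δ (S t)) fun s s' =>
        R.r (a' ⊗ₜ s') • F (S (S w) * (s * a)))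
        = sw (Δ x) fun a b => sw (Δ a) fun a a' => sw (Δ b) fun t w => sw (Δ t) fun t t' =>
            R.r (a' ⊗ₜ S t) • F (S (t' * S w) * a) := sw_congr fun a b => by
          rw [sw_comm]
          refine sw_congr fun a a' => sw_congr fun t w => ?_
          rw [sw_comul_antipode]
          · simp only [HopfAlgebra.antipode_mul_antidistrib, mul_assoc]
          all_goals intros; fun_prop
      _ = sw (Δ x) fun a b => sw (Δ a) fun a a' => R.r (a' ⊗ₜ S b) • F a :=
          sw_congr fun a b => sw_congr fun a a' => by
            rw [sw_coassoc, ← sw_counit_right (F := fun b => R.r (a' ⊗ₜ S b) • F a) b (by fun_prop)]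
            · refine sw_congr fun t w => ?_
              rw [sw_mul_antipode (fun y => R.r (a' ⊗ₜ S t) • F (S y * a)) (by fun_prop),
                HopfAlgebra.antipode_one, one_mul]
            all_goals intros; fun_prop
      _ = sw (Δ x) fun x y => sw (Δ y) fun a b => R.r (a ⊗ₜ S b) • F x := by
          rw [sw_coassoc]
          all_goals intros; fun_prop
      _ = _ := sw_congr fun x y => by
          rw [drinfeld_apply, Lin.map_sw (g := fun c => c • F x) (by fun_prop)]
  · calc (sw (Δ x) fun a b => sw (Δ b) fun t w => sw (Δ a) fun a a' => sw (Δ (S t)) fun s s' =>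
        R.r (a ⊗ₜ s) • F (S (S w) * (a' * s')))
        = sw (Δ x) fun a b => sw (Δ b) fun t w => sw (Δ a) fun a a' => sw (Δ t) fun t t' =>
            R.r (a ⊗ₜ S t') • F (S (S w) * (a' * S t)) :=
          sw_congr fun a b => sw_congr fun t w => sw_congr fun a a' => by
            rw [sw_comul_antipode]
            all_goals intros; fun_prop
      _ = sw (Δ x) fun c w => sw (Δ c) fun a t => sw (Δ a) fun a a' => sw (Δ t) fun t t' =>
            R.r (a ⊗ₜ S t') • F (S (S w) * (a' * S t)) := by
          rw [sw_coassoc]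
          all_goals intros; fun_prop
      _ = sw (Δ x) fun c w => sw (Δ c) fun a d => sw (Δ d) fun a' t => sw (Δ t) fun t t' =>
            R.r (a ⊗ₜ S t') • F (S (S w) * (a' * S t)) := sw_congr fun c w => by
          rw [sw_coassoc]
          all_goals intros; fun_prop
      _ = sw (Δ x) fun c w => sw (Δ c) fun a d => R.r (a ⊗ₜ S d) • F (S (S w)) :=
          sw_congr fun c w => sw_congr fun a d => by
            rw [← sw_coassoc,
              ← sw_counit_left (F := fun d => R.r (a ⊗ₜ S d) • F (S (S w))) d (by fun_prop)]
            · refine sw_congr fun e t => ?_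
              rw [sw_mul_antipode (fun y => R.r (a ⊗ₜ S t) • F (S (S w) * y)) (by fun_prop),
                mul_one]
            all_goals intros; fun_prop
      _ = _ := sw_congr fun c w => by
          rw [drinfeld_apply, Lin.map_sw (g := fun c => c • F (S (S w))) (by fun_prop)]

/-- Multiplicativity of `r` in its second argument joins the two values of `r` into one at S(v) z,
where v and z are adjacent legs that cancel. -/
theorem sw_r_drinfeld (x : H) : (sw (Δ x) fun x y => sw (Δ y) fun y z =>
    R.drinfeld y * R.r (x ⊗ₜ z)) = ε x := by
  calc (sw (Δ x) fun x y => sw (Δ y) fun y z => R.drinfeld y * R.r (x ⊗ₜ z))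
      = sw (Δ x) fun x y => sw (Δ y) fun y z => sw (Δ y) fun u v =>
          R.r (x ⊗ₜ z) * R.r (u ⊗ₜ S v) := sw_congr fun x y => sw_congr fun y z => by
        rw [drinfeld_apply, Lin.map_sw (g := fun c => c * R.r (x ⊗ₜ z)) (by fun_prop)]
        exact sw_congr fun u v => _root_.mul_comm _ _
    _ = sw (Δ x) fun x y => sw (Δ y) fun u y => sw (Δ y) fun v z =>
          R.r (x ⊗ₜ z) * R.r (u ⊗ₜ S v) := sw_congr fun x y => by
        rw [sw_coassoc]
        all_goals intros; fun_prop
    _ = sw (Δ x) fun x y => sw (Δ x) fun x u => sw (Δ y) fun v z =>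
          R.r (x ⊗ₜ z) * R.r (u ⊗ₜ S v) := by
        rw [sw_coassoc]
        all_goals intros; fun_prop
    _ = sw (Δ x) fun x y => ε y • ε x := sw_congr fun x y => by
        rw [sw_comm]
        simp only [← R.r_mul_right]
        rw [sw_antipode_mul (fun t => R.r (x ⊗ₜ t)) (by fun_prop), r_one_right]
    _ = _ := sw_counit_right x (by fun_prop)

/-- Moving S² across u by `sw_drinfeld` turns r(S² y, z) into r(y, z), and `sw_r_drinfeld` applies.
This one-sided inverse is all that the conjugation formula needs. -/
theorem sw_drinfeld_inv (x : H) : (sw (Δ x) fun x y => R.drinfeld x * R.drinfeldInv y) = ε x := by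
  calc (sw (Δ x) fun x y => R.drinfeld x * R.drinfeldInv y)
      = sw (Δ x) fun x y => sw (Δ y) fun y z => R.drinfeld x * R.r (S (S y) ⊗ₜ z) :=
        sw_congr fun x y => by
          rw [drinfeldInv_apply, Lin.map_sw (g := fun c => R.drinfeld x * c) (by fun_prop)]
    _ = sw (Δ x) fun x z => sw (Δ x) fun x y => R.drinfeld x • R.r (S (S y) ⊗ₜ z) := by
        rw [sw_coassoc]
        · rfl
        all_goals intros; fun_prop
    _ = sw (Δ x) fun x z => sw (Δ x) fun x y => R.drinfeld y • R.r (x ⊗ₜ z) :=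
        sw_congr fun x z => (R.sw_drinfeld x (fun y => R.r (y ⊗ₜ z)) (by fun_prop)).symm
    _ = sw (Δ x) fun x y => sw (Δ y) fun y z => R.drinfeld y * R.r (x ⊗ₜ z) := by
        rw [sw_coassoc]
        · rfl
        all_goals intros; fun_prop
    _ = _ := R.sw_r_drinfeld x

/-- Conjugation by `drinfeld`. -/
theorem sw_sw_drinfeld (x : H) : (sw (Δ x) fun x y => sw (Δ y) fun y z =>
    (R.drinfeld x * R.drinfeldInv z) • S (S y)) = x := by
  calc (sw (Δ x) fun x y => sw (Δ y) fun y z => (R.drinfeld x * R.drinfeldInv z) • S (S y))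
      = sw (Δ x) fun x z => sw (Δ x) fun x y => R.drinfeld x • R.drinfeldInv z • S (S y) := by
        rw [sw_coassoc]
        · simp only [smul_smul]
        all_goals intros; fun_prop
    _ = sw (Δ x) fun x z => sw (Δ x) fun x y => R.drinfeld y • R.drinfeldInv z • x :=
        sw_congr fun x z => (R.sw_drinfeld x (fun y => R.drinfeldInv z • y) (by fun_prop)).symm
    _ = sw (Δ x) fun x y => sw (Δ y) fun y z => (R.drinfeld y * R.drinfeldInv z) • x := by
        rw [sw_coassoc]
        · simp only [smul_smul]
        all_goals intros; fun_prop
    _ = sw (Δ x) fun x y => ε y • x := sw_congr fun x y => by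
        rw [← R.sw_drinfeld_inv y, Lin.map_sw (g := fun c => c • x) (by fun_prop)]
    _ = x := sw_counit_right x (by fun_prop)

/-- S² preserves the coproduct and `r` is invariant under S ⊗ S. The invariance makes conjugation by
u commute with S², so that one formula yields both one-sided inverses of S². -/
theorem drinfeld_antipode_antipode (x : H) : R.drinfeld (S (S x)) = R.drinfeld x := by
  rw [drinfeld_apply, sw_comul_antipode, sw_comul_antipode]
  · simp only [r_antipode_antipode]
    rw [drinfeld_apply]
  all_goals intros; fun_prop

theorem drinfeldInv_antipode_antipode (x : H) : R.drinfeldInv (S (S x)) = R.drinfeldInv x := by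
  rw [drinfeldInv_apply, sw_comul_antipode, sw_comul_antipode]
  · simp only [r_antipode_antipode]
    rw [drinfeldInv_apply]
  all_goals intros; fun_prop

/-- The antipode of a coquasitriangular Hopf algebra is bijective. -/
theorem antipode_bijective (R : UniversalRForm k H) : Function.Bijective (HopfAlgebra.antipode k (A := H)) := by
  -- N(x) = u(x₁) x₂ u⁻¹(x₃). Applying S² after N is `sw_sw_drinfeld`; applying it before gives the
  -- same expression because u and u⁻¹ are S²-invariant.
  let N : H → H := fun x => sw (Δ x) fun x y => sw (Δ y) fun y z =>
    (R.drinfeld x * R.drinfeldInv z) • y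
  have h1 : Function.RightInverse N (fun x => S (S x)) := fun x => by
    refine Eq.trans ?_ (R.sw_sw_drinfeld x)
    simp only [N]
    rw [Lin.map_sw (g := fun x => S (S x)) (by fun_prop)]
    refine sw_congr fun x y => ?_
    rw [Lin.map_sw (g := fun x => S (S x)) (by fun_prop)]
    simp only [map_smul]
  have h2 : Function.LeftInverse N (fun x => S (S x)) := fun x => by
    refine Eq.trans ?_ (R.sw_sw_drinfeld x)
    simp only [N]
    rw [sw_comul_antipode, sw_comul_antipode]
    · refine sw_congr fun x y => ?_
      rw [sw_comul_antipode, sw_comul_antipode]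
      · simp only [drinfeld_antipode_antipode, drinfeldInv_antipode_antipode]
      all_goals intros; fun_prop
    all_goals intros; fun_prop
  exact ⟨Function.Injective.of_comp (f := S) h2.injective,
    Function.Surjective.of_comp (g := S) h1.surjective⟩

end UniversalRForm
end Hopf

end

section

/-! ### Sweedler calculus for comodules -/

section Comodule

variable {k H : Type u} [Field k] [Ring H] [HopfAlgebra k H]
variable {V W : Type u} [AddCommGroup V] [Module k V] [AddCommGroup W] [Module k W]
variable {U : Type*} [AddCommGroup U] [Module k U]

theorem IsRightCoaction.sw_coassoc {ρ : V →ₗ[k] V ⊗[k] H} (hρ : IsRightCoaction ρ) (v : V)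
    {F : V → H → H → U} (h1 : ∀ y z, Lin k fun x => F x y z)
    (h2 : ∀ x z, Lin k fun y => F x y z) (h3 : ∀ x y, Lin k fun z => F x y z) :
    (sw (ρ v) fun x h => sw (ρ x) fun x h' => F x h' h) =
      sw (ρ v) fun x h => sw (comul (R := k) h) fun h h' => F x h h' := by
  have key := congrArg (fun t => sw t fun t z => sw t fun x y => F x y z)
    (LinearMap.congr_fun hρ.coassoc v)
  simp only [LinearMap.comp_apply, LinearEquiv.coe_coe] at key
  rw [sw_assoc_symm _ h1 h2 h3, sw_rTensor, sw_lTensor] at key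
  · exact key
  all_goals intros; fun_prop

theorem IsRightCoaction.sw_counit {ρ : V →ₗ[k] V ⊗[k] H} (hρ : IsRightCoaction ρ) (v : V)
    {F : V → U} (h : Lin k F) : (sw (ρ v) fun x h => Coalgebra.counit (R := k) h • F x) = F v := by
  have key := congrArg (fun t => sw t fun x c => c • F x) (LinearMap.congr_fun hρ.counit v)
  simp only [LinearMap.comp_apply, LinearMap.flip_apply, TensorProduct.mk_apply] at key
  rw [sw_lTensor, sw_tmul, one_smul] at key
  · exact key
  all_goals intros; fun_prop

theorem IsColinear.sw_apply {ρ : V →ₗ[k] V ⊗[k] H} {σ : W →ₗ[k] W ⊗[k] H} {f : V →ₗ[k] W}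
    (hf : IsColinear ρ σ f) (v : V) {F : W → H → U} (h1 : ∀ y, Lin k fun x => F x y)
    (h2 : ∀ x, Lin k fun y => F x y) :
    sw (σ (f v)) F = sw (ρ v) fun x h => F (f x) h := by
  rw [← sw_rTensor _ _ h1 h2]
  exact congrArg (fun t => sw t F) (LinearMap.congr_fun hf v)

theorem sw_tensorCoaction (ρ : V →ₗ[k] V ⊗[k] H) (σ : W →ₗ[k] W ⊗[k] H) (t : V ⊗[k] W)
    {F : V ⊗[k] W → H → U} (h1 : ∀ y, Lin k fun x => F x y) (h2 : ∀ x, Lin k fun y => F x y) :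
    sw (tensorCoaction ρ σ t) F = sw t fun v w => sw (ρ v) fun x h => sw (σ w) fun y h' =>
      F (x ⊗ₜ y) (h * h') := by
  refine (Lin.tensor_eq (f := fun t => sw (tensorCoaction ρ σ t) F) (by fun_prop) t).trans
    (sw_congr fun v w => ?_)
  simp only [tensorCoaction, LinearMap.comp_apply, TensorProduct.map_tmul, LinearEquiv.coe_coe]
  refine (Lin.tensor_eq (f := fun t => sw ((LinearMap.mul' k H).lTensor (V ⊗[k] W)
    ((TensorProduct.tensorTensorTensorComm k V H W H).toLinearMap (t ⊗ₜ σ w))) F)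
    (by fun_prop) (ρ v)).trans (sw_congr fun x h => ?_)
  refine (Lin.tensor_eq (f := fun t => sw ((LinearMap.mul' k H).lTensor (V ⊗[k] W)
    ((TensorProduct.tensorTensorTensorComm k V H W H).toLinearMap (_ ⊗ₜ t))) F)
    (by fun_prop) (σ w)).trans (sw_congr fun y h' => ?_)
  simp only [LinearEquiv.coe_coe, TensorProduct.tensorTensorTensorComm_tmul,
    LinearMap.lTensor_tmul, LinearMap.mul'_apply]
  rw [sw_tmul _ _ h1 h2]

theorem sw_trivialCoaction {F : V → H → U} (v : V) (h1 : ∀ y, Lin k fun x => F x y)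
    (h2 : ∀ x, Lin k fun y => F x y) : sw (trivialCoaction (k := k) H V v) F = F v 1 :=
  sw_tmul v 1 h1 h2

theorem sw_braiding (R : UniversalRForm k H) (ρ : V →ₗ[k] V ⊗[k] H) (σ : W →ₗ[k] W ⊗[k] H)
    (v : V) (w : W) : braiding R ρ σ (v ⊗ₜ w) = sw (ρ v) fun x h => sw (σ w) fun y h' =>
      R.r (h ⊗ₜ h') • (y ⊗ₜ x) := by
  simp only [braiding, LinearMap.comp_apply, TensorProduct.map_tmul, LinearEquiv.coe_coe]
  refine (Lin.tensor_eq (f := fun t => (TensorProduct.rid k (W ⊗[k] V)).toLinearMap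
    (TensorProduct.map (TensorProduct.comm k V W).toLinearMap R.r
    ((TensorProduct.tensorTensorTensorComm k V H W H).toLinearMap (t ⊗ₜ σ w))))
    (by fun_prop) (ρ v)).trans (sw_congr fun x h => ?_)
  refine (Lin.tensor_eq (f := fun t => (TensorProduct.rid k (W ⊗[k] V)).toLinearMap
    (TensorProduct.map (TensorProduct.comm k V W).toLinearMap R.r
    ((TensorProduct.tensorTensorTensorComm k V H W H).toLinearMap (_ ⊗ₜ t))))
    (by fun_prop) (σ w)).trans (sw_congr fun y h' => ?_)
  simp

end Comodule

/-! ### `A` as a Yetter-Drinfeld module algebra, and its braided antipode -/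

namespace BraidedHopfAlgebra

variable {k H : Type u} [Field k] [Ring H] [HopfAlgebra k H] {R : UniversalRForm k H}
variable {A : Type u} [Ring A] [Algebra k A] [Coalgebra k A] (B : BraidedHopfAlgebra R A)
variable {U : Type*} [AddCommGroup U] [Module k U]

local notation "Δ" => comul (R := k)
local notation "ε" => counit (R := k)
local notation "S" => HopfAlgebra.antipode k (A := H)

theorem sw_coact_mul (a b : A) {F : A → H → U} (h1 : ∀ y, Lin k fun x => F x y)
    (h2 : ∀ x, Lin k fun y => F x y) :
    sw (B.coact (a * b)) F = sw (B.coact a) fun a h => sw (B.coact b) fun b h' =>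
      F (a * b) (h * h') := by
  have := B.mul_colinear.sw_apply (a ⊗ₜ b) h1 h2
  rw [LinearMap.mul'_apply, sw_tensorCoaction, sw_tmul] at this
  · exact this
  all_goals intros; fun_prop

theorem sw_coact_one {F : A → H → U} (h1 : ∀ y, Lin k fun x => F x y)
    (h2 : ∀ x, Lin k fun y => F x y) : sw (B.coact 1) F = F 1 1 := by
  have := B.unit_colinear.sw_apply 1 h1 h2
  rw [sw_trivialCoaction] at this
  · simpa using this
  all_goals intros; fun_prop

theorem sw_coact_comul (a : A) {F : A → A → H → U} (h1 : ∀ y z, Lin k fun x => F x y z)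
    (h2 : ∀ x z, Lin k fun y => F x y z) (h3 : ∀ x y, Lin k fun z => F x y z) :
    (sw (B.coact a) fun x h => sw (Δ x) fun u v => F u v h) = sw (Δ a) fun x y =>
      sw (B.coact x) fun x h => sw (B.coact y) fun y h' => F x y (h * h') := by
  have := B.comul_colinear.sw_apply a (F := fun t h => sw t fun u v => F u v h)
    (by intros; fun_prop) (by intros; fun_prop)
  rw [← this, sw_tensorCoaction]
  · refine sw_congr fun x y => sw_congr fun x h => sw_congr fun y h' => ?_
    rw [sw_tmul]
    all_goals intros; fun_prop
  all_goals intros; fun_prop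

theorem sw_coact_counit (a : A) {F : H → U} (h : Lin k F) :
    (sw (B.coact a) fun x h => ε x • F h) = ε a • F 1 := by
  have := B.counit_colinear.sw_apply a (F := fun c h => c • F h)
    (by intros; fun_prop) (by intros; fun_prop)
  rw [sw_trivialCoaction] at this
  · exact this.symm
  all_goals intros; fun_prop

theorem sw_coact_antipode (a : A) {F : A → H → U} (h1 : ∀ y, Lin k fun x => F x y)
    (h2 : ∀ x, Lin k fun y => F x y) :
    sw (B.coact (B.antipode a)) F = sw (B.coact a) fun x h => F (B.antipode x) h :=
  B.antipode_colinear.sw_apply a h1 h2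

theorem sw_antipode_mul (F : A → U) (h : Lin k F) (a : A) :
    (sw (Δ a) fun x y => F (B.antipode x * y)) = ε a • F 1 := by
  have key := congrArg F (LinearMap.congr_fun B.antipode_left a)
  have e := Lin.tensor_eq (f := fun t => F (LinearMap.mul' k A
    (B.antipode.rTensor A t))) (by fun_prop) (comul (R := k) a)
  simpa [Algebra.algebraMap_eq_smul_one, h.map_smul'] using e.symm.trans key

theorem sw_mul_antipode (F : A → U) (h : Lin k F) (a : A) :
    (sw (Δ a) fun x y => F (x * B.antipode y)) = ε a • F 1 := by
  have key := congrArg F (LinearMap.congr_fun B.antipode_right a)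
  have e := Lin.tensor_eq (f := fun t => F (LinearMap.mul' k A
    (B.antipode.lTensor A t))) (by fun_prop) (comul (R := k) a)
  simpa [Algebra.algebraMap_eq_smul_one, h.map_smul'] using e.symm.trans key

theorem antipode_one : B.antipode 1 = 1 := by
  have := B.sw_antipode_mul (fun a => a) (by fun_prop) 1
  rw [B.comul_one, sw_tmul, B.counit_one, one_smul, mul_one] at this
  · exact this
  all_goals intros; fun_prop

/-- The right action `a ⊗ h ↦ r(a₍₁₎, h) a₍₀₎` of `H` on `A`, for which `A` is a Yetter-Drinfeld
module. -/
def act (a : A) (h : H) : A := sw (B.coact a) fun x u => R.r (u ⊗ₜ h) • x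

@[fun_prop] theorem lin_act_left {V : Type*} [AddCommGroup V] [Module k V] {f : V → A}
    (hf : Lin k f) (h : H) : Lin k fun x => B.act (f x) h := by
  unfold act; fun_prop

@[fun_prop] theorem lin_act_right {V : Type*} [AddCommGroup V] [Module k V] {f : V → H}
    (hf : Lin k f) (a : A) : Lin k fun x => B.act a (f x) := by
  unfold act; fun_prop

theorem map_act (F : A → U) (hF : Lin k F) (a : A) (h : H) :
    F (B.act a h) = sw (B.coact a) fun x u => R.r (u ⊗ₜ h) • F x := by
  rw [act, hF.map_sw]
  exact sw_congr fun x u => hF.map_smul' _ _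

theorem act_mul (a : A) (h h' : H) : B.act a (h * h') = B.act (B.act a h) h' := by
  rw [B.map_act (fun a => B.act a h') (by fun_prop)]
  simp only [act, R.r_mul_right]
  calc (sw (B.coact a) fun x u => (sw (Δ u) fun u v => R.r (u ⊗ₜ h') * R.r (v ⊗ₜ h)) • x)
      = sw (B.coact a) fun x u => sw (Δ u) fun u v => R.r (v ⊗ₜ h) • R.r (u ⊗ₜ h') • x :=
        sw_congr fun x u => by
          rw [Lin.map_sw (g := fun c : k => c • x) (by fun_prop)]
          exact sw_congr fun u v => by rw [_root_.mul_comm, mul_smul]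
    _ = _ := by
        rw [← B.isRightCoaction.sw_coassoc]
        · refine sw_congr fun x u => ?_
          rw [Lin.map_sw (g := fun y : A => R.r (u ⊗ₜ h) • y) (by fun_prop)]
        all_goals intros; fun_prop

theorem act_one (a : A) : B.act a 1 = a := by
  simp only [act, R.r_one_right]
  exact B.isRightCoaction.sw_counit a (by fun_prop)

theorem one_act (h : H) : B.act 1 h = ε h • (1 : A) := by
  rw [act, B.sw_coact_one, R.r_one_left]
  all_goals intros; fun_prop

/-- The coaction of `A` is multiplicative and `r` is multiplicative in its first argument, so `A` is
a module algebra. -/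
theorem mul_act (a b : A) (h : H) :
    B.act (a * b) h = sw (Δ h) fun h h' => B.act a h * B.act b h' := by
  rw [act, B.sw_coact_mul]
  · simp only [R.r_mul_left]
    calc (sw (B.coact a) fun a u => sw (B.coact b) fun b v =>
          (sw (Δ h) fun h h' => R.r (u ⊗ₜ h) * R.r (v ⊗ₜ h')) • (a * b))
        = sw (Δ h) fun h h' => sw (B.coact a) fun a u => sw (B.coact b) fun b v =>
          (R.r (u ⊗ₜ h) * R.r (v ⊗ₜ h')) • (a * b) := by
          rw [sw_comm (Δ h)]
          refine sw_congr fun a u => ?_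
          rw [sw_comm (Δ h)]
          exact sw_congr fun b v =>
            Lin.map_sw (g := fun c : k => c • (a * b)) (by fun_prop) _ _
      _ = _ := sw_congr fun h h' => by
          rw [B.map_act (fun x => x * B.act b h') (by fun_prop)]
          refine sw_congr fun a u => ?_
          rw [B.map_act (fun x => R.r (u ⊗ₜ h) • (a * x)) (by fun_prop)]
          exact sw_congr fun b v => by rw [_root_.mul_comm, mul_smul]
  all_goals intros; fun_prop

theorem antipode_act (a : A) (h : H) : B.antipode (B.act a h) = B.act (B.antipode a) h := by
  rw [B.map_act (fun x => B.antipode x) (by fun_prop), act, B.sw_coact_antipode]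
  all_goals intros; fun_prop

/-- The Yetter-Drinfeld compatibility of the action and the coaction. -/
theorem sw_coact_act (a : A) (h : H) {F : A → H → U} (h1 : ∀ y, Lin k fun x => F x y)
    (h2 : ∀ x, Lin k fun y => F x y) :
    (sw (Δ h) fun h h' => sw (B.coact (B.act a h')) fun x u => F x (h * u)) =
      sw (B.coact a) fun x u => sw (Δ h) fun h h' => F (B.act x h) (u * h') := by
  calc (sw (Δ h) fun h h' => sw (B.coact (B.act a h')) fun x u => F x (h * u))
      = sw (Δ h) fun h h' => sw (B.coact a) fun x u => sw (B.coact x) fun x v =>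
          R.r (u ⊗ₜ h') • F x (h * v) := sw_congr fun h h' => by
        rw [B.map_act (fun y => sw (B.coact y) fun x u => F x (h * u)) (by fun_prop)]
        exact sw_congr fun x u =>
          Lin.map_sw (g := fun y => R.r (u ⊗ₜ h') • y) (by fun_prop) _ _
    _ = sw (Δ h) fun h h' => sw (B.coact a) fun x u => sw (Δ u) fun v u =>
          R.r (u ⊗ₜ h') • F x (h * v) := sw_congr fun h h' => by
        rw [B.isRightCoaction.sw_coassoc]
        all_goals intros; fun_prop
    _ = sw (B.coact a) fun x u => sw (Δ u) fun v u => sw (Δ h) fun h h' =>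
          R.r (u ⊗ₜ h') • F x (h * v) := by
        rw [sw_comm]
        exact sw_congr fun x u => sw_comm _ _ _
    -- The only step that is not bookkeeping: the commutation relation for `r` is what turns the
    -- order h · u into u · h.
    _ = sw (B.coact a) fun x u => sw (Δ u) fun v u => sw (Δ h) fun h h' =>
          R.r (v ⊗ₜ h) • F x (u * h') := sw_congr fun x u =>
        R.sw_r_comm u h (fun y => F x y) (by fun_prop)
    _ = sw (B.coact a) fun x u => sw (B.coact x) fun x v => sw (Δ h) fun h h' =>
          R.r (v ⊗ₜ h) • F x (u * h') := by
        rw [B.isRightCoaction.sw_coassoc]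
        all_goals intros; fun_prop
    _ = _ := sw_congr fun x u => by
        rw [sw_comm]
        refine sw_congr fun h h' => ?_
        rw [B.map_act (fun y => F y (u * h')) (by fun_prop)]

/-- As the braiding is y ⊗ z ↦ z₍₀₎ ⊗ (y ◁ z₍₁₎), braided multiplicativity reads Δ(ab) = a₁ b₁₍₀₎ ⊗
(a₂ ◁ b₁₍₁₎) b₂. -/
theorem comul_mul_apply (a b : A) {F : A → A → U} (h1 : ∀ y, Lin k fun x => F x y)
    (h2 : ∀ x, Lin k fun y => F x y) :
    sw (Δ (a * b)) F = sw (Δ a) fun x y => sw (Δ b) fun z w => sw (B.coact z) fun z h =>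
      F (x * z) (B.act y h * w) := by
  rw [B.comul_mul]
  refine (Lin.tensor_eq (f := fun t => sw (braidedTensorMul (braiding R B.coact B.coact)
    (t ⊗ₜ Δ b)) F) (by fun_prop) (Δ a)).trans (sw_congr fun x y => ?_)
  refine (Lin.tensor_eq (f := fun t => sw (braidedTensorMul (braiding R B.coact B.coact)
    (_ ⊗ₜ t)) F) (by fun_prop) (Δ b)).trans (sw_congr fun z w => ?_)
  simp only [braidedTensorMul, LinearMap.comp_apply, LinearEquiv.coe_coe,
    TensorProduct.assoc_tmul, LinearMap.lTensor_tmul, TensorProduct.assoc_symm_tmul,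
    LinearMap.rTensor_tmul]
  have key : ∀ t : A ⊗[k] A, sw (TensorProduct.map (LinearMap.mul' k A) (LinearMap.mul' k A)
      ((TensorProduct.assoc k A A (A ⊗[k] A)).symm
        (x ⊗ₜ (TensorProduct.assoc k A A A (t ⊗ₜ w))))) F =
      sw t fun z y => F (x * z) (y * w) := fun t => by
    refine (Lin.tensor_eq (f := fun t => sw (TensorProduct.map (LinearMap.mul' k A)
      (LinearMap.mul' k A) ((TensorProduct.assoc k A A (A ⊗[k] A)).symm.toLinearMap
        (x ⊗ₜ ((TensorProduct.assoc k A A A).toLinearMap (t ⊗ₜ w))))) F) (by fun_prop) t).trans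
      (sw_congr fun z y => ?_)
    simp only [LinearEquiv.coe_coe, TensorProduct.assoc_tmul, TensorProduct.assoc_symm_tmul,
      TensorProduct.map_tmul, LinearMap.mul'_apply]
    rw [sw_tmul _ _ h1 h2]
  have hF : ∀ x' y' (c : k), sw (c • (x' ⊗ₜ[k] y')) (fun z y => F (x * z) (y * w)) =
      c • F (x * x') (y' * w) := fun x' y' c => by
    rw [smul_tmul', sw_tmul, mul_smul_comm, (h1 _).map_smul']
    all_goals intros; fun_prop
  rw [key, sw_braiding, sw_sw]
  · calc (sw (B.coact y) fun y u => sw (sw (B.coact z) fun z h => R.r (u ⊗ₜ h) • (z ⊗ₜ y))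
          fun z y => F (x * z) (y * w))
        = sw (B.coact y) fun y u => sw (B.coact z) fun z h => R.r (u ⊗ₜ h) • F (x * z) (y * w) :=
          sw_congr fun y u => by
            rw [sw_sw]
            · exact sw_congr fun z h => hF _ _ _
            all_goals intros; fun_prop
      _ = _ := by
          rw [sw_comm]
          refine sw_congr fun z h => ?_
          rw [B.map_act (fun y => F (x * z) (y * w)) (by fun_prop)]
  all_goals intros; fun_prop

/-- The element `a₍₁₎ S(a₍₂₎)` is trivial together with its coaction. -/
theorem sw_coact_mul_antipode (a : A) {F : A → H → U} (h1 : ∀ y, Lin k fun x => F x y)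
    (h2 : ∀ x, Lin k fun y => F x y) :
    (sw (Δ a) fun x y => sw (B.coact x) fun x h => sw (B.coact y) fun y h' =>
      F (x * B.antipode y) (h * h')) = ε a • F 1 1 := by
  rw [← B.sw_coact_comul (F := fun x y h => F (x * B.antipode y) h)
    _ (by intros; fun_prop) (by intros; fun_prop) (by intros; fun_prop),
    ← B.sw_coact_counit (F := fun h => F 1 h) a (by fun_prop)]
  exact sw_congr fun x h => B.sw_mul_antipode (fun x => F x h) (by fun_prop) x

/-- The element `S(a₍₁₎) a₍₂₎` is trivial together with its coaction. -/
theorem sw_coact_antipode_mul (a : A) {F : A → H → U} (h1 : ∀ y, Lin k fun x => F x y)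
    (h2 : ∀ x, Lin k fun y => F x y) :
    (sw (Δ a) fun x y => sw (B.coact x) fun x h => sw (B.coact y) fun y h' =>
      F (B.antipode x * y) (h * h')) = ε a • F 1 1 := by
  rw [← B.sw_coact_comul (F := fun x y h => F (B.antipode x * y) h)
    _ (by intros; fun_prop) (by intros; fun_prop) (by intros; fun_prop),
    ← B.sw_coact_counit (F := fun h => F 1 h) a (by fun_prop)]
  exact sw_congr fun x h => B.sw_antipode_mul (fun x => F x h) (by fun_prop) x

/-- The action distributes over products and commutes with the antipode, so the sum is (a₁ S(a₂)) ◁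
h. -/
theorem sw_act_mul_antipode (F : A → U) (hF : Lin k F) (a : A) (h : H) :
    (sw (Δ a) fun x y => sw (Δ h) fun h h' => F (B.act x h * B.antipode (B.act y h'))) =
      ε a • ε h • F 1 := by
  calc _ = sw (Δ a) fun x y => F (B.act (x * B.antipode y) h) := sw_congr fun x y => by
        rw [B.mul_act, hF.map_sw]
        exact sw_congr fun h h' => by rw [B.antipode_act]
    _ = _ := by
        rw [B.sw_mul_antipode (fun x => F (B.act x h)) (by fun_prop), B.one_act, hF.map_smul']

theorem sw_act_antipode_mul (F : A → U) (hF : Lin k F) (a : A) (h : H) :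
    (sw (Δ a) fun x y => sw (Δ h) fun h h' => F (B.antipode (B.act x h) * B.act y h')) =
      ε a • ε h • F 1 := by
  calc _ = sw (Δ a) fun x y => F (B.act (B.antipode x * y) h) := sw_congr fun x y => by
        rw [B.mul_act, hF.map_sw]
        exact sw_congr fun h h' => by rw [B.antipode_act]
    _ = _ := by
        rw [B.sw_antipode_mul (fun x => F (B.act x h)) (by fun_prop), B.one_act, hF.map_smul']

/-- The cancellation of b₂ S(b₃) inside the computation of S(ab). Its coaction acts on a″ and has to
disappear at the same time, hence `sw_coact_mul_antipode` rather than the plain antipode axiom. -/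
theorem antipode_mul_aux (a a' a'' b : A) :
    (sw (Δ b) fun e d => sw (B.coact e) fun e u => sw (B.coact d) fun d v =>
      sw (Δ e) fun z w => sw (B.coact z) fun z h =>
        B.antipode (a * z) * (B.act a' h * w) * B.antipode d * B.antipode (B.act a'' (u * v))) =
    sw (B.coact b) fun z u => sw (Δ u) fun h h' =>
      B.antipode (a * z) * B.act a' h * B.antipode (B.act a'' h') := by
  calc (sw (Δ b) fun e d => sw (B.coact e) fun e u => sw (B.coact d) fun d v =>
      sw (Δ e) fun z w => sw (B.coact z) fun z h =>
        B.antipode (a * z) * (B.act a' h * w) * B.antipode d * B.antipode (B.act a'' (u * v)))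
      = sw (Δ b) fun e d => sw (B.coact e) fun e u => sw (Δ e) fun z w =>
        sw (B.coact d) fun d v => sw (B.coact z) fun z h =>
        B.antipode (a * z) * (B.act a' h * w) * B.antipode d * B.antipode (B.act a'' (u * v)) :=
        sw_congr fun e d => sw_congr fun e u => sw_comm _ _ _
    _ = sw (Δ b) fun e d => sw (Δ e) fun z w => sw (B.coact z) fun z u =>
        sw (B.coact w) fun w t => sw (B.coact d) fun d v => sw (B.coact z) fun z h =>
        B.antipode (a * z) * (B.act a' h * w) * B.antipode d *
          B.antipode (B.act a'' (u * t * v)) := sw_congr fun e d => by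
        rw [B.sw_coact_comul]
        all_goals intros; fun_prop
    _ = sw (Δ b) fun z e => sw (Δ e) fun w d => sw (B.coact z) fun z u =>
        sw (B.coact w) fun w t => sw (B.coact d) fun d v => sw (B.coact z) fun z h =>
        B.antipode (a * z) * (B.act a' h * w) * B.antipode d *
          B.antipode (B.act a'' (u * t * v)) := by
        rw [sw_coassoc]
        all_goals intros; fun_prop
    _ = sw (Δ b) fun z e => sw (B.coact z) fun z u => sw (B.coact z) fun z h =>
        sw (Δ e) fun w d => sw (B.coact w) fun w t => sw (B.coact d) fun d v =>
        B.antipode (a * z) * (B.act a' h * (w * B.antipode d)) *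
          B.antipode (B.act a'' (u * (t * v))) := sw_congr fun z e => by
        rw [sw_comm]
        refine sw_congr fun z u => ?_
        rw [sw_comm (B.coact z)]
        refine sw_congr fun w d => ?_
        rw [sw_comm (B.coact z)]
        refine sw_congr fun w t => ?_
        rw [sw_comm (B.coact z)]
        simp only [mul_assoc]
    _ = sw (Δ b) fun z e => sw (B.coact z) fun z u => sw (B.coact z) fun z h =>
        ε e • (B.antipode (a * z) * (B.act a' h * 1) * B.antipode (B.act a'' (u * 1))) :=
        sw_congr fun z e => sw_congr fun z u => sw_congr fun z h =>
          B.sw_coact_mul_antipode (F := fun x y =>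
            B.antipode (a * z) * (B.act a' h * x) * B.antipode (B.act a'' (u * y))) e
            (by intros; fun_prop) (by intros; fun_prop)
    _ = sw (Δ b) fun z e => ε e • (sw (B.coact z) fun z u => sw (B.coact z) fun z h =>
        B.antipode (a * z) * B.act a' h * B.antipode (B.act a'' u)) := sw_congr fun z e => by
        simp only [mul_one]
        rw [Lin.map_sw (g := fun y : A => ε e • y) (by fun_prop)]
        refine sw_congr fun z u => ?_
        rw [Lin.map_sw (g := fun y : A => ε e • y) (by fun_prop)]
    _ = _ := by
        rw [sw_counit_right (F := fun z => sw (B.coact z) fun z u => sw (B.coact z) fun z h =>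
          B.antipode (a * z) * B.act a' h * B.antipode (B.act a'' u)) b (by fun_prop),
          B.isRightCoaction.sw_coassoc]
        all_goals intros; fun_prop

/-- The antipode of a braided Hopf algebra reverses products, up to the braiding. -/
theorem antipode_mul (a b : A) : B.antipode (a * b) =
    sw (B.coact b) fun b h => B.antipode b * B.antipode (B.act a h) := by
  -- Uniqueness of inverses in convolution form. With X(a, b) the claimed value, the triple product
  -- S((ab)₁) · (ab)₂ · X is evaluated in two ways. Cancelling the first two factors leaves X(a, b);
  -- cancelling the last two leaves S(ab).
  have key : (sw (Δ a) fun c a' => sw (Δ b) fun e d => sw (B.coact e) fun e u =>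
      sw (B.coact d) fun d v => sw (Δ (c * e)) fun p q =>
        B.antipode p * q * B.antipode d * B.antipode (B.act a' (u * v))) =
      sw (Δ a) fun c a'' => sw (Δ c) fun a a' => sw (B.coact b) fun z u => sw (Δ u) fun h h' =>
      B.antipode (a * z) * B.act a' h * B.antipode (B.act a'' h') := sw_congr fun c a'' => by
    simp only [← antipode_mul_aux]
    rw [sw_comm (Δ c)]
    refine sw_congr fun e d => ?_
    rw [sw_comm (Δ c)]
    refine sw_congr fun e u => ?_
    rw [sw_comm (Δ c)]
    refine sw_congr fun d v => ?_
    rw [B.comul_mul_apply]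
    all_goals intros; fun_prop
  refine Eq.trans (Eq.symm ?_) (key.symm.trans ?_)
  · calc (sw (Δ a) fun c a'' => sw (Δ c) fun a a' => sw (B.coact b) fun z u =>
        sw (Δ u) fun h h' => B.antipode (a * z) * B.act a' h * B.antipode (B.act a'' h'))
        = sw (Δ a) fun a c => sw (B.coact b) fun z u => sw (Δ c) fun a' a'' =>
        sw (Δ u) fun h h' => B.antipode (a * z) * (B.act a' h * B.antipode (B.act a'' h')) := by
          rw [sw_coassoc]
          · refine sw_congr fun a c => ?_
            rw [sw_comm]
            simp only [mul_assoc]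
          all_goals intros; fun_prop
      _ = sw (Δ a) fun a c => ε c • B.antipode (a * b) := sw_congr fun a c => by
          rw [← B.isRightCoaction.sw_counit (F := fun b => B.antipode (a * b)) b (by fun_prop),
            Lin.map_sw (g := fun y : A => ε c • y) (by fun_prop)]
          refine sw_congr fun z u => ?_
          rw [B.sw_act_mul_antipode (fun y => B.antipode (a * z) * y) (by fun_prop), mul_one]
      _ = _ := sw_counit_right (F := fun a => B.antipode (a * b)) a (by fun_prop)
  · calc (sw (Δ a) fun c a' => sw (Δ b) fun e d => sw (B.coact e) fun e u =>
        sw (B.coact d) fun d v => sw (Δ (c * e)) fun p q =>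
        B.antipode p * q * B.antipode d * B.antipode (B.act a' (u * v)))
        = sw (Δ a) fun c a' => sw (Δ b) fun e d => sw (B.coact e) fun e u => ε e •
        ε c • sw (B.coact d) fun d v =>
          B.antipode d * B.antipode (B.act a' (u * v)) :=
          sw_congr fun c a' => sw_congr fun e d => sw_congr fun e u => by
            rw [smul_smul, Lin.map_sw (g := fun y : A => (ε e * ε c) • y) (by fun_prop)]
            refine sw_congr fun d v => ?_
            rw [B.sw_antipode_mul (fun y =>
              y * B.antipode d * B.antipode (B.act a' (u * v))) (by fun_prop), one_mul,
              B.counit_mul, _root_.mul_comm]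
      _ = sw (Δ a) fun c a' => ε c • sw (Δ b) fun e d => ε e • sw (B.coact d) fun d v =>
          B.antipode d * B.antipode (B.act a' v) :=
          sw_congr fun c a' => by
            rw [Lin.map_sw (g := fun y : A => ε c • y) (by fun_prop)]
            refine sw_congr fun e d => ?_
            rw [B.sw_coact_counit (F := fun u => ε c • sw (B.coact d) fun d v =>
              B.antipode d * B.antipode (B.act a' (u * v))) e (by fun_prop), smul_comm]
            simp only [one_mul]
      _ = _ := by
          rw [sw_counit_left (F := fun a' => sw (Δ b) fun e d => ε e • sw (B.coact d) fun d v =>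
            B.antipode d * B.antipode (B.act a' v)) a (by fun_prop),
            sw_counit_left (F := fun d => sw (B.coact d) fun d v =>
            B.antipode d * B.antipode (B.act a v)) b (by fun_prop)]

end BraidedHopfAlgebra

end

section

/-! ### Tensors in Hom_A(M, A) ⊗ V tested by evaluation; finiteness -/

section Separation

variable {k : Type*} [Field k] {C D V X : Type*} [AddCommGroup C] [Module k C] [AddCommGroup D]
  [Module k D] [AddCommGroup V] [Module k V]

/-- A tensor vanishes if it is killed by a family of maps that separates the points of the first
factor. -/
theorem tensor_eq_zero_of_separating (L : X → C →ₗ[k] D) (hL : ∀ c, (∀ x, L x c = 0) → c = 0)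
    (t : C ⊗[k] V) (ht : ∀ x, (L x).rTensor V t = 0) : t = 0 := by
  classical
  let b := Module.Basis.ofVectorSpace k V
  -- Coordinates with respect to a basis of the second factor commute with maps on the first factor.
  have nat : ∀ x i (t : C ⊗[k] V), TensorProduct.equivFinsuppOfBasisRight b
      ((L x).rTensor V t) i = L x (TensorProduct.equivFinsuppOfBasisRight b t i) := fun x i t => by
    induction t with
    | zero => simp
    | tmul c v => simp
    | add s t hs ht => simp [hs, ht]
  apply (TensorProduct.equivFinsuppOfBasisRight b).injective
  ext i
  rw [map_zero, Finsupp.zero_apply]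
  exact hL _ fun x => by rw [← nat, ht, map_zero, Finsupp.zero_apply]

end Separation

section HopfModule

variable {k H : Type u} [Field k] [Ring H] [HopfAlgebra k H] {R : UniversalRForm k H}
variable {A : Type u} [Ring A] [Algebra k A] [Coalgebra k A] {B : BraidedHopfAlgebra R A}
variable {M : Type u} [AddCommGroup M] [Module k M] [Module A M] [IsScalarTower k A M]
variable {U : Type*} [AddCommGroup U] [Module k U]

local notation "Δ" => comul (R := k)
local notation "ε" => counit (R := k)
local notation "S" => HopfAlgebra.antipode k (A := H)

theorem IsHopfModule.sw_smul {ρ : M →ₗ[k] M ⊗[k] H} (hρ : IsHopfModule B ρ) (a : A) (m : M)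
    {F : M → H → U} (h1 : ∀ y, Lin k fun x => F x y) (h2 : ∀ x, Lin k fun y => F x y) :
    sw (ρ (a • m)) F = sw (B.coact a) fun a h => sw (ρ m) fun m h' => F (a • m) (h * h') := by
  have := hρ.smul_colinear.sw_apply (a ⊗ₜ m) h1 h2
  rw [sw_tensorCoaction, sw_tmul] at this
  · exact this
  all_goals intros; fun_prop

/-- A comodule with a left dual is finite dimensional. -/
theorem HasLeftDual.finite {V : Type u} [AddCommGroup V] [Module k V] {ρ : V →ₗ[k] V ⊗[k] H}
    (h : HasLeftDual ρ) : Module.Finite k V := by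
  obtain ⟨D, _, _, σ, ev, coev, -, -, -, hV, -⟩ := h
  classical
  -- The first zigzag identity writes every v as a combination of the first legs of coev(1), so
  -- these finitely many vectors span.
  refine ⟨⟨((exists_rep (coev 1)).choose.map Prod.fst).toFinset, eq_top_iff.2 fun v _ => ?_⟩⟩
  have key : (sw (coev 1) fun x d => ev (d ⊗ₜ v) • x) = v := by
    refine Eq.trans ?_ (LinearMap.congr_fun hV v)
    simp only [LinearMap.comp_apply, LinearEquiv.coe_coe, TensorProduct.lid_symm_apply,
      LinearMap.rTensor_tmul]
    refine Eq.symm ((Lin.tensor_eq (f := fun t => (TensorProduct.rid k V).toLinearMap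
      (ev.lTensor V ((TensorProduct.assoc k V D V).toLinearMap (t ⊗ₜ v)))) (by fun_prop)
      (coev 1)).trans (sw_congr fun x d => ?_))
    simp
  rw [← key, sw]
  refine list_sum_mem fun y hy => ?_
  obtain ⟨p, hp, rfl⟩ := List.mem_map.1 hy
  exact Submodule.smul_mem _ _ (Submodule.subset_span (by
    simp only [List.coe_toFinset, List.mem_map, Set.mem_ofPred_eq]
    exact ⟨p, hp, rfl⟩))

theorem IsFiniteRelProjective.finite {ρ : M →ₗ[k] M ⊗[k] H} (h : IsFiniteRelProjective B ρ) :
    Module.Finite A M := by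
  obtain ⟨V, _, _, _, i, p, _, hV, _, _, hip⟩ := h
  have := hV.finite
  exact Module.Finite.of_surjective p fun x => ⟨i x, LinearMap.congr_fun hip x⟩

theorem exists_dual_basis (A M : Type*) [Ring A] [AddCommGroup M] [Module A M] [Module.Finite A M]
    [Module.Projective A M] : ∃ (n : ℕ) (p : Fin n → M) (e : Fin n → M →ₗ[A] A),
      ∀ x, ∑ i, e i x • p i = x := by
  obtain ⟨n, f, hf⟩ := Module.Finite.exists_fin' A M
  obtain ⟨g, hg⟩ := Module.projective_lifting_property f LinearMap.id hf
  refine ⟨n, fun i => f (Pi.single i 1), fun i => LinearMap.proj i ∘ₗ g, fun x => ?_⟩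
  conv_rhs => rw [← LinearMap.id_apply (R := A) x, ← hg, LinearMap.comp_apply,
    pi_eq_sum_univ' (g x), map_sum]
  simp only [map_smul, LinearMap.comp_apply, LinearMap.proj_apply]

/-- Evaluation at `x`, as a `k`-linear map. -/
def evalAt (k : Type u) [Field k] {A M N : Type u} [Ring A] [Algebra k A] [AddCommGroup M]
    [Module A M] [AddCommGroup N] [Module A N] [Module k N] [IsScalarTower k A N]
    [SMulCommClass A k N] (x : M) : (M →ₗ[A] N) →ₗ[k] N where
  toFun f := f x
  map_add' _ _ := rfl
  map_smul' _ _ := rfl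

/-- Right multiplication by an element of `A` on `Hom_A(M, A)`. -/
def homMulRight (f : M →ₗ[A] A) (a : A) : M →ₗ[A] A := LinearMap.toSpanSingleton A A a ∘ₗ f

@[simp] theorem homMulRight_apply (f : M →ₗ[A] A) (a : A) (x : M) :
    homMulRight f a x = f x * a := rfl

@[fun_prop] theorem lin_homMulRight_right {V : Type*} [AddCommGroup V] [Module k V] {g : V → A}
    (hg : Lin k g) (f : M →ₗ[A] A) : Lin k fun x => homMulRight f (g x) :=
  ⟨fun x y => by ext; simp [hg.map_add', mul_add], fun c x => by ext; simp [hg.map_smul']⟩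

@[fun_prop] theorem lin_hom_apply {V : Type*} [AddCommGroup V] [Module k V]
    {g : V → M →ₗ[A] A} (hg : Lin k g) (x : M) : Lin k fun v => g v x :=
  ⟨fun x y => by simp [hg.map_add'], fun c x => by simp [hg.map_smul']⟩

@[fun_prop] theorem lin_hom_arg {V : Type*} [AddCommGroup V] [Module k V]
    {N : Type*} [AddCommGroup N] [Module k N] [Module A N] [IsScalarTower k A N]
    {g : V → M} (hg : Lin k g) (f : M →ₗ[A] N) : Lin k fun v => f (g v) :=
  ⟨fun x y => by simp [hg.map_add'], fun c x => by
    rw [hg.map_smul', ← algebraMap_smul A c (g x), map_smul, algebraMap_smul]⟩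

/-- Evaluations at points of M separate Hom_A(M, A), and over a field they still do so after
tensoring. Identities in Hom_A(M, A) ⊗ V can thus be checked pointwise. -/
theorem hom_tensor_injective {V : Type u} [AddCommGroup V] [Module k V] (t : (M →ₗ[A] A) ⊗[k] V)
    (ht : ∀ x, (sw t fun f v => f x ⊗ₜ[k] v) = 0) : t = 0 := by
  refine tensor_eq_zero_of_separating (evalAt k (N := A)) (fun f hf => LinearMap.ext hf) t
    fun x => ?_
  rw [← ht x]
  exact apply_eq_sw ((evalAt k x).rTensor V) t

theorem hom_tensor_ext {V : Type u} [AddCommGroup V] [Module k V] (s t : (M →ₗ[A] A) ⊗[k] V)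
    (h : ∀ x, (sw s fun f v => f x ⊗ₜ[k] v) = sw t fun f v => f x ⊗ₜ[k] v) : s = t := by
  refine sub_eq_zero.1 (hom_tensor_injective (s - t) fun x => ?_)
  have hl : Lin k fun t : (M →ₗ[A] A) ⊗[k] V => sw t fun f v => f x ⊗ₜ[k] v := by fun_prop
  have := hl.toLinearMap.map_sub s t
  simp only [Lin.toLinearMap_apply] at this
  rw [this, h, sub_self]

/-- With a dual basis (pᵢ, eᵢ) a map F is ∑ eᵢ · F(pᵢ), where F(pᵢ) multiplies on the right. This is
where finiteness makes the coaction on Hom_A(M, A) a finite sum. -/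
theorem hom_tensor_surjective [Module.Finite A M] [Module.Projective A M] {V : Type u}
    [AddCommGroup V] [Module k V] (F : M → A ⊗[k] V) (hadd : ∀ x y, F (x + y) = F x + F y)
    (hsmul : ∀ (a : A) x, F (a • x) = a • F x) :
    ∃ t : (M →ₗ[A] A) ⊗[k] V, ∀ x, (sw t fun f v => f x ⊗ₜ[k] v) = F x := by
  obtain ⟨n, p, e, hpe⟩ := exists_dual_basis A M
  let F' : M →ₗ[A] A ⊗[k] V := ⟨⟨F, hadd⟩, hsmul⟩
  refine ⟨∑ i, sw (F (p i)) fun a v => homMulRight (e i) a ⊗ₜ v, fun x => ?_⟩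
  have hl : Lin k fun t : (M →ₗ[A] A) ⊗[k] V => sw t fun f v => f x ⊗ₜ[k] v := by fun_prop
  have := map_sum hl.toLinearMap (fun i => sw (F (p i)) fun a v => homMulRight (e i) a ⊗ₜ[k] v)
    Finset.univ
  simp only [Lin.toLinearMap_apply] at this
  rw [this]
  have h2 : F x = ∑ i, e i x • F (p i) := by
    conv_lhs => rw [← hpe x]
    change F' _ = _
    rw [map_sum]
    simp only [map_smul]
    rfl
  rw [h2]
  refine Finset.sum_congr rfl fun i _ => ?_
  rw [sw_sw]
  · conv_rhs => rw [← sw_self (F (p i)), Lin.map_sw (g := fun t : A ⊗[k] V => e i x • t)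
      (by fun_prop)]
    refine sw_congr fun a v => ?_
    rw [sw_tmul]
    · rfl
    all_goals intros; fun_prop
  all_goals intros; fun_prop

end HopfModule

/-! ### The coaction on `Hom_A(M, A)` -/

section SInv

variable {k H : Type u} [Field k] [Ring H] [HopfAlgebra k H]
variable {U : Type*} [AddCommGroup U] [Module k U]

local notation "Δ" => comul (R := k)
local notation "ε" => counit (R := k)
local notation "S" => HopfAlgebra.antipode k (A := H)

/-- The linear map `T` is inverse to the antipode. -/
structure IsAntipodeInv (T : H →ₗ[k] H) : Prop where
  left : ∀ h, T (S h) = h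
  right : ∀ h, S (T h) = h

namespace IsAntipodeInv

variable {T : H →ₗ[k] H}

theorem map_mul (hT : IsAntipodeInv T) (x y : H) : T (x * y) = T y * T x := by
  have : S (T y * T x) = x * y := by
    rw [HopfAlgebra.antipode_mul_antidistrib, hT.right, hT.right]
  rw [← this, hT.left]

theorem counit_apply (hT : IsAntipodeInv T) (x : H) : ε (T x) = ε x := by
  conv_rhs => rw [← hT.right x, HopfAlgebra.counit_antipode]

theorem sw_comul (hT : IsAntipodeInv T) (x : H) {F : H → H → U} (h1 : ∀ y, Lin k fun x => F x y)
    (h2 : ∀ x, Lin k fun y => F x y) :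
    sw (Δ (T x)) F = sw (Δ x) fun x y => F (T y) (T x) := by
  conv_rhs => rw [← hT.right x]
  rw [sw_comul_antipode]
  · simp only [hT.left]
  all_goals intros; fun_prop

/-- The antipode identity at T x; as T reverses coproducts, the inverse antipode satisfies the
antipode identities with the two legs exchanged. -/
theorem sw_left (hT : IsAntipodeInv T) (F : H → U) (h : Lin k F) (x : H) :
    (sw (Δ x) fun x y => F (T y * x)) = ε x • F 1 := by
  rw [← hT.counit_apply, ← sw_mul_antipode F h (T x), hT.sw_comul]
  · simp only [hT.right]
  all_goals intros; fun_prop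

theorem sw_right (hT : IsAntipodeInv T) (F : H → U) (h : Lin k F) (x : H) :
    (sw (Δ x) fun x y => F (y * T x)) = ε x • F 1 := by
  rw [← hT.counit_apply, ← sw_antipode_mul F h (T x), hT.sw_comul]
  · simp only [hT.right]
  all_goals intros; fun_prop

end IsAntipodeInv

end SInv

section HomCoaction

variable {k H : Type u} [Field k] [Ring H] [HopfAlgebra k H] {R : UniversalRForm k H}
variable {A : Type u} [Ring A] [Algebra k A] [Coalgebra k A] {B : BraidedHopfAlgebra R A}
variable {M : Type u} [AddCommGroup M] [Module k M] [Module A M] [IsScalarTower k A M]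
variable {N : Type u} [AddCommGroup N] [Module k N] [Module A N] [IsScalarTower k A N]
variable {U : Type*} [AddCommGroup U] [Module k U]

local notation "Δ" => comul (R := k)
local notation "ε" => counit (R := k)
local notation "S" => HopfAlgebra.antipode k (A := H)

theorem homCoaction_apply (T : H →ₗ[k] H) (ρ : M →ₗ[k] M ⊗[k] H) (f : M →ₗ[A] A) (x : M) :
    homCoaction B T ρ f x = sw (ρ x) fun x h => sw (B.coact (f x)) fun a u => a ⊗ₜ (T h * u) := by
  simp only [homCoaction, LinearMap.comp_apply, LinearEquiv.coe_coe]
  refine (Lin.tensor_eq (f := fun t =>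
    (LinearMap.mul' k H ∘ₗ (TensorProduct.comm k H H).toLinearMap).lTensor A
    ((TensorProduct.assoc k A H H).toLinearMap
    (TensorProduct.map (B.coact ∘ₗ f.restrictScalars k) T t))) (by fun_prop) (ρ x)).trans
    (sw_congr fun x h => ?_)
  simp only [TensorProduct.map_tmul]
  refine (Lin.tensor_eq (f := fun t =>
    (LinearMap.mul' k H ∘ₗ (TensorProduct.comm k H H).toLinearMap).lTensor A
    ((TensorProduct.assoc k A H H).toLinearMap (t ⊗ₜ T h))) (by fun_prop) (B.coact (f x))).trans
    (sw_congr fun a u => ?_)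
  simp

theorem sw_homCoaction (T : H →ₗ[k] H) (ρ : M →ₗ[k] M ⊗[k] H) (f : M →ₗ[A] A) (x : M)
    {F : A → H → U} (h1 : ∀ y, Lin k fun x => F x y) (h2 : ∀ x, Lin k fun y => F x y) :
    sw (homCoaction B T ρ f x) F =
      sw (ρ x) fun x h => sw (B.coact (f x)) fun a u => F a (T h * u) := by
  rw [homCoaction_apply, sw_sw _ _ h1 h2]
  refine sw_congr fun x h => ?_
  rw [sw_sw _ _ h1 h2]
  exact sw_congr fun a u => sw_tmul _ _ h1 h2

/-- This fixes the position of S⁻¹: the coaction of a occurs once inside S⁻¹ and once outside, S⁻¹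
reverses products, and the two occurrences become adjacent as S⁻¹(a₍₂₎) a₍₁₎ = ε. -/
theorem homCoaction_smul {T : H →ₗ[k] H} (hT : IsAntipodeInv T) {ρ : M →ₗ[k] M ⊗[k] H}
    (hρ : IsHopfModule B ρ) (f : M →ₗ[A] A) (a : A) (x : M) :
    homCoaction B T ρ f (a • x) = a • homCoaction B T ρ f x := by
  rw [homCoaction_apply, hρ.sw_smul]
  · calc (sw (B.coact a) fun a h => sw (ρ x) fun x h' => sw (B.coact (f (a • x))) fun b u =>
          b ⊗ₜ[k] (T (h * h') * u))
        = sw (B.coact a) fun a h => sw (B.coact a) fun a v => sw (ρ x) fun x h' =>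
          sw (B.coact (f x)) fun b u => (a * b) ⊗ₜ[k] (T h' * (T h * v) * u) :=
          sw_congr fun a h => by
            rw [sw_comm (B.coact a)]
            refine sw_congr fun x h' => ?_
            rw [map_smul, smul_eq_mul, B.sw_coact_mul]
            · simp only [hT.map_mul, mul_assoc]
            all_goals intros; fun_prop
      _ = sw (B.coact a) fun a h => ε h • sw (ρ x) fun x h' =>
          sw (B.coact (f x)) fun b u => (a * b) ⊗ₜ[k] (T h' * u) := by
          rw [B.isRightCoaction.sw_coassoc]
          · refine sw_congr fun a h => ?_
            rw [hT.sw_left (fun y => sw (ρ x) fun x h' =>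
              sw (B.coact (f x)) fun b u => (a * b) ⊗ₜ[k] (T h' * y * u)) (by fun_prop)]
            simp only [mul_one]
          all_goals intros; fun_prop
      _ = sw (ρ x) fun x h' => sw (B.coact (f x)) fun b u => (a * b) ⊗ₜ[k] (T h' * u) :=
          B.isRightCoaction.sw_counit (F := fun a => sw (ρ x) fun x h' =>
          sw (B.coact (f x)) fun b u => (a * b) ⊗ₜ[k] (T h' * u)) a (by fun_prop)
      _ = _ := by
          rw [homCoaction_apply, Lin.map_sw (g := fun t : A ⊗[k] H => a • t) (by fun_prop)]
          refine sw_congr fun x h => ?_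
          rw [Lin.map_sw (g := fun t : A ⊗[k] H => a • t) (by fun_prop)]
          rfl
  all_goals intros; fun_prop

/-- `δ` is the coaction `f ↦ f₍₀₎ ⊗ f₍₁₎` on `Hom_A(M, A)` for which
`f₍₀₎(x) ⊗ f₍₁₎` is the value at `x` of `homCoaction`. -/
def IsHomCoaction (B : BraidedHopfAlgebra R A) (T : H →ₗ[k] H) (ρ : M →ₗ[k] M ⊗[k] H)
    (δ : (M →ₗ[A] A) →ₗ[k] (M →ₗ[A] A) ⊗[k] H) : Prop :=
  ∀ f x, (sw (δ f) fun g h => g x ⊗ₜ[k] h) = homCoaction B T ρ f x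

/-- A-linearity of `homCoaction` gives a tensor for each f by surjectivity; injectivity of
evaluation makes the choice unique, hence linear in f. -/
theorem exists_isHomCoaction {T : H →ₗ[k] H} (hT : IsAntipodeInv T) {ρ : M →ₗ[k] M ⊗[k] H}
    (hρ : IsHopfModule B ρ) [Module.Finite A M] [Module.Projective A M] :
    ∃ δ, IsHomCoaction B T ρ δ := by
  have hex : ∀ f : M →ₗ[A] A, ∃ t : (M →ₗ[A] A) ⊗[k] H, ∀ x,
      (sw t fun g h => g x ⊗ₜ[k] h) = homCoaction B T ρ f x := fun f =>
    hom_tensor_surjective (homCoaction B T ρ f) (map_add _) (homCoaction_smul hT hρ f)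
  choose δ hδ using hex
  have hl : ∀ x, Lin k fun t : (M →ₗ[A] A) ⊗[k] H => sw t fun f v => f x ⊗ₜ[k] v :=
    fun x => by fun_prop
  refine ⟨⟨⟨δ, fun f g => hom_tensor_ext _ _ fun x => ?_⟩, fun c f =>
    hom_tensor_ext _ _ fun x => ?_⟩, hδ⟩
  · rw [(hl x).map_add', hδ, hδ, hδ]
    have : Lin k fun f : M →ₗ[A] A => homCoaction B T ρ f x := by
      simp only [homCoaction_apply]; fun_prop
    exact this.map_add' f g
  · rw [RingHom.id_apply, (hl x).map_smul', hδ, hδ]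
    have : Lin k fun f : M →ₗ[A] A => homCoaction B T ρ f x := by
      simp only [homCoaction_apply]; fun_prop
    exact this.map_smul' c f

namespace IsHomCoaction

variable {T : H →ₗ[k] H} {ρ : M →ₗ[k] M ⊗[k] H} {δ : (M →ₗ[A] A) →ₗ[k] (M →ₗ[A] A) ⊗[k] H}

theorem sw_apply (hδ : IsHomCoaction B T ρ δ) (f : M →ₗ[A] A) (x : M) {F : A → H → U}
    (h1 : ∀ y, Lin k fun x => F x y) (h2 : ∀ x, Lin k fun y => F x y) :
    (sw (δ f) fun g h => F (g x) h) =
      sw (ρ x) fun x h => sw (B.coact (f x)) fun a u => F a (T h * u) := by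
  rw [← sw_homCoaction T ρ f x h1 h2, ← hδ, sw_sw _ _ h1 h2]
  exact sw_congr fun g h => (sw_tmul _ _ h1 h2).symm

/-- The evaluation `M ⊗ Hom_A(M, A) → A` is colinear. -/
theorem sw_coact_apply (hδ : IsHomCoaction B T ρ δ) (hT : IsAntipodeInv T)
    (hρ : IsRightCoaction ρ) (f : M →ₗ[A] A) (x : M) {F : A → H → U}
    (h1 : ∀ y, Lin k fun x => F x y) (h2 : ∀ x, Lin k fun y => F x y) :
    sw (B.coact (f x)) F = sw (δ f) fun g h => sw (ρ x) fun y u => F (g y) (u * h) := by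
  refine Eq.symm ?_
  calc (sw (δ f) fun g h => sw (ρ x) fun y u => F (g y) (u * h))
      = sw (ρ x) fun y u => sw (ρ y) fun y v => sw (B.coact (f y)) fun a w =>
          F a (u * T v * w) := by
        rw [sw_comm]
        refine sw_congr fun y u => ?_
        rw [hδ.sw_apply (F := fun a h => F a (u * h))]
        · simp only [mul_assoc]
        all_goals intros; fun_prop
    _ = sw (ρ x) fun y h => ε h • sw (B.coact (f y)) fun a w => F a w := by
        rw [hρ.sw_coassoc]
        · refine sw_congr fun y h => ?_
          rw [hT.sw_right (fun u => sw (B.coact (f y)) fun a w => F a (u * w)) (by fun_prop)]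
          simp only [one_mul]
        all_goals intros; fun_prop
    _ = _ := hρ.sw_counit (F := fun y => sw (B.coact (f y)) F) x (by fun_prop)

/-- Checked after evaluation at x. For coassociativity, S⁻¹ reverses the coproduct just as the order
in which x is coacted upon is reversed, so the two sides agree by multiplicativity of Δ. -/
theorem isRightCoaction (hδ : IsHomCoaction B T ρ δ) (hT : IsAntipodeInv T)
    (hρ : IsRightCoaction ρ) : IsRightCoaction δ where
  coassoc := by
    refine LinearMap.ext fun f => ?_
    simp only [LinearMap.comp_apply, LinearEquiv.coe_coe]
    rw [LinearEquiv.eq_symm_apply]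
    refine hom_tensor_ext _ _ fun x => ?_
    have e : ∀ (g : M →ₗ[A] A) (t : H ⊗[k] H), g x ⊗ₜ[k] t = sw t fun u v => g x ⊗ₜ (u ⊗ₜ v) :=
      fun g t => by
        conv_lhs => rw [← sw_self t]
        rw [Lin.map_sw (g := fun t => g x ⊗ₜ[k] t) (by fun_prop)]
    refine (sw_congr fun g t => e g t).trans (Eq.trans ?_ (sw_congr fun g t => (e g t).symm))
    rw [sw_assoc, sw_rTensor, sw_lTensor]
    · calc (sw (δ f) fun g h => sw (δ g) fun g h' => g x ⊗ₜ[k] (h' ⊗ₜ[k] h))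
          = sw (ρ x) fun y v => sw (δ f) fun g h => sw (B.coact (g y)) fun a u =>
              a ⊗ₜ[k] ((T v * u) ⊗ₜ[k] h) := by
            rw [sw_comm (ρ x)]
            refine sw_congr fun g h => ?_
            rw [hδ.sw_apply (F := fun a h' => a ⊗ₜ[k] (h' ⊗ₜ[k] h))]
            all_goals intros; fun_prop
        _ = sw (ρ x) fun y v => sw (ρ y) fun y w => sw (B.coact (f y)) fun b t =>
              sw (B.coact b) fun a u => a ⊗ₜ[k] ((T v * u) ⊗ₜ[k] (T w * t)) :=
            sw_congr fun y v => by
              rw [hδ.sw_apply (F := fun b h => sw (B.coact b) fun a u =>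
                a ⊗ₜ[k] ((T v * u) ⊗ₜ[k] h))]
              all_goals intros; fun_prop
        _ = sw (ρ x) fun y h => sw (Δ h) fun w v => sw (B.coact (f y)) fun a t =>
              sw (Δ t) fun u t => a ⊗ₜ[k] ((T v * u) ⊗ₜ[k] (T w * t)) := by
            rw [hρ.sw_coassoc]
            · refine sw_congr fun y h => sw_congr fun w v => ?_
              rw [B.isRightCoaction.sw_coassoc]
              all_goals intros; fun_prop
            all_goals intros; fun_prop
        _ = sw (ρ x) fun y h => sw (B.coact (f y)) fun a t => sw (Δ (T h * t)) fun u v =>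
              a ⊗ₜ[k] (u ⊗ₜ[k] v) := sw_congr fun y h => by
            rw [sw_comm]
            refine sw_congr fun a t => ?_
            rw [sw_comul_mul, hT.sw_comul]
            all_goals intros; fun_prop
        _ = _ := by
            rw [hδ.sw_apply (F := fun a h => sw (Δ h) fun u v => a ⊗ₜ[k] (u ⊗ₜ[k] v))]
            all_goals intros; fun_prop
    all_goals intros; fun_prop
  counit := by
    refine LinearMap.ext fun f => ?_
    simp only [LinearMap.comp_apply, LinearMap.flip_apply, TensorProduct.mk_apply]
    refine hom_tensor_ext _ _ fun x => ?_
    rw [sw_lTensor, sw_tmul, hδ.sw_apply (F := fun a h => a ⊗ₜ[k] ε h)]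
    · calc (sw (ρ x) fun y h => sw (B.coact (f y)) fun a u => a ⊗ₜ[k] ε (T h * u))
          = sw (ρ x) fun y h => ε h • (f y ⊗ₜ[k] (1 : k)) := sw_congr fun y h => by
            rw [← B.isRightCoaction.sw_counit (F := fun a => ε h • (a ⊗ₜ[k] (1 : k))) (f y)
              (by fun_prop)]
            refine sw_congr fun a u => ?_
            rw [Bialgebra.counit_mul, hT.counit_apply, smul_smul, _root_.mul_comm, ← tmul_smul,
              smul_eq_mul, mul_one]
        _ = _ := hρ.sw_counit (F := fun y => f y ⊗ₜ[k] (1 : k)) x (by fun_prop)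
    all_goals intros; fun_prop

/-- The coaction on `Hom_A(M, A)` is natural in `M`. -/
theorem apply_comp (hδ : IsHomCoaction B T ρ δ) {σ : N →ₗ[k] N ⊗[k] H}
    {δ' : (N →ₗ[A] A) →ₗ[k] (N →ₗ[A] A) ⊗[k] H} (hδ' : IsHomCoaction B T σ δ') (φ : N →ₗ[A] M)
    (hφ : IsColinear σ ρ (φ.restrictScalars k)) (f : M →ₗ[A] A) :
    δ' (f ∘ₗ φ) = (LinearMap.lcomp k A φ).rTensor H (δ f) := by
  refine hom_tensor_ext _ _ fun x => ?_
  rw [hδ', homCoaction_apply, sw_rTensor]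
  · have e := hδ.sw_apply f (φ x) (F := fun a h => a ⊗ₜ[k] h) (by intros; fun_prop)
      (by intros; fun_prop)
    refine Eq.trans ?_ e.symm
    have e' := hφ.sw_apply x (F := fun y h => sw (B.coact (f y)) fun a u => a ⊗ₜ[k] (T h * u))
      (by intros; fun_prop) (by intros; fun_prop)
    exact e'.symm
  all_goals intros; fun_prop

/-- The right multiplication `Hom_A(M, A) ⊗ A → Hom_A(M, A)` is colinear. -/
theorem sw_homMulRight (hδ : IsHomCoaction B T ρ δ) (f : M →ₗ[A] A) (a : A)
    {F : (M →ₗ[A] A) → H → U} (h1 : ∀ y, Lin k fun x => F x y) (h2 : ∀ x, Lin k fun y => F x y) :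
    sw (δ (homMulRight f a)) F = sw (δ f) fun g h => sw (B.coact a) fun b u =>
      F (homMulRight g b) (h * u) := by
  have key : δ (homMulRight f a) = sw (δ f) fun g h => sw (B.coact a) fun b u =>
      homMulRight g b ⊗ₜ[k] (h * u) := by
    refine hom_tensor_ext _ _ fun x => ?_
    rw [hδ, homCoaction_apply, sw_sw]
    · calc (sw (ρ x) fun y h => sw (B.coact (homMulRight f a y)) fun b u => b ⊗ₜ[k] (T h * u))
          = sw (ρ x) fun y h => sw (B.coact (f y)) fun b u => sw (B.coact a) fun c v =>
              (b * c) ⊗ₜ[k] (T h * u * v) := sw_congr fun y h => by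
            rw [homMulRight_apply, B.sw_coact_mul]
            · simp only [mul_assoc]
            all_goals intros; fun_prop
        _ = sw (δ f) fun g h => sw (B.coact a) fun c v => (g x * c) ⊗ₜ[k] (h * v) := by
            rw [hδ.sw_apply (F := fun b h => sw (B.coact a) fun c v => (b * c) ⊗ₜ[k] (h * v))]
            all_goals intros; fun_prop
        _ = _ := sw_congr fun g h => by
            rw [sw_sw]
            · refine sw_congr fun b u => ?_
              rw [sw_tmul]
              · rfl
              all_goals intros; fun_prop
            all_goals intros; fun_prop
    all_goals intros; fun_prop
  rw [key, sw_sw _ _ h1 h2]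
  refine sw_congr fun g h => ?_
  rw [sw_sw _ _ h1 h2]
  exact sw_congr fun b u => sw_tmul _ _ h1 h2

end IsHomCoaction

end HomCoaction

end

section

/-! ### The bimodule `M ⊗ A` -/

section IndBimod

variable {k H : Type u} [Field k] [Ring H] [HopfAlgebra k H] {R : UniversalRForm k H}
variable {A : Type u} [Ring A] [Algebra k A] [Coalgebra k A] {B : BraidedHopfAlgebra R A}
variable {M : Type u} [AddCommGroup M] [Module k M] [Module A M] [IsScalarTower k A M]
variable {N : Type u} [AddCommGroup N] [Module k N] [Module A N] [IsScalarTower k A N]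
variable {U : Type*} [AddCommGroup U] [Module k U]

local notation "Δ" => comul (R := k)
local notation "ε" => counit (R := k)
local notation "S" => HopfAlgebra.antipode k (A := H)

variable (B) in
/-- The left action `a · (p ⊗ x) = a₍₁₎ p₍₀₎ ⊗ (a₍₂₎ ◁ p₍₁₎) x` of `A` on `M ⊗ A`. -/
def twistedSMul (ρ : M →ₗ[k] M ⊗[k] H) (a : A) (t : M ⊗[k] A) : M ⊗[k] A :=
  sw t fun p x => sw (Δ a) fun a a' => sw (ρ p) fun p u => (a • p) ⊗ₜ (B.act a' u * x)

@[fun_prop] theorem lin_twistedSMul_left {V : Type*} [AddCommGroup V] [Module k V] {f : V → A}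
    (hf : Lin k f) (ρ : M →ₗ[k] M ⊗[k] H) (t : M ⊗[k] A) :
    Lin k fun x => twistedSMul B ρ (f x) t := by
  unfold twistedSMul; fun_prop

@[fun_prop] theorem lin_twistedSMul_right {V : Type*} [AddCommGroup V] [Module k V]
    {f : V → M ⊗[k] A} (hf : Lin k f) (ρ : M →ₗ[k] M ⊗[k] H) (a : A) :
    Lin k fun x => twistedSMul B ρ a (f x) := by
  unfold twistedSMul; fun_prop

theorem twistedSMul_tmul (ρ : M →ₗ[k] M ⊗[k] H) (a : A) (p : M) (x : A) :
    twistedSMul B ρ a (p ⊗ₜ x) = sw (Δ a) fun a a' => sw (ρ p) fun p u =>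
      (a • p) ⊗ₜ (B.act a' u * x) := by
  rw [twistedSMul, sw_tmul]
  all_goals intros; fun_prop

theorem twistedSMul_one {ρ : M →ₗ[k] M ⊗[k] H} (hρ : IsRightCoaction ρ) (t : M ⊗[k] A) :
    twistedSMul B ρ 1 t = t := by
  conv_rhs => rw [← sw_self t]
  refine sw_congr fun p x => ?_
  rw [B.comul_one, sw_tmul]
  · simp only [B.one_act, one_smul, smul_mul_assoc, one_mul, tmul_smul]
    exact hρ.sw_counit (F := fun p => p ⊗ₜ[k] x) p (by fun_prop)
  all_goals intros; fun_prop

/-- The twist of a₂ by b₁ in the braided coproduct of ab is the same twist that colinearity of the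
action produces in the coaction of b₁ p. -/
theorem twistedSMul_mul {ρ : M →ₗ[k] M ⊗[k] H} (hρ : IsHopfModule B ρ) (a b : A)
    (t : M ⊗[k] A) : twistedSMul B ρ (a * b) t = twistedSMul B ρ a (twistedSMul B ρ b t) := by
  rw [(show Lin k fun t => twistedSMul B ρ (a * b) t by fun_prop).tensor_eq t,
    (show Lin k fun t => twistedSMul B ρ a (twistedSMul B ρ b t) by fun_prop).tensor_eq t]
  refine sw_congr fun p x => ?_
  rw [twistedSMul_tmul, twistedSMul_tmul, Lin.map_sw (g := fun t => twistedSMul B ρ a t)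
    (by fun_prop), B.comul_mul_apply]
  · calc (sw (Δ a) fun a a' => sw (Δ b) fun b b' => sw (B.coact b) fun b h => sw (ρ p) fun p u =>
          ((a * b) • p) ⊗ₜ[k] (B.act (B.act a' h * b') u * x))
        = sw (Δ a) fun a a' => sw (Δ b) fun b b' => sw (B.coact b) fun b h => sw (ρ p) fun p u =>
          sw (ρ p) fun p v =>
          (a • b • p) ⊗ₜ[k] (B.act a' (h * v) * (B.act b' u * x)) :=
          sw_congr fun a a' => sw_congr fun b b' => sw_congr fun b h => by
            rw [hρ.isRightCoaction.sw_coassoc]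
            · refine sw_congr fun p u => ?_
              rw [B.mul_act, Lin.map_sw (g := fun y => ((a * b) • p) ⊗ₜ[k] (y * x)) (by fun_prop)]
              refine sw_congr fun v u => ?_
              rw [B.act_mul, mul_smul, mul_assoc]
            all_goals intros; fun_prop
      _ = sw (Δ b) fun b b' => sw (ρ p) fun p u => sw (Δ a) fun a a' => sw (B.coact b) fun b h =>
          sw (ρ p) fun p v => (a • b • p) ⊗ₜ[k] (B.act a' (h * v) * (B.act b' u * x)) := by
          rw [sw_comm]
          refine sw_congr fun b b' => ?_
          rw [sw_comm (ρ p)]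
          refine sw_congr fun a a' => ?_
          rw [sw_comm (ρ p)]
      _ = _ := sw_congr fun b b' => by
          rw [Lin.map_sw (g := fun t => twistedSMul B ρ a t) (by fun_prop)]
          refine sw_congr fun p u => ?_
          rw [twistedSMul_tmul]
          refine sw_congr fun a a' => ?_
          rw [hρ.sw_smul]
          all_goals intros; fun_prop
  all_goals intros; fun_prop

/-- The tensor product `M ⊗ A`, with its bimodule structure
`a · (p ⊗ x) · b = a₍₁₎ p₍₀₎ ⊗ (a₍₂₎ ◁ p₍₁₎) x b`. -/
def IndBimod {ρ : M →ₗ[k] M ⊗[k] H} (_ : IsHopfModule B ρ) : Type u := M ⊗[k] A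

namespace IndBimod

variable {ρ : M →ₗ[k] M ⊗[k] H} (hρ : IsHopfModule B ρ)
variable {σ : N →ₗ[k] N ⊗[k] H} (hσ : IsHopfModule B σ)

instance : AddCommGroup (IndBimod hρ) := inferInstanceAs (AddCommGroup (M ⊗[k] A))

instance : Module k (IndBimod hρ) := inferInstanceAs (Module k (M ⊗[k] A))

/-- The identity map. -/
def of : M ⊗[k] A ≃ₗ[k] IndBimod hρ := LinearEquiv.refl k _

/-- The left action of `A` on `M ⊗ A`. -/
def leftRep : A →ₐ[k] Module.End k (M ⊗[k] A) :=
  AlgHom.ofLinearMap (Lin.toLinearMap (k := k) (f := fun a : A =>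
      Lin.toLinearMap (k := k) (f := fun t => twistedSMul B ρ a t) (by fun_prop))
      ⟨fun a b => LinearMap.ext fun t =>
        (show Lin k fun a => twistedSMul B ρ a t by fun_prop).map_add' a b,
       fun c a => LinearMap.ext fun t =>
        (show Lin k fun a => twistedSMul B ρ a t by fun_prop).map_smul' c a⟩)
    (LinearMap.ext fun t => twistedSMul_one hρ.isRightCoaction t)
    (fun a b => LinearMap.ext fun t => twistedSMul_mul hρ a b t)

variable (k A M) in
/-- The right action of `A` on `M ⊗ A`. -/
def rightRep : Aᵐᵒᵖ →ₐ[k] Module.End k (M ⊗[k] A) :=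
  AlgHom.ofLinearMap (LinearMap.lTensorHom M ∘ₗ (LinearMap.mul k A).flip ∘ₗ
    (MulOpposite.opLinearEquiv k).symm.toLinearMap)
    (by ext; simp) (fun a b => by ext; simp [mul_assoc])

theorem rightRep_tmul (b : Aᵐᵒᵖ) (p : M) (x : A) :
    rightRep k A M b (p ⊗ₜ x) = p ⊗ₜ (x * b.unop) := rfl

theorem commute_leftRep_rightRep (a : A) (b : Aᵐᵒᵖ) :
    Commute (leftRep hρ a) (rightRep k A M b) := by
  refine TensorProduct.ext' fun p x => ?_
  change twistedSMul B ρ a (p ⊗ₜ (x * b.unop)) =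
    rightRep k A M b (twistedSMul B ρ a (p ⊗ₜ x))
  simp only [twistedSMul_tmul]
  rw [Lin.map_sw (g := fun t => rightRep k A M b t) (by fun_prop)]
  refine sw_congr fun a a' => ?_
  rw [Lin.map_sw (g := fun t => rightRep k A M b t) (by fun_prop)]
  refine sw_congr fun p u => ?_
  rw [rightRep_tmul, mul_assoc]

/-- The representation of the enveloping algebra on `M ⊗ A`. -/
def rep : A ⊗[k] Aᵐᵒᵖ →ₐ[k] Module.End k (M ⊗[k] A) :=
  Algebra.TensorProduct.lift (leftRep hρ) (rightRep k A M) (commute_leftRep_rightRep hρ)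

@[fun_prop] theorem lin_rep {s : U → A ⊗[k] Aᵐᵒᵖ} (hs : Lin k s) :
    Lin k fun x => rep hρ (s x) :=
  (Lin.coe (rep hρ).toLinearMap).comp hs

instance : Module (A ⊗[k] Aᵐᵒᵖ) (IndBimod hρ) :=
  letI : Module (Module.End k (M ⊗[k] A)) (IndBimod hρ) :=
    inferInstanceAs (Module (Module.End k (M ⊗[k] A)) (M ⊗[k] A))
  Module.compHom (IndBimod hρ) (rep hρ).toRingHom

theorem smul_def (s : A ⊗[k] Aᵐᵒᵖ) (t : M ⊗[k] A) : s • of hρ t = of hρ (rep hρ s t) := rfl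

instance : IsScalarTower k (A ⊗[k] Aᵐᵒᵖ) (IndBimod hρ) where
  smul_assoc c s t := by
    change rep hρ (c • s) t = c • rep hρ s t
    rw [map_smul]
    rfl

theorem tmul_smul_tmul (a b : A) (p : M) (x : A) :
    (a ⊗ₜ[k] MulOpposite.op b) • of hρ (p ⊗ₜ x) = of hρ (sw (Δ a) fun a a' => sw (ρ p) fun p u =>
      (a • p) ⊗ₜ (B.act a' u * x * b)) := by
  rw [smul_def, rep, Algebra.TensorProduct.lift_tmul]
  change of hρ (twistedSMul B ρ a (p ⊗ₜ (x * b))) = _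
  rw [twistedSMul_tmul]
  simp only [mul_assoc]

/-- To check linearity over the enveloping algebra, it is enough to check it for `A` and for
`Aᵒᵖ` on pure tensors. -/
theorem map_smul_of {X : Type*} [AddCommGroup X] [Module k X] [Module (A ⊗[k] Aᵐᵒᵖ) X]
    [IsScalarTower k (A ⊗[k] Aᵐᵒᵖ) X] {f : M ⊗[k] A → X} (hf : Lin k f)
    (h : ∀ (a b : A) (p : M) (x : A), (sw (Δ a) fun a a' => sw (ρ p) fun p u =>
      f ((a • p) ⊗ₜ (B.act a' u * x * b))) = (a ⊗ₜ[k] MulOpposite.op b) • f (p ⊗ₜ x))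
    (s : A ⊗[k] Aᵐᵒᵖ) (t : IndBimod hρ) : f ((of hρ).symm (s • t)) = s • f ((of hρ).symm t) := by
  obtain ⟨t, rfl⟩ := (of hρ).surjective t
  rw [smul_def, LinearEquiv.symm_apply_apply, LinearEquiv.symm_apply_apply]
  have h1 : Lin k fun s => f (rep hρ s t) := hf.comp (Lin.coe_left (lin_rep hρ Lin.id') t)
  rw [h1.tensor_eq s, (show Lin k fun s : A ⊗[k] Aᵐᵒᵖ => s • f t by fun_prop).tensor_eq s]
  refine sw_congr fun a b => ?_
  obtain ⟨b, rfl⟩ := MulOpposite.op_surjective b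
  have h2 : Lin k fun t => f (rep hρ (a ⊗ₜ MulOpposite.op b) t) := hf.comp (by fun_prop)
  rw [h2.tensor_eq t,
    (show Lin k fun t => (a ⊗ₜ[k] MulOpposite.op b) • f t by fun_prop).tensor_eq t]
  refine sw_congr fun p x => ?_
  rw [← h]
  have := tmul_smul_tmul hρ a b p x
  rw [smul_def] at this
  rw [(of hρ).injective this, hf.map_sw]
  exact sw_congr fun a a' => hf.map_sw _ _

variable {hρ hσ} in
/-- The bimodule map `φ ⊗ A` of a colinear module map `φ`. -/
def map (φ : M →ₗ[A] N) (hφ : IsColinear ρ σ (φ.restrictScalars k)) :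
    IndBimod hρ →ₗ[A ⊗[k] Aᵐᵒᵖ] IndBimod hσ where
  toFun t := of hσ ((φ.restrictScalars k).rTensor A ((of hρ).symm t))
  map_add' s t := by simp only [map_add]
  map_smul' s t := by
    refine map_smul_of hρ (f := fun t => of hσ ((φ.restrictScalars k).rTensor A t))
      ((Lin.coe (of hσ).toLinearMap).comp (by fun_prop)) (fun a b p x => ?_) s t
    rw [LinearMap.rTensor_tmul, tmul_smul_tmul, ← LinearEquiv.coe_coe (of hσ),
      (Lin.coe (of hσ).toLinearMap).map_sw]
    refine sw_congr fun a a' => ?_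
    rw [hφ.sw_apply, (Lin.coe (of hσ).toLinearMap).map_sw]
    · refine sw_congr fun p u => ?_
      simp
    all_goals intros; fun_prop

variable {hρ hσ} in
theorem map_of (φ : M →ₗ[A] N) (hφ : IsColinear ρ σ (φ.restrictScalars k)) (t : M ⊗[k] A) :
    map (hρ := hρ) (hσ := hσ) φ hφ (of hρ t) = of hσ ((φ.restrictScalars k).rTensor A t) := rfl

end IndBimod

end IndBimod

end

section

/-! ### Free modules -/

section Free

variable {k H : Type u} [Field k] [Ring H] [HopfAlgebra k H] {R : UniversalRForm k H}
variable {A : Type u} [Ring A] [Algebra k A] [Coalgebra k A] {B : BraidedHopfAlgebra R A}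
variable {V : Type u} [AddCommGroup V] [Module k V]
variable {W : Type u} [AddCommGroup W] [Module k W]
variable {U : Type*} [AddCommGroup U] [Module k U]

local notation "Δ" => comul (R := k)
local notation "ε" => counit (R := k)
local notation "S" => HopfAlgebra.antipode k (A := H)

theorem IsRightCoaction.of_sw {ρ : V →ₗ[k] V ⊗[k] H}
    (h1 : ∀ v, (sw (ρ v) fun x h => sw (ρ x) fun x h' => x ⊗ₜ[k] (h' ⊗ₜ[k] h)) =
      sw (ρ v) fun x h => sw (Δ h) fun h h' => x ⊗ₜ[k] (h ⊗ₜ[k] h'))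
    (h2 : ∀ v, (sw (ρ v) fun x h => ε h • x) = v) : IsRightCoaction ρ where
  coassoc := by
    refine LinearMap.ext fun v => ?_
    simp only [LinearMap.comp_apply, LinearEquiv.coe_coe]
    rw [LinearEquiv.eq_symm_apply]
    have e : ∀ t : V ⊗[k] (H ⊗[k] H), t = sw t fun v s => sw s fun x y => v ⊗ₜ (x ⊗ₜ y) :=
      fun t => by
        conv_lhs => rw [← sw_self t]
        refine sw_congr fun v s => ?_
        conv_lhs => rw [← sw_self s]
        rw [Lin.map_sw (g := fun t => v ⊗ₜ[k] t) (by fun_prop)]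
    rw [e (TensorProduct.assoc k V H H _), e (LinearMap.lTensor V _ _), sw_assoc, sw_rTensor,
      sw_lTensor]
    · exact h1 v
    all_goals intros; fun_prop
  counit := by
    refine LinearMap.ext fun v => ?_
    simp only [LinearMap.comp_apply, LinearMap.flip_apply, TensorProduct.mk_apply]
    rw [← sw_self (LinearMap.lTensor V _ _), sw_lTensor]
    · conv_rhs => rw [← h2 v, Lin.map_sw (g := fun t => t ⊗ₜ[k] (1 : k)) (by fun_prop)]
      refine sw_congr fun x h => ?_
      rw [← smul_tmul', ← tmul_smul, smul_eq_mul, mul_one]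
    all_goals intros; fun_prop

theorem IsRightCoaction.tensor {ρ : V →ₗ[k] V ⊗[k] H} {σ : W →ₗ[k] W ⊗[k] H}
    (hρ : IsRightCoaction ρ) (hσ : IsRightCoaction σ) : IsRightCoaction (tensorCoaction ρ σ) := by
  refine .of_sw (fun t => ?_) fun t => ?_
  · rw [sw_tensorCoaction, sw_tensorCoaction]
    · refine sw_congr fun v w => ?_
      calc (sw (ρ v) fun x h => sw (σ w) fun y g =>
            sw (tensorCoaction ρ σ (x ⊗ₜ y)) fun z h' => z ⊗ₜ[k] (h' ⊗ₜ[k] (h * g)))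
          = sw (ρ v) fun x h => sw (ρ x) fun x h' => sw (σ w) fun y g => sw (σ y) fun y g' =>
            (x ⊗ₜ[k] y) ⊗ₜ[k] ((h' * g') ⊗ₜ[k] (h * g)) := sw_congr fun x h => by
            rw [sw_comm (ρ x)]
            refine sw_congr fun y g => ?_
            rw [sw_tensorCoaction, sw_tmul]
            all_goals intros; fun_prop
        _ = sw (ρ v) fun x h => sw (Δ h) fun h h' => sw (σ w) fun y g => sw (Δ g) fun g g' =>
            (x ⊗ₜ[k] y) ⊗ₜ[k] ((h * g) ⊗ₜ[k] (h' * g')) := by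
            rw [hρ.sw_coassoc]
            · refine sw_congr fun x h => sw_congr fun h h' => ?_
              rw [hσ.sw_coassoc]
              all_goals intros; fun_prop
            all_goals intros; fun_prop
        _ = _ := sw_congr fun x h => by
            rw [sw_comm]
            refine sw_congr fun y g => ?_
            rw [sw_comul_mul]
            all_goals intros; fun_prop
    all_goals intros; fun_prop
  · conv_rhs => rw [← sw_self t]
    rw [sw_tensorCoaction]
    · refine sw_congr fun v w => ?_
      rw [← hρ.sw_counit (F := fun v => v ⊗ₜ[k] w) v (by fun_prop)]
      refine sw_congr fun x h => ?_
      rw [← hσ.sw_counit (F := fun w => ε h • (x ⊗ₜ[k] w)) w (by fun_prop)]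
      refine sw_congr fun y g => ?_
      rw [Bialgebra.counit_mul, smul_smul, _root_.mul_comm]
    all_goals intros; fun_prop

theorem sw_tensorCoaction_tmul (ρ : V →ₗ[k] V ⊗[k] H) (σ : W →ₗ[k] W ⊗[k] H) (v : V) (w : W)
    {F : V ⊗[k] W → H → U} (h1 : ∀ y, Lin k fun x => F x y) (h2 : ∀ x, Lin k fun y => F x y) :
    sw (tensorCoaction ρ σ (v ⊗ₜ w)) F = sw (ρ v) fun x h => sw (σ w) fun y h' =>
      F (x ⊗ₜ y) (h * h') := by
  rw [sw_tensorCoaction _ _ _ h1 h2, sw_tmul]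
  all_goals intros; fun_prop

theorem IsHopfModule.free {σ : V →ₗ[k] V ⊗[k] H} (hσ : IsRightCoaction σ) :
    IsHopfModule B (tensorCoaction B.coact σ) where
  isRightCoaction := B.isRightCoaction.tensor hσ
  smul_colinear := by
    refine TensorProduct.ext' fun a t => ?_
    simp only [LinearMap.comp_apply]
    refine (sw_self _).symm.trans (Eq.trans ?_ (sw_self _))
    rw [sw_rTensor, sw_tensorCoaction_tmul]
    · change sw (tensorCoaction B.coact σ (a • t)) _ = sw (B.coact a) fun a h =>
        sw (tensorCoaction B.coact σ t) fun t h' => (a • t) ⊗ₜ (h * h')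
      refine ((show Lin k fun t => sw (tensorCoaction B.coact σ (a • t)) fun x y => x ⊗ₜ[k] y
        by fun_prop).tensor_eq t).trans (Eq.trans (sw_congr fun b v => ?_)
        (Eq.symm ((show Lin k fun t => sw (B.coact a) fun a h =>
        sw (tensorCoaction B.coact σ t) fun t h' => (a • t) ⊗ₜ[k] (h * h') by
          fun_prop).tensor_eq t)))
      rw [smul_tmul', sw_tensorCoaction_tmul, smul_eq_mul, B.sw_coact_mul]
      · refine sw_congr fun a h => ?_
        rw [sw_tensorCoaction_tmul]
        · simp only [smul_tmul', smul_eq_mul, mul_assoc]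
        all_goals intros; fun_prop
      all_goals intros; fun_prop
    all_goals intros; fun_prop

namespace IndBimod

variable (B) in
/-- The map `A^e ⊗ V → (A ⊗ V) ⊗ A`, `s ⊗ v ↦ s · (1 ⊗ v ⊗ 1)`. -/
def ofFree {σ : V →ₗ[k] V ⊗[k] H} (hσ : IsRightCoaction σ) : (A ⊗[k] Aᵐᵒᵖ) ⊗[k] V →ₗ[A ⊗[k] Aᵐᵒᵖ]
    IndBimod (IsHopfModule.free (B := B) hσ) :=
  TensorProduct.AlgebraTensorModule.lift
    { toFun := fun s =>
        { toFun := fun v => s • of (IsHopfModule.free (B := B) hσ) ((1 ⊗ₜ v) ⊗ₜ 1)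
          map_add' := fun v w => by simp only [tmul_add, add_tmul, map_add, smul_add]
          map_smul' := fun c v => by
            rw [tmul_smul, ← smul_tmul', map_smul, RingHom.id_apply,
              ← algebraMap_smul (A ⊗[k] Aᵐᵒᵖ) c (of _ _), smul_smul, ← Algebra.commutes,
              ← smul_smul, algebraMap_smul] }
      map_add' := fun s t => LinearMap.ext fun v => add_smul _ _ _
      map_smul' := fun s t => LinearMap.ext fun v => mul_smul _ _ _ }

theorem ofFree_tmul {σ : V →ₗ[k] V ⊗[k] H} (hσ : IsRightCoaction σ) (s : A ⊗[k] Aᵐᵒᵖ) (v : V) :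
    ofFree B hσ (s ⊗ₜ v) = s • of (IsHopfModule.free (B := B) hσ) ((1 ⊗ₜ v) ⊗ₜ 1) := rfl

theorem ofFree_tmul_tmul {σ : V →ₗ[k] V ⊗[k] H} (hσ : IsRightCoaction σ) (a b : A) (v : V) :
    ofFree B hσ ((a ⊗ₜ MulOpposite.op b) ⊗ₜ v) = of (IsHopfModule.free (B := B) hσ)
      (sw (Δ a) fun a a' => sw (σ v) fun v u => (a ⊗ₜ v) ⊗ₜ (B.act a' u * b)) := by
  rw [ofFree_tmul, tmul_smul_tmul]
  congr 1
  refine sw_congr fun a a' => ?_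
  rw [sw_tensorCoaction_tmul, B.sw_coact_one]
  · simp only [smul_tmul', smul_eq_mul, mul_one, one_mul]
  all_goals intros; fun_prop

variable (B) in
/-- The inverse of `ofFree`. -/
def toFree (σ : V →ₗ[k] V ⊗[k] H) (t : (A ⊗[k] V) ⊗[k] A) : (A ⊗[k] Aᵐᵒᵖ) ⊗[k] V :=
  sw t fun m x => sw m fun a v => sw (Δ a) fun a a' => sw (σ v) fun v u =>
    (a ⊗ₜ MulOpposite.op (B.antipode (B.act a' u) * x)) ⊗ₜ v

@[fun_prop] theorem lin_op {f : U → A} (hf : Lin k f) : Lin k fun x => MulOpposite.op (f x) :=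
  (Lin.coe (MulOpposite.opLinearEquiv k).toLinearMap).comp hf

theorem lin_toFree (σ : V →ₗ[k] V ⊗[k] H) : Lin k (toFree B σ) := by
  unfold toFree
  fun_prop

theorem toFree_tmul (σ : V →ₗ[k] V ⊗[k] H) (a : A) (v : V) (x : A) :
    toFree B σ ((a ⊗ₜ v) ⊗ₜ x) = sw (Δ a) fun a a' => sw (σ v) fun v u =>
      (a ⊗ₜ MulOpposite.op (B.antipode (B.act a' u) * x)) ⊗ₜ v := by
  rw [toFree, sw_tmul, sw_tmul]
  all_goals intros; fun_prop

variable (B) in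
-- On pure tensors the map is a ⊗ b ⊗ v ↦ (a₁ ⊗ v₍₀₎) ⊗ (a₂ ◁ v₍₁₎) b, and its inverse uses S(a₂ ◁
-- v₍₁₎) instead. In either composite the two twisted legs of a meet and cancel by the antipode
-- identities, which survive the action of `H`.
theorem ofFree_bijective {σ : V →ₗ[k] V ⊗[k] H} (hσ : IsRightCoaction σ) :
    Function.Bijective (ofFree B hσ) := by
  refine Function.bijective_iff_has_inverse.2
    ⟨fun t => toFree B σ ((of _).symm t), fun t => ?_, fun t => ?_⟩
  · have h1 : Lin k fun t => toFree B σ ((of (IsHopfModule.free (B := B) hσ)).symm.toLinearMap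
        ((ofFree B hσ).restrictScalars k t)) := (lin_toFree (B := B) σ).comp (by fun_prop)
    refine (h1.tensor_eq t).trans (Eq.trans (sw_congr fun s v => ?_) (sw_self t))
    have h2 : Lin k fun s => toFree B σ ((of (IsHopfModule.free (B := B) hσ)).symm.toLinearMap
        ((ofFree B hσ).restrictScalars k (s ⊗ₜ v))) := (lin_toFree (B := B) σ).comp (by fun_prop)
    refine (h2.tensor_eq s).trans (Eq.trans (sw_congr fun a b => ?_)
      ((show Lin k fun s : A ⊗[k] Aᵐᵒᵖ => s ⊗ₜ[k] v by fun_prop).tensor_eq s).symm)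
    obtain ⟨b, rfl⟩ := MulOpposite.op_surjective b
    simp only [LinearMap.coe_restrictScalars, LinearEquiv.coe_coe, ofFree_tmul_tmul,
      LinearEquiv.symm_apply_apply]
    rw [(lin_toFree (B := B) σ).map_sw]
    calc (sw (Δ a) fun a a' => toFree B σ (sw (σ v) fun v u => (a ⊗ₜ v) ⊗ₜ (B.act a' u * b)))
        = sw (Δ a) fun a a' => sw (Δ a) fun a a'' => sw (σ v) fun v u => sw (σ v) fun v u' =>
            (a ⊗ₜ[k] MulOpposite.op (B.antipode (B.act a'' u') * (B.act a' u * b))) ⊗ₜ[k] v :=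
          sw_congr fun a a' => by
            rw [(lin_toFree (B := B) σ).map_sw, sw_comm (Δ a)]
            refine sw_congr fun v u => ?_
            rw [toFree_tmul]
      _ = sw (Δ a) fun a c => sw (Δ c) fun x y => sw (σ v) fun v u => sw (Δ u) fun u u' =>
            (a ⊗ₜ[k] MulOpposite.op (B.antipode (B.act x u) * B.act y u' * b)) ⊗ₜ[k] v := by
          rw [sw_coassoc]
          · refine sw_congr fun a c => sw_congr fun x y => ?_
            rw [hσ.sw_coassoc]
            · simp only [mul_assoc]
            all_goals intros; fun_prop
          all_goals intros; fun_prop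
      _ = sw (Δ a) fun a c => ε c • (a ⊗ₜ[k] MulOpposite.op b) ⊗ₜ[k] v := sw_congr fun a c => by
          rw [sw_comm, ← hσ.sw_counit (F := fun v => ε c • (a ⊗ₜ[k] MulOpposite.op b) ⊗ₜ[k] v) v
            (by fun_prop)]
          refine sw_congr fun v u => ?_
          rw [B.sw_act_antipode_mul (fun x => (a ⊗ₜ[k] MulOpposite.op (x * b)) ⊗ₜ[k] v)
            (by fun_prop), one_mul, smul_comm]
      _ = _ := sw_counit_right (F := fun a => (a ⊗ₜ[k] MulOpposite.op b) ⊗ₜ[k] v) a (by fun_prop)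
  · obtain ⟨t, rfl⟩ := (of (IsHopfModule.free (B := B) hσ)).surjective t
    apply (of (IsHopfModule.free (B := B) hσ)).symm.injective
    simp only [LinearEquiv.symm_apply_apply]
    have h0 : Lin k fun t : (A ⊗[k] Aᵐᵒᵖ) ⊗[k] V =>
        (of (IsHopfModule.free (B := B) hσ)).symm.toLinearMap
        ((ofFree B hσ).restrictScalars k t) := by fun_prop
    have h1 : Lin k fun t : (A ⊗[k] V) ⊗[k] A =>
        (of (IsHopfModule.free (B := B) hσ)).symm.toLinearMap
        ((ofFree B hσ).restrictScalars k (toFree B σ t)) := h0.comp (lin_toFree (B := B) σ)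
    refine (h1.tensor_eq t).trans (Eq.trans (sw_congr fun m x => ?_) (sw_self t))
    refine ((show Lin k fun m : A ⊗[k] V =>
        (of (IsHopfModule.free (B := B) hσ)).symm.toLinearMap
        ((ofFree B hσ).restrictScalars k (toFree B σ (m ⊗ₜ x))) from h1.comp
      (show Lin k fun m : A ⊗[k] V => m ⊗ₜ[k] x by fun_prop)).tensor_eq m).trans
      (Eq.trans (sw_congr fun a v => ?_)
      ((show Lin k fun m : A ⊗[k] V => m ⊗ₜ[k] x by fun_prop).tensor_eq m).symm)
    simp only [toFree_tmul]
    rw [h0.map_sw]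
    simp only [h0.map_sw]
    simp only [LinearMap.coe_restrictScalars, LinearEquiv.coe_coe, ofFree_tmul_tmul,
      LinearEquiv.symm_apply_apply]
    calc (sw (Δ a) fun a a' => sw (σ v) fun v u => sw (Δ a) fun a a'' => sw (σ v) fun v u' =>
          (a ⊗ₜ[k] v) ⊗ₜ[k] (B.act a'' u' * (B.antipode (B.act a' u) * x)))
        = sw (Δ a) fun a c => sw (Δ c) fun b c => sw (σ v) fun v u => sw (Δ u) fun u u' =>
          (a ⊗ₜ[k] v) ⊗ₜ[k] (B.act b u * B.antipode (B.act c u') * x) := by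
          rw [← sw_coassoc]
          · refine sw_congr fun a a' => ?_
            rw [sw_comm]
            refine sw_congr fun a a'' => ?_
            rw [hσ.sw_coassoc]
            · simp only [mul_assoc]
            all_goals intros; fun_prop
          all_goals intros; fun_prop
      _ = sw (Δ a) fun a c => ε c • (a ⊗ₜ[k] v) ⊗ₜ[k] x := sw_congr fun a c => by
          rw [sw_comm, ← hσ.sw_counit (F := fun v => ε c • (a ⊗ₜ[k] v) ⊗ₜ[k] x) v
            (by fun_prop)]
          refine sw_congr fun v u => ?_
          rw [B.sw_act_mul_antipode (fun y => (a ⊗ₜ[k] v) ⊗ₜ[k] (y * x))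
            (by fun_prop), one_mul, smul_comm]
      _ = _ := sw_counit_right (F := fun a => (a ⊗ₜ[k] v) ⊗ₜ[k] x) a (by fun_prop)

/-- The construction M ↦ M ⊗ A preserves direct summands, and A^e ⊗ V is free because V is a vector
space. -/
theorem projective {M : Type u} [AddCommGroup M] [Module k M] [Module A M] [IsScalarTower k A M]
    {ρ : M →ₗ[k] M ⊗[k] H} (hρ : IsHopfModule B ρ) (h : IsFiniteRelProjective B ρ) :
    Module.Projective (A ⊗[k] Aᵐᵒᵖ) (IndBimod hρ) := by
  obtain ⟨V, _, _, σ, i, p, hσ, -, hi, hp, hip⟩ := h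
  have : Module.Projective (A ⊗[k] Aᵐᵒᵖ) (IndBimod (IsHopfModule.free (B := B) hσ)) :=
    Module.Projective.of_equiv (LinearEquiv.ofBijective _ (ofFree_bijective B hσ))
  refine Module.Projective.of_split (map (hρ := hρ) (hσ := IsHopfModule.free hσ) i hi)
    (map p hp) (LinearMap.ext fun t => ?_)
  obtain ⟨t, rfl⟩ := (of hρ).surjective t
  rw [LinearMap.comp_apply, map_of, map_of, ← LinearMap.comp_apply, ← LinearMap.rTensor_comp]
  have e : p.restrictScalars k ∘ₗ i.restrictScalars k = LinearMap.id :=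
    LinearMap.ext fun x => LinearMap.congr_fun hip x
  rw [e, LinearMap.rTensor_id]
  rfl

end IndBimod

end Free

end

section

/-! ### Identities for the antipode of `A` -/

section AntipodeIdentities

variable {k H : Type u} [Field k] [Ring H] [HopfAlgebra k H] {R : UniversalRForm k H}
variable {A : Type u} [Ring A] [Algebra k A] [Coalgebra k A] (B : BraidedHopfAlgebra R A)
variable {U : Type*} [AddCommGroup U] [Module k U]

local notation "Δ" => comul (R := k)
local notation "ε" => counit (R := k)
local notation "S" => HopfAlgebra.antipode k (A := H)

namespace BraidedHopfAlgebra

/-- Braided coproduct of ac, then the twisted reversal of S on the second leg. The Yetter-Drinfeld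
condition moves h to the right of the coaction of the second leg of c, so that the coactions of both
legs of c merge into that of c. -/
theorem sw_comul_mul_antipode_act (a c : A) (h : H) {F : A → A → U}
    (h1 : ∀ y, Lin k fun x => F x y) (h2 : ∀ x, Lin k fun y => F x y) :
    (sw (Δ (a * c)) fun x z => F x (B.antipode (B.act z h))) =
      sw (Δ a) fun a a' => sw (B.coact c) fun c u => sw (Δ c) fun x z => sw (Δ h) fun h h' =>
        F (a * x) (B.antipode (B.act z h) * B.antipode (B.act a' (u * h'))) := by
  rw [B.comul_mul_apply]
  · refine sw_congr fun a a' => ?_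
    calc (sw (Δ c) fun z w => sw (B.coact z) fun z u =>
          F (a * z) (B.antipode (B.act (B.act a' u * w) h)))
        = sw (Δ c) fun z w => sw (B.coact z) fun z u => sw (Δ h) fun h h' =>
          sw (B.coact (B.act w h')) fun w v =>
            F (a * z) (B.antipode w * B.antipode (B.act a' (u * (h * v)))) :=
          sw_congr fun z w => sw_congr fun z u => by
            rw [B.mul_act, Lin.map_sw (g := fun t => F (a * z) (B.antipode t)) (by fun_prop)]
            refine sw_congr fun h h' => ?_
            rw [B.antipode_mul, Lin.map_sw (g := fun t => F (a * z) t) (by fun_prop)]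
            simp only [← B.act_mul, mul_assoc]
      _ = sw (Δ c) fun z w => sw (B.coact z) fun z u => sw (B.coact w) fun w v =>
          sw (Δ h) fun h h' =>
            F (a * z) (B.antipode (B.act w h) * B.antipode (B.act a' (u * v * h'))) :=
          sw_congr fun z w => sw_congr fun z u => by
            rw [B.sw_coact_act w h (F := fun w v =>
              F (a * z) (B.antipode w * B.antipode (B.act a' (u * v))))]
            · simp only [mul_assoc]
            all_goals intros; fun_prop
      _ = _ := by
            rw [B.sw_coact_comul (F := fun z w u => sw (Δ h) fun h h' =>
              F (a * z) (B.antipode (B.act w h) * B.antipode (B.act a' (u * h'))))]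
            all_goals intros; fun_prop
  all_goals intros; fun_prop

/-- The extra factor S(a₍₁₎) is chosen to cancel the twist in S(ba): the antipode then reverses the
product with no trace of the braiding. -/
theorem sw_antipode_act_mul (b a : A) (h : H) (F : A → U) (hF : Lin k F) :
    (sw (B.coact a) fun a u => F (B.antipode (B.act (b * a) (S u * h)))) =
      sw (B.coact a) fun a u => sw (Δ h) fun h h' =>
        F (B.antipode (B.act a (S u * h)) * B.antipode (B.act b h')) := by
  calc (sw (B.coact a) fun a u => F (B.antipode (B.act (b * a) (S u * h))))
      = sw (B.coact a) fun a u => sw (Δ (S u * h)) fun x x' =>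
          sw (B.coact (B.act a x')) fun a v =>
          F (B.antipode a * B.antipode (B.act b (x * v))) := sw_congr fun a u => by
        rw [B.mul_act, Lin.map_sw (g := fun t => F (B.antipode t)) (by fun_prop)]
        refine sw_congr fun x x' => ?_
        rw [B.antipode_mul, Lin.map_sw (g := F) (by fun_prop)]
        simp only [← B.act_mul]
    _ = sw (B.coact a) fun a u => sw (B.coact a) fun a v => sw (Δ u) fun u u' =>
          sw (Δ h) fun h h' =>
          F (B.antipode (B.act a (S u' * h)) * B.antipode (B.act b (v * S u * h'))) :=
        sw_congr fun a u => by
          rw [B.sw_coact_act a _ (F := fun a v =>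
              F (B.antipode a * B.antipode (B.act b v)))]
          · refine sw_congr fun a v => ?_
            rw [sw_comul_mul, sw_comul_antipode]
            · simp only [mul_assoc]
            all_goals intros; fun_prop
          all_goals intros; fun_prop
    _ = sw (B.coact a) fun a u => sw (Δ u) fun v u => sw (Δ u) fun u u' =>
          sw (Δ h) fun h h' =>
          F (B.antipode (B.act a (S u' * h)) * B.antipode (B.act b (v * S u * h'))) := by
        rw [B.isRightCoaction.sw_coassoc]
        all_goals intros; fun_prop
    _ = sw (B.coact a) fun a u => sw (Δ u) fun v u' => ε v •
          sw (Δ h) fun h h' =>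
          F (B.antipode (B.act a (S u' * h)) * B.antipode (B.act b h')) :=
        sw_congr fun a u => by
          rw [← sw_coassoc (F := fun v u u' => sw (Δ h) fun h h' =>
            F (B.antipode (B.act a (S u' * h)) * B.antipode (B.act b (v * S u * h'))))]
          · refine sw_congr fun v u' => ?_
            rw [_root_.BraidedHoch.sw_mul_antipode (fun y => sw (Δ h) fun h h' =>
              F (B.antipode (B.act a (S u' * h)) * B.antipode (B.act b (y * h')))) (by fun_prop)]
            simp only [one_mul]
          all_goals intros; fun_prop
    _ = _ := sw_congr fun a u =>
        sw_counit_left (F := fun u' => sw (Δ h) fun h h' =>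
          F (B.antipode (B.act a (S u' * h)) * B.antipode (B.act b h'))) u (by fun_prop)

/-- S(a₁ S(a₂)) computed as S²(a₂) S(a₁). The twists by `H` are those that make the previous
untwisted reversal applicable. This identity accounts for S² in the right action. -/
theorem sw_antipode_antipode_mul_antipode (a : A) (h : H) (F : A → U) (hF : Lin k F) :
    (sw (Δ a) fun z a => sw (B.coact z) fun z v => sw (Δ v) fun v v' => sw (B.coact a) fun a u =>
      sw (Δ h) fun h h' => F (B.antipode (B.antipode (B.act a (S u * (S v' * h)))) *
        B.antipode (B.act z (S v * h')))) = ε a • ε h • F 1 := by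
  calc (sw (Δ a) fun z a => sw (B.coact z) fun z v => sw (Δ v) fun v v' =>
        sw (B.coact a) fun a u => sw (Δ h) fun h h' =>
        F (B.antipode (B.antipode (B.act a (S u * (S v' * h)))) *
        B.antipode (B.act z (S v * h'))))
      = sw (Δ a) fun z a => sw (B.coact z) fun z v => sw (B.coact a) fun a u =>
          F (B.antipode (B.act (z * B.antipode a) (S (v * u) * h))) := 
        sw_congr fun z a => sw_congr fun z v => by
          have e := B.sw_antipode_act_mul z (B.antipode a) (S v * h) F hF
          rw [B.sw_coact_antipode, B.sw_coact_antipode] at e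
          · simp only [HopfAlgebra.antipode_mul_antidistrib, mul_assoc]
            rw [e, sw_comm]
            refine sw_congr fun a u => ?_
            rw [sw_comul_mul, sw_comul_antipode]
            · simp only [B.antipode_act]
            all_goals intros; fun_prop
          all_goals intros; fun_prop
    _ = ε a • F (B.antipode (B.act 1 (S 1 * h))) :=
        B.sw_coact_mul_antipode a (F := fun a u => F (B.antipode (B.act a (S u * h))))
          (by intros; fun_prop) (by intros; fun_prop)
    _ = _ := by
        rw [HopfAlgebra.antipode_one, one_mul, B.one_act, map_smul, B.antipode_one, hF.map_smul']

/-- The mirror identity, from S(S(a₁) a₂); it serves the retraction of `phi`. -/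
theorem sw_antipode_mul_antipode_antipode (a : A) (h : H) (F : A → U) (hF : Lin k F) :
    (sw (Δ a) fun z a => sw (B.coact z) fun z v => sw (Δ v) fun v v' => sw (B.coact a) fun a u =>
      sw (Δ h) fun h h' => F (B.antipode (B.act a (S u * (S v' * h))) *
        B.antipode (B.antipode (B.act z (S v * h'))))) = ε a • ε h • F 1 := by
  calc (sw (Δ a) fun z a => sw (B.coact z) fun z v => sw (Δ v) fun v v' =>
        sw (B.coact a) fun a u => sw (Δ h) fun h h' =>
        F (B.antipode (B.act a (S u * (S v' * h))) *
        B.antipode (B.antipode (B.act z (S v * h')))))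
      = sw (Δ a) fun z a => sw (B.coact z) fun z v => sw (B.coact a) fun a u =>
          F (B.antipode (B.act (B.antipode z * a) (S (v * u) * h))) := 
        sw_congr fun z a => sw_congr fun z v => by
          have e := B.sw_antipode_act_mul (B.antipode z) a (S v * h) F hF
          simp only [HopfAlgebra.antipode_mul_antidistrib, mul_assoc]
          rw [e, sw_comm]
          refine sw_congr fun a u => ?_
          rw [sw_comul_mul, sw_comul_antipode]
          · simp only [B.antipode_act]
          all_goals intros; fun_prop
    _ = ε a • F (B.antipode (B.act 1 (S 1 * h))) :=
        B.sw_coact_antipode_mul a (F := fun a u => F (B.antipode (B.act a (S u * h))))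
          (by intros; fun_prop) (by intros; fun_prop)
    _ = _ := by
        rw [HopfAlgebra.antipode_one, one_mul, B.one_act, map_smul, B.antipode_one, hF.map_smul']

end BraidedHopfAlgebra

end AntipodeIdentities

/-! ### The map `Hom_A(M, A) ⊗ A → Hom(M ⊗ A, A^e)` -/

section Phi

variable {k H : Type u} [Field k] [Ring H] [HopfAlgebra k H] {R : UniversalRForm k H}
variable {A : Type u} [Ring A] [Algebra k A] [Coalgebra k A] {B : BraidedHopfAlgebra R A}
variable {M : Type u} [AddCommGroup M] [Module k M] [Module A M] [IsScalarTower k A M]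
variable {N : Type u} [AddCommGroup N] [Module k N] [Module A N] [IsScalarTower k A N]
variable {U : Type*} [AddCommGroup U] [Module k U]

local notation "Δ" => comul (R := k)
local notation "ε" => counit (R := k)
local notation "S" => HopfAlgebra.antipode k (A := H)

namespace IsHomCoaction

variable {T : H →ₗ[k] H} {ρ : M →ₗ[k] M ⊗[k] H} {δ : (M →ₗ[A] A) →ₗ[k] (M →ₗ[A] A) ⊗[k] H}

/-- Evaluation is colinear, so the coaction of f₍₀₎(p) is p₍₁₎ followed by a leg of f₍₁₎. The factor
S(f₍₁₎) cancels this leg and leaves the coaction of p alone. -/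
theorem sw_coact_apply_mul_antipode (hδ : IsHomCoaction B T ρ δ) (hT : IsAntipodeInv T)
    (hρ : IsRightCoaction ρ) (f : M →ₗ[A] A) (p : M) {F : A → H → H → U}
    (h1 : ∀ y z, Lin k fun x => F x y z)
    (h2 : ∀ x z, Lin k fun y => F x y z) (h3 : ∀ x y, Lin k fun z => F x y z) :
    (sw (δ f) fun g h => sw (Δ h) fun h h' => sw (B.coact (g p)) fun c u => F c (u * S h) h') =
      sw (δ f) fun g h => sw (ρ p) fun q u => F (g q) u h := by
  calc (sw (δ f) fun g h => sw (Δ h) fun h h' => sw (B.coact (g p)) fun c u => F c (u * S h) h')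
      = sw (δ f) fun g h => sw (Δ h) fun v w => sw (Δ w) fun w w' => sw (ρ p) fun q u =>
          F (g q) (u * (v * S w)) w' := by
        calc _ = sw (δ f) fun g h => sw (δ g) fun g v => sw (Δ h) fun w w' => sw (ρ p) fun q u =>
                F (g q) (u * (v * S w)) w' := sw_congr fun g h => by
              rw [sw_comm (δ g)]
              refine sw_congr fun w w' => ?_
              rw [hδ.sw_coact_apply hT hρ]
              · simp only [mul_assoc]
              all_goals intros; fun_prop
          _ = _ := by
              rw [(hδ.isRightCoaction hT hρ).sw_coassoc]
              all_goals intros; fun_prop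
    _ = sw (δ f) fun g h => sw (Δ h) fun v w => ε v • sw (ρ p) fun q u => F (g q) u w :=
        sw_congr fun g h => by
          rw [← sw_coassoc (F := fun v w w' => sw (ρ p) fun q u => F (g q) (u * (v * S w)) w')]
          · refine sw_congr fun v w => ?_
            rw [sw_mul_antipode (fun y => sw (ρ p) fun q u => F (g q) (u * y) w) (by fun_prop)]
            simp only [mul_one]
          all_goals intros; fun_prop
    _ = _ := sw_congr fun g h =>
        sw_counit_left (F := fun w => sw (ρ p) fun q u => F (g q) u w) h (by fun_prop)

end IsHomCoaction

@[fun_prop] theorem lin_unop {f : U → Aᵐᵒᵖ} (hf : Lin k f) :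
    Lin k fun x => MulOpposite.unop (f x) :=
  (Lin.coe (MulOpposite.opLinearEquiv k).symm.toLinearMap).comp hf

variable (B) in
/-- The map `(f ⊗ y) ⊗ (p ⊗ x) ↦ f₍₀₎(p)₍₁₎ ⊗ y S(f₍₀₎(p)₍₂₎ ◁ S(f₍₁₎)) x`. -/
def phiFun (δ : (M →ₗ[A] A) →ₗ[k] (M →ₗ[A] A) ⊗[k] H) (t : (M →ₗ[A] A) ⊗[k] A) (m : M ⊗[k] A) :
    A ⊗[k] Aᵐᵒᵖ :=
  sw t fun f y => sw m fun p x => sw (δ f) fun g h => sw (Δ (g p)) fun u v =>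
    u ⊗ₜ MulOpposite.op (y * B.antipode (B.act v (S h)) * x)

@[fun_prop] theorem lin_phiFun_left {V : Type*} [AddCommGroup V] [Module k V]
    {f : V → (M →ₗ[A] A) ⊗[k] A} (hf : Lin k f)
    (δ : (M →ₗ[A] A) →ₗ[k] (M →ₗ[A] A) ⊗[k] H) (m : M ⊗[k] A) :
    Lin k fun x => phiFun B δ (f x) m := by
  unfold phiFun; fun_prop

@[fun_prop] theorem lin_phiFun_right {V : Type*} [AddCommGroup V] [Module k V]
    {f : V → M ⊗[k] A} (hf : Lin k f)
    (δ : (M →ₗ[A] A) →ₗ[k] (M →ₗ[A] A) ⊗[k] H) (t : (M →ₗ[A] A) ⊗[k] A) :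
    Lin k fun x => phiFun B δ t (f x) := by
  unfold phiFun; fun_prop

theorem phiFun_tmul_tmul (δ : (M →ₗ[A] A) →ₗ[k] (M →ₗ[A] A) ⊗[k] H) (f : M →ₗ[A] A) (y : A)
    (p : M) (x : A) : phiFun B δ (f ⊗ₜ y) (p ⊗ₜ x) =
      sw (δ f) fun g h => sw (Δ (g p)) fun u v =>
        u ⊗ₜ MulOpposite.op (y * B.antipode (B.act v (S h)) * x) := by
  rw [phiFun, sw_tmul, sw_tmul]
  all_goals intros; fun_prop

variable {T : H →ₗ[k] H} {ρ : M →ₗ[k] M ⊗[k] H} {δ : (M →ₗ[A] A) →ₗ[k] (M →ₗ[A] A) ⊗[k] H}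

/-- In f(a p) = a f(p) the antipode on the second leg produces S(a₂ ◁ -), with a twist that the
preceding lemma reduces to p₍₁₎. It meets a₃ ◁ p₍₂₎ coming from the bimodule structure, and the two
cancel. The twist S(f₍₁₎) in `phi` is what makes the arguments match. -/
theorem phiFun_smul (hδ : IsHomCoaction B T ρ δ) (hT : IsAntipodeInv T)
    (hρ : IsHopfModule B ρ) (f : M →ₗ[A] A) (y a b : A) (p : M) (x : A) :
    (sw (Δ a) fun a a' => sw (ρ p) fun p u =>
      phiFun B δ (f ⊗ₜ y) ((a • p) ⊗ₜ (B.act a' u * x * b))) =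
    (a ⊗ₜ[k] MulOpposite.op b) * phiFun B δ (f ⊗ₜ y) (p ⊗ₜ x) := by
  calc (sw (Δ a) fun a a' => sw (ρ p) fun p u =>
      phiFun B δ (f ⊗ₜ y) ((a • p) ⊗ₜ (B.act a' u * x * b)))
      = sw (Δ a) fun a a₃ => sw (Δ a) fun a a₂ => sw (ρ p) fun p u => sw (δ f) fun g h =>
          sw (Δ h) fun h h' => sw (B.coact (g p)) fun c w => sw (Δ c) fun c z =>
          (a * c) ⊗ₜ[k] MulOpposite.op (y * (B.antipode (B.act z (S h')) *
            B.antipode (B.act a₂ (w * S h))) * (B.act a₃ u * x * b)) :=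
        sw_congr fun a a₃ => by
          rw [sw_comm (Δ a)]
          refine sw_congr fun p u => ?_
          rw [phiFun_tmul_tmul, sw_comm (Δ a)]
          refine sw_congr fun g h => ?_
          rw [map_smul, smul_eq_mul, B.sw_comul_mul_antipode_act (F := fun c s => 
            c ⊗ₜ[k] MulOpposite.op (y * s * (B.act a₃ u * x * b)))]
          · refine sw_congr fun a a₂ => ?_
            rw [sw_comm (Δ h)]
            refine sw_congr fun c w => ?_
            rw [sw_comm (Δ h)]
            refine sw_congr fun c z => ?_
            rw [sw_comul_antipode]
            all_goals intros; fun_prop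
          all_goals intros; fun_prop
    _ = sw (Δ a) fun a a₃ => sw (Δ a) fun a a₂ => sw (ρ p) fun p u => sw (δ f) fun g h =>
          sw (ρ p) fun p w => sw (Δ (g p)) fun c z =>
          (a * c) ⊗ₜ[k] MulOpposite.op (y * (B.antipode (B.act z (S h)) *
            B.antipode (B.act a₂ w)) * (B.act a₃ u * x * b)) :=
        sw_congr fun a a₃ => sw_congr fun a a₂ => sw_congr fun p u =>
          hδ.sw_coact_apply_mul_antipode hT hρ.isRightCoaction f p (F := fun c w h =>
            sw (Δ c) fun c z => (a * c) ⊗ₜ[k] MulOpposite.op (y * (B.antipode (B.act z (S h)) *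
            B.antipode (B.act a₂ w)) * (B.act a₃ u * x * b))) (by intros; fun_prop)
            (by intros; fun_prop) (by intros; fun_prop)
    _ = sw (Δ a) fun a a₂ => sw (Δ a₂) fun a₂ a₃ => sw (δ f) fun g h => sw (ρ p) fun p w =>
          sw (Δ w) fun w u => sw (Δ (g p)) fun c z =>
          (a * c) ⊗ₜ[k] MulOpposite.op (y * B.antipode (B.act z (S h)) *
            (B.antipode (B.act a₂ w) * B.act a₃ u) * x * b) := by
        rw [sw_coassoc]
        · refine sw_congr fun a a₂ => sw_congr fun a₂ a₃ => ?_
          rw [sw_comm]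
          refine sw_congr fun g h => ?_
          rw [hρ.isRightCoaction.sw_coassoc]
          · simp only [mul_assoc]
          all_goals intros; fun_prop
        all_goals intros; fun_prop
    _ = sw (Δ a) fun a a₂ => ε a₂ • sw (δ f) fun g h => sw (ρ p) fun p w => ε w • 
          sw (Δ (g p)) fun c z =>
          (a * c) ⊗ₜ[k] MulOpposite.op (y * B.antipode (B.act z (S h)) * x * b) :=
        sw_congr fun a a₂ => by
          rw [sw_comm, Lin.map_sw (g := fun t : A ⊗[k] Aᵐᵒᵖ => ε a₂ • t) (by fun_prop)]
          refine sw_congr fun g h => ?_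
          rw [sw_comm, Lin.map_sw (g := fun t : A ⊗[k] Aᵐᵒᵖ => ε a₂ • t) (by fun_prop)]
          refine sw_congr fun p w => ?_
          rw [B.sw_act_antipode_mul (fun s => sw (Δ (g p)) fun c z =>
            (a * c) ⊗ₜ[k] MulOpposite.op (y * B.antipode (B.act z (S h)) * s * x * b))
            (by fun_prop)]
          simp only [mul_one]
    _ = sw (δ f) fun g h => sw (Δ (g p)) fun c z =>
          (a * c) ⊗ₜ[k] MulOpposite.op (y * B.antipode (B.act z (S h)) * x * b) := by
        rw [sw_counit_right (F := fun a => sw (δ f) fun g h => sw (ρ p) fun p w => ε w • 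
          sw (Δ (g p)) fun c z =>
          (a * c) ⊗ₜ[k] MulOpposite.op (y * B.antipode (B.act z (S h)) * x * b)) a (by fun_prop)]
        refine sw_congr fun g h => ?_
        exact hρ.isRightCoaction.sw_counit (F := fun p => sw (Δ (g p)) fun c z =>
          (a * c) ⊗ₜ[k] MulOpposite.op (y * B.antipode (B.act z (S h)) * x * b)) p (by fun_prop)
    _ = _ := by
        rw [phiFun_tmul_tmul, Lin.map_sw (g := fun t : A ⊗[k] Aᵐᵒᵖ =>
          (a ⊗ₜ[k] MulOpposite.op b) * t) (by fun_prop)]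
        refine sw_congr fun g h => ?_
        rw [Lin.map_sw (g := fun t : A ⊗[k] Aᵐᵒᵖ =>
          (a ⊗ₜ[k] MulOpposite.op b) * t) (by fun_prop)]
        refine sw_congr fun u v => ?_
        rw [Algebra.TensorProduct.tmul_mul_tmul, ← MulOpposite.op_mul]

/-- The map `Hom_A(M, A) ⊗ A → Hom_{A^e}(M ⊗ A, A^e)`. -/
def phi (hδ : IsHomCoaction B T ρ δ) (hT : IsAntipodeInv T) (hρ : IsHopfModule B ρ) :
    (M →ₗ[A] A) ⊗[k] A →ₗ[k] (IndBimod hρ →ₗ[A ⊗[k] Aᵐᵒᵖ] A ⊗[k] Aᵐᵒᵖ) where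
  toFun t :=
    { toFun := fun m => phiFun B δ t ((IndBimod.of hρ).symm m)
      map_add' := fun m m' => by
        rw [map_add, (show Lin k fun m => phiFun B δ t m by fun_prop).map_add']
      map_smul' := fun s m => IndBimod.map_smul_of hρ (f := fun m => phiFun B δ t m)
        (by fun_prop) (fun a b p x => by
          have h : Lin k fun t => sw (Δ a) fun a a' => sw (ρ p) fun p u =>
            phiFun B δ t ((a • p) ⊗ₜ (B.act a' u * x * b)) := by fun_prop
          rw [smul_eq_mul, h.tensor_eq t, (show Lin k fun t => (a ⊗ₜ[k] MulOpposite.op b) *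
            phiFun B δ t (p ⊗ₜ x) by fun_prop).tensor_eq t]
          exact sw_congr fun f y => phiFun_smul hδ hT hρ f y a b p x) s m }
  map_add' s t := LinearMap.ext fun m =>
    (show Lin k fun t => phiFun B δ t ((IndBimod.of hρ).symm m) by fun_prop).map_add' s t
  map_smul' c t := LinearMap.ext fun m =>
    (show Lin k fun t => phiFun B δ t ((IndBimod.of hρ).symm m) by fun_prop).map_smul' c t

theorem phi_apply_of (hδ : IsHomCoaction B T ρ δ) (hT : IsAntipodeInv T) (hρ : IsHopfModule B ρ)
    (t : (M →ₗ[A] A) ⊗[k] A) (m : M ⊗[k] A) :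
    phi hδ hT hρ t (IndBimod.of hρ m) = phiFun B δ t m := rfl

end Phi

end

section

/-! ### Right multiplication in A^e, and a retraction of `phi` -/

section TwistedMul

variable {k H : Type u} [Field k] [Ring H] [HopfAlgebra k H] {R : UniversalRForm k H}
variable {A : Type u} [Ring A] [Algebra k A] [Coalgebra k A] {B : BraidedHopfAlgebra R A}
variable {M : Type u} [AddCommGroup M] [Module k M] [Module A M] [IsScalarTower k A M]
variable {N : Type u} [AddCommGroup N] [Module k N] [Module A N] [IsScalarTower k A N]
variable {U : Type*} [AddCommGroup U] [Module k U]

local notation "Δ" => comul (R := k)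
local notation "ε" => counit (R := k)
local notation "S" => HopfAlgebra.antipode k (A := H)

namespace BraidedHopfAlgebra

variable (B)

/-- The expansion of Δ(ac) when the acting element contains S(c₍₁₎). Then the coaction of c cancels
inside the twist of the second leg of a, which keeps only S(h). -/
theorem sw_comul_mul_antipode_act_antipode (a c : A) (h : H) {F : A → A → U}
    (h1 : ∀ y, Lin k fun x => F x y) (h2 : ∀ x, Lin k fun y => F x y) :
    (sw (B.coact c) fun c s => sw (Δ (a * c)) fun x z =>
      F x (B.antipode (B.act z (S (h * s))))) =
    sw (Δ a) fun a a' => sw (B.coact c) fun c s => sw (Δ c) fun x z => sw (Δ h) fun h h' =>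
      F (a * x) (B.antipode (B.act z (S (h' * s))) * B.antipode (B.act a' (S h))) := by
  calc (sw (B.coact c) fun c s => sw (Δ (a * c)) fun x z =>
        F x (B.antipode (B.act z (S (h * s)))))
      = sw (Δ a) fun a a' => sw (B.coact c) fun c s => sw (B.coact c) fun c e =>
          sw (Δ c) fun x z => sw (Δ h) fun h h' => sw (Δ s) fun s s' =>
          F (a * x) (B.antipode (B.act z (S (h' * s'))) *
            B.antipode (B.act a' (e * S s * S h))) := by
        rw [sw_comm (Δ a)]
        refine sw_congr fun c s => ?_
        rw [B.sw_comul_mul_antipode_act _ _ _ h1 h2]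
        refine sw_congr fun a a' => sw_congr fun c e => sw_congr fun x z => ?_
        rw [sw_comul_antipode, sw_comul_mul]
        · simp only [HopfAlgebra.antipode_mul_antidistrib, mul_assoc]
        all_goals intros; fun_prop
    _ = sw (Δ a) fun a a' => sw (B.coact c) fun c s => sw (Δ s) fun e s => ε e •
          sw (Δ c) fun x z => sw (Δ h) fun h h' =>
          F (a * x) (B.antipode (B.act z (S (h' * s))) * B.antipode (B.act a' (S h))) :=
        sw_congr fun a a' => by
        rw [B.isRightCoaction.sw_coassoc (F := fun c e s => 
          sw (Δ c) fun x z => sw (Δ h) fun h h' => sw (Δ s) fun s s' =>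
          F (a * x) (B.antipode (B.act z (S (h' * s'))) *
            B.antipode (B.act a' (e * S s * S h))))]
        · refine sw_congr fun c s => ?_
          calc _ = sw (Δ s) fun e s => sw (Δ s) fun s s' => sw (Δ c) fun x z =>
                sw (Δ h) fun h h' => F (a * x) (B.antipode (B.act z (S (h' * s'))) *
                B.antipode (B.act a' (e * S s * S h))) := sw_congr fun e s => by
                rw [sw_comm (Δ s)]
                refine sw_congr fun x z => ?_
                rw [sw_comm (Δ s)]
            _ = _ := by
                rw [← sw_coassoc (F := fun e s s' => sw (Δ c) fun x z =>
                  sw (Δ h) fun h h' => F (a * x) (B.antipode (B.act z (S (h' * s'))) *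
                  B.antipode (B.act a' (e * S s * S h))))]
                · refine sw_congr fun e s' => ?_
                  rw [_root_.BraidedHoch.sw_mul_antipode (fun y => sw (Δ c) fun x z =>
                    sw (Δ h) fun h h' => F (a * x) (B.antipode (B.act z (S (h' * s'))) *
                    B.antipode (B.act a' (y * S h)))) (by fun_prop)]
                  simp only [one_mul]
                all_goals intros; fun_prop
        all_goals intros; fun_prop
    _ = _ := sw_congr fun a a' => sw_congr fun c s =>
        sw_counit_left (F := fun s => sw (Δ c) fun x z => sw (Δ h) fun h h' =>
          F (a * x) (B.antipode (B.act z (S (h' * s))) * B.antipode (B.act a' (S h)))) s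
          (by fun_prop)

/-- The product S²(a₃) S(a₂) with the twists that arise when the right action is inserted in `phi`.
Splitting the coactions over the legs of a brings it to `sw_antipode_antipode_mul_antipode`; the
rest permutes independent sums. -/
theorem sw_collapse_left (a : A) (h : H) {F : A → A → U}
    (h1 : ∀ y, Lin k fun x => F x y) (h2 : ∀ x, Lin k fun y => F x y) :
    (sw (B.coact a) fun a w => sw (Δ a) fun a a' => sw (B.coact a) fun c s =>
      sw (Δ c) fun x z => sw (Δ h) fun h h' =>
        F x (B.antipode (B.antipode (B.act a' (S (h' * w)))) *
          B.antipode (B.act z (S (h * s))))) = ε h • F a 1 := by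
  calc (sw (B.coact a) fun a w => sw (Δ a) fun a a' => sw (B.coact a) fun c s =>
      sw (Δ c) fun x z => sw (Δ h) fun h h' =>
        F x (B.antipode (B.antipode (B.act a' (S (h' * w)))) *
          B.antipode (B.act z (S (h * s)))))
      = sw (B.coact a) fun a w => sw (Δ a) fun a a' => sw (Δ a) fun x z =>
          sw (B.coact x) fun x s => sw (B.coact z) fun z s' => sw (Δ h) fun h h' =>
          F x (B.antipode (B.antipode (B.act a' (S (h' * w)))) *
          B.antipode (B.act z (S (h * (s * s'))))) :=
        sw_congr fun a w => sw_congr fun a a' =>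
          B.sw_coact_comul a (F := fun x z s => sw (Δ h) fun h h' =>
            F x (B.antipode (B.antipode (B.act a' (S (h' * w)))) *
              B.antipode (B.act z (S (h * s)))))
            (by intros; fun_prop) (by intros; fun_prop) (by intros; fun_prop)
    _ = sw (B.coact a) fun a w => sw (Δ a) fun x b => sw (Δ b) fun z a' =>
          sw (B.coact x) fun x s => sw (B.coact z) fun z s' => sw (Δ h) fun h h' =>
          F x (B.antipode (B.antipode (B.act a' (S (h' * w)))) *
          B.antipode (B.act z (S (h * (s * s'))))) := sw_congr fun a w => by
        rw [sw_coassoc]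
        all_goals intros; fun_prop
    _ = sw (Δ a) fun x b => sw (B.coact x) fun x w => sw (Δ b) fun z a' =>
          sw (B.coact z) fun z w' => sw (B.coact a') fun a' w'' =>
          sw (B.coact x) fun x s => sw (B.coact z) fun z s' => sw (Δ h) fun h h' =>
          F x (B.antipode (B.antipode (B.act a' (S (h' * (w * (w' * w'')))))) *
          B.antipode (B.act z (S (h * (s * s'))))) := by
        rw [B.sw_coact_comul a (F := fun x b w => sw (Δ b) fun z a' =>
          sw (B.coact x) fun x s => sw (B.coact z) fun z s' => sw (Δ h) fun h h' =>
          F x (B.antipode (B.antipode (B.act a' (S (h' * w)))) *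
          B.antipode (B.act z (S (h * (s * s'))))))]
        · refine sw_congr fun x b => sw_congr fun x w => ?_
          rw [B.sw_coact_comul b (F := fun z a' w' => 
            sw (B.coact x) fun x s => sw (B.coact z) fun z s' => sw (Δ h) fun h h' =>
            F x (B.antipode (B.antipode (B.act a' (S (h' * (w * w'))))) *
            B.antipode (B.act z (S (h * (s * s'))))))]
          all_goals intros; fun_prop
        all_goals intros; fun_prop
    _ = sw (Δ a) fun x b => sw (B.coact x) fun x v => ε b • ε (S (h * v)) • F x 1 :=
        sw_congr fun x b => by
        -- Two successive coactions of the middle leg are rewritten as one coaction followed by a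
        -- coproduct.
        have key : ∀ (x : A) (w s h h' : H), (sw (Δ b) fun z a' => sw (B.coact z) fun z v =>
            sw (Δ v) fun v v' => sw (B.coact a') fun a' u =>
            F x (B.antipode (B.antipode (B.act a' (S (h' * (w * (v' * u)))))) *
              B.antipode (B.act z (S (h * (s * v)))))) =
            sw (Δ b) fun z a' => sw (B.coact z) fun z w' => sw (B.coact a') fun a' w'' =>
              sw (B.coact z) fun z s' =>
              F x (B.antipode (B.antipode (B.act a' (S (h' * (w * (w' * w'')))))) *
              B.antipode (B.act z (S (h * (s * s'))))) := fun x w s h h' =>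
          sw_congr fun z a' => by
            rw [← B.isRightCoaction.sw_coassoc (F := fun z v v' => sw (B.coact a') fun a' u =>
              F x (B.antipode (B.antipode (B.act a' (S (h' * (w * (v' * u)))))) *
              B.antipode (B.act z (S (h * (s * v))))))]
            · refine sw_congr fun z v' => ?_
              rw [sw_comm]
            all_goals intros; fun_prop
        calc _ = sw (B.coact x) fun x w => sw (B.coact x) fun x s => sw (Δ h) fun h h' =>
              sw (Δ b) fun z a' => sw (B.coact z) fun z v => sw (Δ v) fun v v' =>
              sw (B.coact a') fun a' u =>
              F x (B.antipode (B.antipode (B.act a' (S (h' * (w * (v' * u)))))) *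
                B.antipode (B.act z (S (h * (s * v))))) := sw_congr fun x w => by
              simp only [key]
              calc _ = sw (Δ b) fun z a' => sw (B.coact z) fun z w' => sw (B.coact x) fun x s => 
                    sw (B.coact a') fun a' w'' => sw (Δ h) fun h h' => sw (B.coact z) fun z s' =>
                    F x (B.antipode (B.antipode (B.act a' (S (h' * (w * (w' * w'')))))) *
                    B.antipode (B.act z (S (h * (s * s'))))) :=
                    sw_congr fun z a' => sw_congr fun z w' => by
                      rw [sw_comm (B.coact a')]
                      refine sw_congr fun x s => sw_congr fun a' w'' => ?_
                      rw [sw_comm (B.coact z)]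
                _ = sw (Δ b) fun z a' => sw (B.coact x) fun x s => sw (Δ h) fun h h' => 
                    sw (B.coact z) fun z w' => sw (B.coact a') fun a' w'' => 
                    sw (B.coact z) fun z s' =>
                    F x (B.antipode (B.antipode (B.act a' (S (h' * (w * (w' * w'')))))) *
                    B.antipode (B.act z (S (h * (s * s'))))) :=
                    sw_congr fun z a' => by
                      rw [sw_comm (B.coact z)]
                      refine sw_congr fun x s => ?_
                      rw [sw_comm (Δ h)]
                      refine sw_congr fun z w' => ?_
                      rw [sw_comm (Δ h)]
                _ = _ := by
                  rw [sw_comm (Δ b)]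
                  refine sw_congr fun x s => ?_
                  rw [sw_comm (Δ b)]
          _ = sw (B.coact x) fun x w => sw (Δ w) fun s w => sw (Δ h) fun h h' =>
              sw (Δ b) fun z a' => sw (B.coact z) fun z v => sw (Δ v) fun v v' =>
              sw (B.coact a') fun a' u =>
              F x (B.antipode (B.antipode (B.act a' (S (h' * (w * (v' * u)))))) *
                B.antipode (B.act z (S (h * (s * v))))) := by
              rw [B.isRightCoaction.sw_coassoc]
              all_goals intros; fun_prop
          -- The four legs of h and w are the two legs K, K' of the single element S(hw), in
          -- reversed order.
          _ = sw (B.coact x) fun x w => sw (Δ b) fun z a' => sw (B.coact z) fun z v =>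
              sw (Δ v) fun v v' => sw (B.coact a') fun a' u => sw (Δ (S (h * w))) fun K K' =>
              F x (B.antipode (B.antipode (B.act a' (S u * (S v' * K)))) *
                B.antipode (B.act z (S v * K'))) := sw_congr fun x w => by
              calc _ = sw (Δ b) fun z a' => sw (Δ w) fun s w => sw (Δ h) fun h h' =>
                    sw (B.coact z) fun z v => sw (Δ v) fun v v' => sw (B.coact a') fun a' u =>
                    F x (B.antipode (B.antipode (B.act a' (S (h' * (w * (v' * u)))))) *
                    B.antipode (B.act z (S (h * (s * v))))) := by
                    rw [sw_comm (Δ b)]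
                    refine sw_congr fun s w => ?_
                    rw [sw_comm (Δ b)]
                _ = sw (Δ b) fun z a' => sw (B.coact z) fun z v => sw (Δ w) fun s w => 
                    sw (Δ h) fun h h' => sw (Δ v) fun v v' => sw (B.coact a') fun a' u =>
                    F x (B.antipode (B.antipode (B.act a' (S (h' * (w * (v' * u)))))) *
                    B.antipode (B.act z (S (h * (s * v))))) := sw_congr fun z a' => by
                    rw [sw_comm (B.coact z)]
                    refine sw_congr fun s w => ?_
                    rw [sw_comm (B.coact z)]
                _ = sw (Δ b) fun z a' => sw (B.coact z) fun z v => sw (Δ v) fun v v' =>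
                    sw (Δ w) fun s w => sw (Δ h) fun h h' => sw (B.coact a') fun a' u =>
                    F x (B.antipode (B.antipode (B.act a' (S (h' * (w * (v' * u)))))) *
                    B.antipode (B.act z (S (h * (s * v))))) :=
                    sw_congr fun z a' => sw_congr fun z v => by
                    rw [sw_comm (Δ v)]
                    refine sw_congr fun s w => ?_
                    rw [sw_comm (Δ v)]
                _ = sw (Δ b) fun z a' => sw (B.coact z) fun z v => sw (Δ v) fun v v' =>
                    sw (B.coact a') fun a' u => sw (Δ w) fun s w => sw (Δ h) fun h h' => 
                    F x (B.antipode (B.antipode (B.act a' (S (h' * (w * (v' * u)))))) *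
                    B.antipode (B.act z (S (h * (s * v))))) :=
                    sw_congr fun z a' => sw_congr fun z v => sw_congr fun v v' => by
                    rw [sw_comm (B.coact a')]
                    refine sw_congr fun s w => ?_
                    rw [sw_comm (B.coact a')]
                _ = _ :=
                    sw_congr fun z a' => sw_congr fun z v => sw_congr fun v v' =>
                      sw_congr fun a' u => by
                    rw [sw_comul_antipode, sw_comul_mul, sw_comm]
                    · simp only [HopfAlgebra.antipode_mul_antidistrib, mul_assoc]
                    all_goals intros; fun_prop
          _ = _ := sw_congr fun x w =>
              B.sw_antipode_antipode_mul_antipode b (S (h * w)) (fun y => F x y) (by fun_prop)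
    _ = sw (Δ a) fun x b => ε b • ε h • F x 1 := sw_congr fun x b => by
        rw [← B.isRightCoaction.sw_counit (F := fun x => ε b • ε h • F x 1) x (by fun_prop)]
        refine sw_congr fun x v => ?_
        rw [HopfAlgebra.counit_antipode, Bialgebra.counit_mul, smul_smul, smul_smul, smul_smul]
        congr 1
        ring
    _ = _ := sw_counit_right (F := fun x => ε h • F x 1) a (by fun_prop)

/-- The counterpart for S(a₃) S²(a₂), by `sw_antipode_mul_antipode_antipode`; it shows that
`phiRetract` undoes `phi`. -/
theorem sw_collapse_right (a : A) (h : H) {F : A → A → U}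
    (h1 : ∀ y, Lin k fun x => F x y) (h2 : ∀ x, Lin k fun y => F x y) :
    (sw (B.coact a) fun a s => sw (Δ a) fun c z => sw (B.coact c) fun c u =>
      sw (Δ c) fun x w => sw (Δ h) fun h h' =>
        F x (B.antipode (B.act z (S s * h)) *
          B.antipode (B.antipode (B.act w (S u * h'))))) = ε h • F a 1 := by
  calc (sw (B.coact a) fun a s => sw (Δ a) fun c z => sw (B.coact c) fun c u =>
      sw (Δ c) fun x w => sw (Δ h) fun h h' =>
        F x (B.antipode (B.act z (S s * h)) *
          B.antipode (B.antipode (B.act w (S u * h')))))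
      = sw (Δ a) fun c z => sw (B.coact c) fun c s => sw (B.coact c) fun c u =>
          sw (B.coact z) fun z s' => sw (Δ c) fun x w => sw (Δ h) fun h h' =>
          F x (B.antipode (B.act z (S (s * s') * h)) *
          B.antipode (B.antipode (B.act w (S u * h')))) := by
        rw [B.sw_coact_comul a (F := fun c z s => sw (B.coact c) fun c u =>
          sw (Δ c) fun x w => sw (Δ h) fun h h' => F x (B.antipode (B.act z (S s * h)) *
          B.antipode (B.antipode (B.act w (S u * h')))))]
        · refine sw_congr fun c z => sw_congr fun c s => ?_
          rw [sw_comm]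
        all_goals intros; fun_prop
    _ = sw (Δ a) fun c z => sw (B.coact c) fun c v => sw (Δ c) fun x w => sw (Δ v) fun u s =>
          sw (B.coact z) fun z s' => sw (Δ h) fun h h' =>
          F x (B.antipode (B.act z (S (s * s') * h)) *
          B.antipode (B.antipode (B.act w (S u * h')))) := sw_congr fun c z => by
        rw [B.isRightCoaction.sw_coassoc c (F := fun c u s => sw (B.coact z) fun z s' =>
          sw (Δ c) fun x w => sw (Δ h) fun h h' => F x (B.antipode (B.act z (S (s * s') * h)) *
          B.antipode (B.antipode (B.act w (S u * h')))))]
        · refine sw_congr fun c v => ?_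
          rw [sw_comm (Δ c)]
          refine sw_congr fun u s => ?_
          rw [sw_comm]
        all_goals intros; fun_prop
    _ = sw (Δ a) fun c z => sw (Δ c) fun x w => sw (B.coact x) fun x t => sw (B.coact w) fun w v =>
          sw (Δ v) fun v v' => sw (B.coact z) fun z u => sw (Δ (S t * h)) fun K K' =>
          F x (B.antipode (B.act z (S u * (S v' * K))) *
          B.antipode (B.antipode (B.act w (S v * K')))) := sw_congr fun c z => by
        rw [B.sw_coact_comul c (F := fun x w v => sw (Δ v) fun u s =>
          sw (B.coact z) fun z s' => sw (Δ h) fun h h' =>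
          F x (B.antipode (B.act z (S (s * s') * h)) *
          B.antipode (B.antipode (B.act w (S u * h')))))]
        · refine sw_congr fun x w => sw_congr fun x t => sw_congr fun w v => ?_
          rw [sw_comul_mul, sw_comm (Δ t)]
          · refine sw_congr fun v v' => ?_
            rw [sw_comm (Δ t)]
            refine sw_congr fun z u => ?_
            rw [sw_comul_mul, sw_comul_antipode]
            · simp only [HopfAlgebra.antipode_mul_antidistrib, mul_assoc]
            all_goals intros; fun_prop
          all_goals intros; fun_prop
        all_goals intros; fun_prop
    _ = sw (Δ a) fun x b => sw (Δ b) fun w z => sw (B.coact x) fun x t => sw (B.coact w) fun w v =>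
          sw (Δ v) fun v v' => sw (B.coact z) fun z u => sw (Δ (S t * h)) fun K K' =>
          F x (B.antipode (B.act z (S u * (S v' * K))) *
          B.antipode (B.antipode (B.act w (S v * K')))) := by
        rw [sw_coassoc]
        all_goals intros; fun_prop
    _ = sw (Δ a) fun x b => sw (B.coact x) fun x t => ε b • ε (S t * h) • F x 1 :=
        sw_congr fun x b => by
        rw [sw_comm]
        exact sw_congr fun x t =>
          B.sw_antipode_mul_antipode_antipode b (S t * h) (fun y => F x y) (by fun_prop)
    _ = sw (Δ a) fun x b => ε b • ε h • F x 1 := sw_congr fun x b => by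
        rw [← B.isRightCoaction.sw_counit (F := fun x => ε b • ε h • F x 1) x (by fun_prop)]
        refine sw_congr fun x v => ?_
        rw [Bialgebra.counit_mul, HopfAlgebra.counit_antipode, smul_smul, smul_smul, smul_smul]
        congr 1
        ring
    _ = _ := sw_counit_right (F := fun x => ε h • F x 1) a (by fun_prop)

end BraidedHopfAlgebra

variable {T : H →ₗ[k] H} {ρ : M →ₗ[k] M ⊗[k] H} {δ : (M →ₗ[A] A) →ₗ[k] (M →ₗ[A] A) ⊗[k] H}

variable (B) in
/-- The element `f₍₀₎ a₍₁₎₍₀₎ ⊗ b y S²(a₍₂₎ ◁ S(f₍₁₎ a₍₁₎₍₁₎))`, for the braided form of the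
coproduct of `a`. -/
def twistedMul (δ : (M →ₗ[A] A) →ₗ[k] (M →ₗ[A] A) ⊗[k] H) (f : M →ₗ[A] A) (y a b : A) :
    (M →ₗ[A] A) ⊗[k] A :=
  sw (Δ a) fun a a' => sw (δ (homMulRight f a)) fun g h => sw (B.coact a') fun x v =>
    g ⊗ₜ[k] (b * y * B.antipode (B.antipode (B.act x (S v * S h))))

namespace IsHomCoaction

/-- Colinearity of right multiplication on Hom_A(M, A) separates the coactions of f and a₁; that of
a₁ then merges with that of a₂ into the coaction of a. -/
theorem twistedMul_eq (hδ : IsHomCoaction B T ρ δ) (f : M →ₗ[A] A) (y a b : A) :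
    twistedMul B δ f y a b = sw (B.coact a) fun a w => sw (Δ a) fun a a' => sw (δ f) fun g h =>
      homMulRight g a ⊗ₜ[k] (b * y * B.antipode (B.antipode (B.act a' (S (h * w))))) := by
  rw [B.sw_coact_comul a (F := fun a a' w => sw (δ f) fun g h =>
      homMulRight g a ⊗ₜ[k] (b * y * B.antipode (B.antipode (B.act a' (S (h * w))))))]
  · refine sw_congr fun a a' => ?_
    rw [hδ.sw_homMulRight, sw_comm]
    · refine sw_congr fun a u => ?_
      rw [sw_comm]
      simp only [HopfAlgebra.antipode_mul_antidistrib, mul_assoc]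
    all_goals intros; fun_prop
  all_goals intros; fun_prop

/-- This identity dictates the formula for the right action. In `phi` the map g · a₁ evaluates to
g(p) a₁, whose coproduct contributes S(a₂) next to the factor S²(a₃) of the action. They collapse
and leave right multiplication by a in the first factor and b in the second. -/
theorem phiFun_twistedMul (hδ : IsHomCoaction B T ρ δ) (hT : IsAntipodeInv T)
    (hρ : IsRightCoaction ρ) (f : M →ₗ[A] A) (y a b : A) (p : M) (x : A) :
    phiFun B δ (twistedMul B δ f y a b) (p ⊗ₜ x) =
      phiFun B δ (f ⊗ₜ y) (p ⊗ₜ x) * (a ⊗ₜ MulOpposite.op b) := by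
  calc phiFun B δ (twistedMul B δ f y a b) (p ⊗ₜ x)
      = sw (B.coact a) fun a w => sw (Δ a) fun a a' => sw (δ f) fun g h =>
          sw (δ (homMulRight g a)) fun g h' => sw (Δ (g p)) fun u v =>
          u ⊗ₜ MulOpposite.op (b * y * B.antipode (B.antipode (B.act a' (S (h * w)))) *
            B.antipode (B.act v (S h')) * x) := by
        have hl : Lin k fun t => phiFun B δ t (p ⊗ₜ x) := by fun_prop
        rw [hδ.twistedMul_eq, hl.map_sw]
        refine sw_congr fun a w => ?_
        rw [hl.map_sw]
        refine sw_congr fun a a' => ?_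
        rw [hl.map_sw]
        refine sw_congr fun g h => ?_
        rw [phiFun_tmul_tmul]
    _ = sw (B.coact a) fun a w => sw (Δ a) fun a a' => sw (δ f) fun g h => sw (Δ h) fun h' h =>
          sw (B.coact a) fun c s => sw (Δ (g p * c)) fun u v =>
          u ⊗ₜ MulOpposite.op (b * y * B.antipode (B.antipode (B.act a' (S (h * w)))) *
            B.antipode (B.act v (S (h' * s))) * x) :=
        sw_congr fun a w => sw_congr fun a a' => by
        rw [← (hδ.isRightCoaction hT hρ).sw_coassoc]
        · refine sw_congr fun g h => ?_
          rw [hδ.sw_homMulRight]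
          · rfl
          all_goals intros; fun_prop
        all_goals intros; fun_prop
    _ = sw (B.coact a) fun a w => sw (Δ a) fun a a' => sw (δ f) fun g h => sw (Δ h) fun h' h =>
          sw (Δ (g p)) fun q q' => sw (B.coact a) fun c s => sw (Δ c) fun x' z =>
          sw (Δ h') fun h₁ h₂ => (q * x') ⊗ₜ MulOpposite.op
            (b * y * B.antipode (B.antipode (B.act a' (S (h * w)))) *
            (B.antipode (B.act z (S (h₂ * s))) * B.antipode (B.act q' (S h₁))) * x) :=
        sw_congr fun a w => sw_congr fun a a' => sw_congr fun g h => sw_congr fun h' h =>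
          B.sw_comul_mul_antipode_act_antipode (g p) a h' (F := fun u v =>
            u ⊗ₜ MulOpposite.op (b * y * B.antipode (B.antipode (B.act a' (S (h * w)))) *
            v * x)) (by intros; fun_prop) (by intros; fun_prop)
    _ = sw (δ f) fun g h => sw (Δ (g p)) fun q q' => sw (Δ h) fun h' h => sw (Δ h') fun h₁ h₂ =>
          sw (B.coact a) fun a w => sw (Δ a) fun a a' => sw (B.coact a) fun c s =>
          sw (Δ c) fun x' z => (q * x') ⊗ₜ MulOpposite.op
            (b * y * (B.antipode (B.antipode (B.act a' (S (h * w)))) *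
            B.antipode (B.act z (S (h₂ * s)))) * B.antipode (B.act q' (S h₁)) * x) := by
        simp only [mul_assoc]
        calc _ = sw (δ f) fun g h => sw (B.coact a) fun a w => sw (Δ a) fun a a' => 
              sw (Δ (g p)) fun q q' => sw (Δ h) fun h' h => sw (Δ h') fun h₁ h₂ =>
              sw (B.coact a) fun c s =>
              sw (Δ c) fun x' z => (q * x') ⊗ₜ MulOpposite.op
              (b * (y * (B.antipode (B.antipode (B.act a' (S (h * w)))) *
              (B.antipode (B.act z (S (h₂ * s))) * (B.antipode (B.act q' (S h₁)) * x))))) := by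
              rw [sw_comm (δ f)]
              refine sw_congr fun a w => ?_
              rw [sw_comm (δ f)]
              refine sw_congr fun a a' => sw_congr fun g h => ?_
              rw [sw_comm]
              refine sw_congr fun q q' => sw_congr fun h' h => ?_
              rw [sw_comm (Δ h')]
              refine sw_congr fun c s => ?_
              rw [sw_comm]
          _ = _ := sw_congr fun g h => by
              calc _ = sw (B.coact a) fun a w => sw (Δ (g p)) fun q q' => sw (Δ h) fun h' h =>
                    sw (Δ h') fun h₁ h₂ => sw (Δ a) fun a a' => sw (B.coact a) fun c s =>
                    sw (Δ c) fun x' z => (q * x') ⊗ₜ MulOpposite.op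
                    (b * (y * (B.antipode (B.antipode (B.act a' (S (h * w)))) *
                    (B.antipode (B.act z (S (h₂ * s))) * (B.antipode (B.act q' (S h₁)) * x))))) :=
                    sw_congr fun a w => by
                    rw [sw_comm (Δ a)]
                    refine sw_congr fun q q' => ?_
                    rw [sw_comm (Δ a)]
                    refine sw_congr fun h' h => ?_
                    rw [sw_comm (Δ a)]
                _ = _ := by
                  rw [sw_comm (B.coact a)]
                  refine sw_congr fun q q' => ?_
                  rw [sw_comm (B.coact a)]
                  refine sw_congr fun h' h => ?_
                  rw [sw_comm (B.coact a)]
    _ = sw (δ f) fun g h => sw (Δ (g p)) fun q q' => sw (Δ h) fun h₁ h => ε h •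
          (q * a) ⊗ₜ MulOpposite.op (b * y * B.antipode (B.act q' (S h₁)) * x) :=
        sw_congr fun g h => sw_congr fun q q' => by
        rw [sw_coassoc (F := fun h₁ h₂ h => sw (B.coact a) fun a w => sw (Δ a) fun a a' =>
          sw (B.coact a) fun c s =>
          sw (Δ c) fun x' z => (q * x') ⊗ₜ MulOpposite.op
            (b * y * (B.antipode (B.antipode (B.act a' (S (h * w)))) *
            B.antipode (B.act z (S (h₂ * s)))) * B.antipode (B.act q' (S h₁)) * x))]
        · refine sw_congr fun h₁ h => ?_
          have e := B.sw_collapse_left a h (F := fun x' y' => (q * x') ⊗ₜ[k] MulOpposite.op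
            (b * y * y' * B.antipode (B.act q' (S h₁)) * x)) (by intros; fun_prop)
            (by intros; fun_prop)
          simp only [mul_one] at e
          rw [← e, sw_comm (Δ h)]
          refine sw_congr fun a w => ?_
          rw [sw_comm (Δ h)]
          refine sw_congr fun a a' => ?_
          rw [sw_comm (Δ h)]
          refine sw_congr fun c s => ?_
          rw [sw_comm (Δ h)]
        all_goals intros; fun_prop
    _ = _ := by
        have hl : Lin k fun t : A ⊗[k] Aᵐᵒᵖ => t * (a ⊗ₜ MulOpposite.op b) := by fun_prop
        rw [phiFun_tmul_tmul, hl.map_sw]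
        refine sw_congr fun g h => ?_
        rw [hl.map_sw]
        refine sw_congr fun q q' => ?_
        rw [sw_counit_right (F := fun h₁ =>
          (q * a) ⊗ₜ[k] MulOpposite.op (b * y * B.antipode (B.act q' (S h₁)) * x)) h (by fun_prop),
          Algebra.TensorProduct.tmul_mul_tmul, ← MulOpposite.op_mul]
        simp only [mul_assoc]

/-- `f(p₍₀₎)₍₀₎ ⊗ S(f(p₍₀₎)₍₁₎) p₍₁₎ = f₍₀₎(p) ⊗ S(f₍₁₎)`. -/
theorem sw_coact_apply_antipode_mul (hδ : IsHomCoaction B T ρ δ) (hT : IsAntipodeInv T)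
    (hρ : IsRightCoaction ρ) (f : M →ₗ[A] A) (p : M) {F : A → H → U}
    (h1 : ∀ y, Lin k fun x => F x y) (h2 : ∀ x, Lin k fun y => F x y) :
    (sw (ρ p) fun p v => sw (B.coact (f p)) fun a s => F a (S s * v)) =
      sw (δ f) fun g h => F (g p) (S h) := by
  calc (sw (ρ p) fun p v => sw (B.coact (f p)) fun a s => F a (S s * v))
      = sw (δ f) fun g h => sw (ρ p) fun p v => sw (ρ p) fun p u => 
          F (g p) (S h * (S u * v)) := by
        rw [sw_comm (δ f)]
        refine sw_congr fun p v => ?_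
        rw [hδ.sw_coact_apply hT hρ]
        · simp only [HopfAlgebra.antipode_mul_antidistrib, mul_assoc]
        all_goals intros; fun_prop
    _ = sw (δ f) fun g h => sw (ρ p) fun p v => ε v • F (g p) (S h) := sw_congr fun g h => by
        rw [hρ.sw_coassoc]
        · refine sw_congr fun p v => ?_
          rw [_root_.BraidedHoch.sw_antipode_mul (fun u : H => F (g p) (S h * u)) (by fun_prop),
            mul_one]
        all_goals intros; fun_prop
    _ = _ := sw_congr fun g h => hρ.sw_counit (F := fun p => F (g p) (S h)) p (by fun_prop)

end IsHomCoaction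

variable (B) in
/-- The map `c ⊗ d ↦ c₍₀₎₍₁₎ ⊗ d S²(c₍₀₎₍₂₎ ◁ S(c₍₁₎) v)`, from which one recovers a tensor in
`Hom_A(M, A) ⊗ A` from its image under `phi`. -/
def phiRetract (v : H) (s : A ⊗[k] Aᵐᵒᵖ) : A ⊗[k] A :=
  sw s fun c d => sw (B.coact c) fun c u => sw (Δ c) fun x w =>
    x ⊗ₜ (d.unop * B.antipode (B.antipode (B.act w (S u * v))))

@[fun_prop] theorem lin_phiRetract_right {V : Type*} [AddCommGroup V] [Module k V]
    {f : V → A ⊗[k] Aᵐᵒᵖ} (hf : Lin k f) (v : H) : Lin k fun x => phiRetract B v (f x) := by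
  unfold phiRetract; fun_prop

theorem phiRetract_tmul (v : H) (c d : A) : phiRetract B v (c ⊗ₜ MulOpposite.op d) =
    sw (B.coact c) fun c u => sw (Δ c) fun x w =>
      x ⊗ₜ (d * B.antipode (B.antipode (B.act w (S u * v)))) := by
  rw [phiRetract, sw_tmul]
  · rfl
  all_goals intros; fun_prop

namespace IsHomCoaction

/-- After f₍₀₎(p) ⊗ S(f₍₁₎) is replaced by f(p₍₀₎)₍₀₎ ⊗ S(f(p₍₀₎)₍₁₎) p₍₁₎, everything depends on
the single element f(p₍₀₎), and `sw_collapse_right` applies. The parameter v of the retraction is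
the remaining leg of p. -/
theorem phiRetract_phiFun (hδ : IsHomCoaction B T ρ δ) (hT : IsAntipodeInv T)
    (hρ : IsRightCoaction ρ) (f : M →ₗ[A] A) (y : A) (p : M) :
    (sw (ρ p) fun p v => phiRetract B v (phiFun B δ (f ⊗ₜ y) (p ⊗ₜ 1))) = f p ⊗ₜ[k] y := by
  let G : A → H → H → A ⊗[k] A := fun a h v => sw (Δ a) fun c z => sw (B.coact c) fun c u =>
      sw (Δ c) fun x w => x ⊗ₜ (y * (B.antipode (B.act z h) *
        B.antipode (B.antipode (B.act w (S u * v)))))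
  have hG1 : ∀ h v, Lin k fun a => G a h v := fun h v => by fun_prop
  have hG2 : ∀ a v, Lin k fun h => G a h v := fun a v => by fun_prop
  have hG3 : ∀ a h, Lin k fun v => G a h v := fun a h => by fun_prop
  have e : ∀ (p : M) (v : H), (sw (δ f) fun g h => G (g p) (S h) v) =
      phiRetract B v (phiFun B δ (f ⊗ₜ y) (p ⊗ₜ 1)) := fun p v => by
    rw [phiFun_tmul_tmul, (show Lin k fun s => phiRetract B v s by fun_prop).map_sw]
    refine sw_congr fun g h => ?_
    rw [(show Lin k fun s => phiRetract B v s by fun_prop).map_sw]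
    refine sw_congr fun c z => ?_
    rw [phiRetract_tmul]
    simp only [mul_one, mul_assoc]
  calc (sw (ρ p) fun p v => phiRetract B v (phiFun B δ (f ⊗ₜ y) (p ⊗ₜ 1)))
      = sw (ρ p) fun p v => sw (ρ p) fun p v' => sw (B.coact (f p)) fun a s => G a (S s * v') v :=
        sw_congr fun p v => by
          rw [← e, hδ.sw_coact_apply_antipode_mul hT hρ f p (F := fun a h => G a h v)
            (hG1 · v) (hG2 · v)]
    _ = sw (ρ p) fun p v => sw (Δ v) fun v' v => sw (B.coact (f p)) fun a s =>
          G a (S s * v') v := by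
        rw [hρ.sw_coassoc]
        · intros; fun_prop
        · exact fun x z => Lin.sw_fun fun a s => (hG2 a z).comp (by fun_prop)
        · exact fun x z => Lin.sw_fun fun a s => hG3 _ _
    _ = sw (ρ p) fun p v => ε v • (f p ⊗ₜ[k] y) := sw_congr fun p v => by
        have e' := B.sw_collapse_right (f p) v (F := fun x y' => x ⊗ₜ[k] (y * y'))
          (by intros; fun_prop) (by intros; fun_prop)
        simp only [mul_one] at e'
        rw [← e', sw_comm (Δ v)]
        refine sw_congr fun a s => ?_
        rw [sw_comm (Δ v)]
        refine sw_congr fun c z => ?_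
        rw [sw_comm (Δ v)]
        refine sw_congr fun c u => ?_
        rw [sw_comm (Δ v)]
    _ = _ := hρ.sw_counit (F := fun p => f p ⊗ₜ[k] y) p (by fun_prop)

theorem phiFun_injective (hδ : IsHomCoaction B T ρ δ) (hT : IsAntipodeInv T)
    (hρ : IsRightCoaction ρ) (t : (M →ₗ[A] A) ⊗[k] A) (ht : ∀ m, phiFun B δ t m = 0) : t = 0 := by
  refine hom_tensor_injective t fun p => ?_
  have hl : Lin k fun t => sw (ρ p) fun p v => phiRetract B v (phiFun B δ t (p ⊗ₜ 1)) := by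
    fun_prop
  calc (sw t fun f y => f p ⊗ₜ[k] y)
      = sw (ρ p) fun p v => phiRetract B v (phiFun B δ t (p ⊗ₜ 1)) := by
        rw [hl.tensor_eq t]
        exact sw_congr fun f y => (hδ.phiRetract_phiFun hT hρ f y p).symm
    _ = sw (ρ p) fun p v => 0 := sw_congr fun p v => by
        rw [ht, (show Lin k fun s => phiRetract B v s by fun_prop).map_zero']
    _ = 0 := by simp [sw]

/-- Naturality of `phi`. -/
theorem phiFun_comp (hδ : IsHomCoaction B T ρ δ) {σ : N →ₗ[k] N ⊗[k] H}
    {δ' : (N →ₗ[A] A) →ₗ[k] (N →ₗ[A] A) ⊗[k] H} (hδ' : IsHomCoaction B T σ δ') (φ : N →ₗ[A] M)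
    (hφ : IsColinear σ ρ (φ.restrictScalars k)) (t : (M →ₗ[A] A) ⊗[k] A) (m : N ⊗[k] A) :
    phiFun B δ' ((LinearMap.lcomp k A φ).rTensor A t) m =
      phiFun B δ t ((φ.restrictScalars k).rTensor A m) := by
  have h1 : Lin k fun t => phiFun B δ' ((LinearMap.lcomp k A φ).rTensor A t) m := by fun_prop
  rw [h1.tensor_eq t, (show Lin k fun t => phiFun B δ t ((φ.restrictScalars k).rTensor A m) by
    fun_prop).tensor_eq t]
  refine sw_congr fun f y => ?_
  rw [(show Lin k fun m => phiFun B δ' ((LinearMap.lcomp k A φ).rTensor A (f ⊗ₜ y)) m by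
    fun_prop).tensor_eq m,
    (show Lin k fun m => phiFun B δ (f ⊗ₜ y) ((φ.restrictScalars k).rTensor A m) by
    fun_prop).tensor_eq m]
  refine sw_congr fun p x => ?_
  rw [LinearMap.rTensor_tmul, LinearMap.rTensor_tmul, phiFun_tmul_tmul, phiFun_tmul_tmul]
  have e := hδ.apply_comp hδ' φ hφ f
  rw [LinearMap.lcomp_apply', e, sw_rTensor]
  · rfl
  all_goals intros; fun_prop

end IsHomCoaction

end TwistedMul

end

section

/-! ### Bijectivity of `phi` on finite relative projective modules -/

section PhiBijective

variable {k H : Type u} [Field k] [Ring H] [HopfAlgebra k H] {R : UniversalRForm k H}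
variable {A : Type u} [Ring A] [Algebra k A] [Coalgebra k A] {B : BraidedHopfAlgebra R A}
variable {M : Type u} [AddCommGroup M] [Module k M] [Module A M] [IsScalarTower k A M]
variable {N : Type u} [AddCommGroup N] [Module k N] [Module A N] [IsScalarTower k A N]
variable {V : Type u} [AddCommGroup V] [Module k V]

local notation "Δ" => comul (R := k)
local notation "ε" => counit (R := k)
local notation "S" => HopfAlgebra.antipode k (A := H)

variable {T : H →ₗ[k] H} {ρ : M →ₗ[k] M ⊗[k] H} {δ : (M →ₗ[A] A) →ₗ[k] (M →ₗ[A] A) ⊗[k] H}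

theorem phi_twistedMul (hδ : IsHomCoaction B T ρ δ) (hT : IsAntipodeInv T)
    (hρ : IsHopfModule B ρ) (f : M →ₗ[A] A) (y a b : A) (m : IndBimod hρ) :
    phi hδ hT hρ (twistedMul B δ f y a b) m =
      phi hδ hT hρ (f ⊗ₜ y) m * (a ⊗ₜ MulOpposite.op b) := by
  obtain ⟨m, rfl⟩ := (IndBimod.of hρ).surjective m
  rw [phi_apply_of, phi_apply_of]
  have h1 : Lin k fun m => phiFun B δ (twistedMul B δ f y a b) m := by fun_prop
  have h2 : Lin k fun m => phiFun B δ (f ⊗ₜ y) m * (a ⊗ₜ[k] MulOpposite.op b) := by fun_prop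
  rw [h1.tensor_eq m, h2.tensor_eq m]
  exact sw_congr fun p x => hδ.phiFun_twistedMul hT hρ.isRightCoaction f y a b p x

theorem phi_comp (hδ : IsHomCoaction B T ρ δ) (hT : IsAntipodeInv T)
    (hρ : IsHopfModule B ρ) {σ : N →ₗ[k] N ⊗[k] H} {δ' : (N →ₗ[A] A) →ₗ[k] (N →ₗ[A] A) ⊗[k] H}
    (hδ' : IsHomCoaction B T σ δ') (hσ : IsHopfModule B σ) (φ : N →ₗ[A] M)
    (hφ : IsColinear σ ρ (φ.restrictScalars k)) (t : (M →ₗ[A] A) ⊗[k] A) :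
    phi hδ' hT hσ ((LinearMap.lcomp k A φ).rTensor A t) =
      phi hδ hT hρ t ∘ₗ IndBimod.map (hρ := hσ) (hσ := hρ) φ hφ := by
  refine LinearMap.ext fun m => ?_
  obtain ⟨m, rfl⟩ := (IndBimod.of hσ).surjective m
  rw [LinearMap.comp_apply, IndBimod.map_of, phi_apply_of, phi_apply_of]
  exact hδ.phiFun_comp hδ' φ hφ t m

theorem phi_injective (hδ : IsHomCoaction B T ρ δ) (hT : IsAntipodeInv T)
    (hρ : IsHopfModule B ρ) : Function.Injective (phi hδ hT hρ) := by
  refine (injective_iff_map_eq_zero _).2 fun t ht => ?_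
  refine hδ.phiFun_injective hT hρ.isRightCoaction t fun m => ?_
  rw [← phi_apply_of hδ hT hρ, ht, LinearMap.zero_apply]

/-- Stability of the image under right multiplication of values by A^e; it reduces surjectivity on
free modules to producing coordinate forms. -/
theorem exists_phi_mul (hδ : IsHomCoaction B T ρ δ) (hT : IsAntipodeInv T)
    (hρ : IsHopfModule B ρ) (f : M →ₗ[A] A) (y : A) (s : A ⊗[k] Aᵐᵒᵖ) :
    ∃ t, ∀ m, phi hδ hT hρ t m = phi hδ hT hρ (f ⊗ₜ y) m * s := by
  refine ⟨sw s fun a b => twistedMul B δ f y a b.unop, fun m => ?_⟩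
  have hl : Lin k fun t => phi hδ hT hρ t m :=
    ⟨fun x y => by rw [map_add, LinearMap.add_apply], fun c x => by
      rw [map_smul, LinearMap.smul_apply]⟩
  rw [hl.map_sw, (show Lin k fun s => phi hδ hT hρ (f ⊗ₜ y) m * s by fun_prop).tensor_eq s]
  refine sw_congr fun a b => ?_
  rw [phi_twistedMul, MulOpposite.op_unop]

/-- The map `A ⊗ V → A` given by a linear form on `V`. -/
def freeForm (A : Type u) [Ring A] [Algebra k A] (l : V →ₗ[k] k) : A ⊗[k] V →ₗ[A] A :=
  (TensorProduct.AlgebraTensorModule.rid k A A).toLinearMap ∘ₗ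
    TensorProduct.AlgebraTensorModule.map LinearMap.id l

theorem freeForm_tmul (l : V →ₗ[k] k) (a : A) (v : V) :
    freeForm A l (a ⊗ₜ v) = l v • a := by
  simp [freeForm]

/-- At 1 ⊗ v every twist acts on the unit of `A`, hence through the counit: S undoes the S⁻¹ of the
coaction on Hom, and only l(v) remains. -/
theorem phi_freeForm {σ : V →ₗ[k] V ⊗[k] H} (hσ : IsRightCoaction σ)
    {δ : (A ⊗[k] V →ₗ[A] A) →ₗ[k] (A ⊗[k] V →ₗ[A] A) ⊗[k] H}
    (hδ : IsHomCoaction B T (tensorCoaction B.coact σ) δ) (hT : IsAntipodeInv T) (l : V →ₗ[k] k)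
    (v : V) : phi hδ hT (IsHopfModule.free hσ) (freeForm A l ⊗ₜ 1)
      (IndBimod.of _ ((1 ⊗ₜ v) ⊗ₜ 1)) = l v • 1 := by
  rw [phi_apply_of, phiFun_tmul_tmul]
  simp only [one_mul, mul_one]
  calc (sw (δ (freeForm A l)) fun g h => sw (Δ (g (1 ⊗ₜ v))) fun u z =>
        u ⊗ₜ[k] MulOpposite.op (B.antipode (B.act z (S h))))
      = sw (σ v) fun v h => ε h • l v • (1 : A ⊗[k] Aᵐᵒᵖ) := by
        rw [hδ.sw_apply (F := fun c h => sw (Δ c) fun u z =>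
          u ⊗ₜ[k] MulOpposite.op (B.antipode (B.act z (S h)))), sw_tensorCoaction_tmul,
          B.sw_coact_one]
        · refine sw_congr fun v h => ?_
          have hl : Lin k fun a : A => sw (B.coact a) fun a u => sw (Δ a) fun a z =>
            a ⊗ₜ[k] MulOpposite.op (B.antipode (B.act z (S (T (1 * h) * u)))) := by fun_prop
          rw [freeForm_tmul, hl.map_smul', B.sw_coact_one, B.comul_one, sw_tmul]
          · rw [one_mul, mul_one, hT.right, B.one_act, map_smul, B.antipode_one,
              MulOpposite.op_smul, tmul_smul, smul_comm]
            rfl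
          all_goals intros; fun_prop
        all_goals intros; fun_prop
    _ = _ := hσ.sw_counit (F := fun v => l v • (1 : A ⊗[k] Aᵐᵒᵖ)) v (by fun_prop)

/-- A map ψ on the free A^e-module with basis (bⱼ) is the sum of the coordinate forms times the
values ψ(bⱼ); finiteness of V makes the sum finite. -/
theorem phi_free_surjective [Module.Finite k V] {σ : V →ₗ[k] V ⊗[k] H} (hσ : IsRightCoaction σ)
    {δ : (A ⊗[k] V →ₗ[A] A) →ₗ[k] (A ⊗[k] V →ₗ[A] A) ⊗[k] H}
    (hδ : IsHomCoaction B T (tensorCoaction B.coact σ) δ) (hT : IsAntipodeInv T) :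
    Function.Surjective (phi hδ hT (IsHopfModule.free hσ)) := by
  intro ψ
  let b := Module.finBasis k V
  choose t ht using fun j => exists_phi_mul hδ hT (IsHopfModule.free hσ) (freeForm A (b.coord j)) 1
    (ψ (IndBimod.of _ ((1 ⊗ₜ b j) ⊗ₜ 1)))
  refine ⟨∑ j, t j, LinearMap.ext fun m => ?_⟩
  obtain ⟨m, rfl⟩ := (IndBimod.ofFree_bijective B hσ).2 m
  induction m with
  | zero => rw [map_zero, map_zero, map_zero]
  | add x y hx hy => rw [map_add, map_add, map_add, hx, hy]
  | tmul s v =>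
    rw [IndBimod.ofFree_tmul, map_smul, map_smul]
    congr 1
    rw [map_sum, LinearMap.sum_apply]
    simp only [ht]
    conv_rhs => rw [← b.sum_repr v]
    simp only [TensorProduct.tmul_sum, TensorProduct.sum_tmul, map_sum]
    refine Finset.sum_congr rfl fun j _ => ?_
    rw [tmul_smul, ← smul_tmul', map_smul, ← algebraMap_smul (A ⊗[k] Aᵐᵒᵖ) (b.repr v j)
      (IndBimod.of _ _), map_smul, algebraMap_smul]
    refine (congrArg (· * ψ (IndBimod.of _ ((1 ⊗ₜ b j) ⊗ₜ 1)))
      (phi_freeForm hσ hδ hT (b.coord j) v)).trans ?_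
    simp only [smul_mul_assoc, one_mul]
    rfl

/-- Surjectivity passes to a direct summand by naturality: ψ is lifted after composition with the
projection p, and the lift is restricted along i. -/
theorem phi_surjective (hδ : IsHomCoaction B T ρ δ) (hT : IsAntipodeInv T)
    (hρ : IsHopfModule B ρ) (h : IsFiniteRelProjective B ρ) :
    Function.Surjective (phi hδ hT hρ) := by
  intro ψ
  obtain ⟨V, _, _, σ, i, p, hσ, hV, hi, hp, hip⟩ := h
  have := hV.finite
  obtain ⟨δ', hδ'⟩ := exists_isHomCoaction hT (IsHopfModule.free (B := B) hσ)
  obtain ⟨t, ht⟩ := phi_free_surjective hσ hδ' hT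
    (ψ ∘ₗ IndBimod.map (hρ := IsHopfModule.free hσ) (hσ := hρ) p hp)
  refine ⟨(LinearMap.lcomp k A i).rTensor A t, ?_⟩
  rw [phi_comp hδ' hT (IsHopfModule.free hσ) hδ hρ i hi, ht]
  refine LinearMap.ext fun m => congrArg ψ ?_
  obtain ⟨m, rfl⟩ := (IndBimod.of hρ).surjective m
  rw [IndBimod.map_of, IndBimod.map_of, ← LinearMap.comp_apply, ← LinearMap.rTensor_comp]
  have e : p.restrictScalars k ∘ₗ i.restrictScalars k = LinearMap.id :=
    LinearMap.ext fun x => LinearMap.congr_fun hip x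
  rw [e, LinearMap.rTensor_id]
  rfl

end PhiBijective

end

section

/-! ### The projective resolution P ⊗ A of the bimodule `A` -/

section ResolutionOfExact

variable {Λ : Type u} [Ring Λ] (X : ℕ → ModuleCat.{u} Λ) (d : ∀ n, X (n + 1) ⟶ X n)
  {Z : ModuleCat.{u} Λ} (π : X 0 ⟶ Z)

/-- The projective resolution given by an exact sequence of projective modules. -/
def resolutionOfExact (hX : ∀ n, Module.Projective Λ (X n))
    (hd : ∀ n, Function.Exact (d (n + 1)).hom (d n).hom) (h0 : Function.Exact (d 0).hom π.hom)
    (hπ : Function.Surjective π.hom) : ProjectiveResolution Z where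
  complex := ChainComplex.of X d fun n => ModuleCat.hom_ext (hd n).linearMap_comp_eq_zero
  projective n := (IsProjective.iff_projective (X n)).1 (hX n)
  π := (ChainComplex.toSingle₀Equiv _ _).symm ⟨π, by
    exact (congrArg (· ≫ π) (ChainComplex.of_d X d 0)).trans
      (ModuleCat.hom_ext h0.linearMap_comp_eq_zero)⟩
  quasiIso := ⟨fun n => by
    cases n with
    | zero =>
      -- In degree 0 a quasi-isomorphism to a module placed in degree 0 means that d₀, π is exact
      -- and π is an epimorphism.
      rw [ChainComplex.quasiIsoAt₀_iff, ShortComplex.quasiIso_iff_of_zeros']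
      · refine (ShortComplex.exact_and_epi_g_iff_of_iso (S₂ := ShortComplex.mk (d 0) π
          (ModuleCat.hom_ext h0.linearMap_comp_eq_zero)) ?_).2
          ⟨(ShortComplex.ShortExact.moduleCat_exact_iff_function_exact _).2 h0,
            (ModuleCat.epi_iff_surjective _).2 hπ⟩
        refine ShortComplex.isoMk (Iso.refl _) (Iso.refl _) (Iso.refl _) ?_ ?_
        · exact (Category.id_comp _).trans
            ((ChainComplex.of_d X d 0).symm.trans (Category.comp_id _).symm)
        · exact (Category.id_comp _).trans
            ((ChainComplex.toSingle₀Equiv_symm_apply_f_zero (C := ChainComplex.of X d fun n =>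
              ModuleCat.hom_ext (hd n).linearMap_comp_eq_zero) (X := Z) π _).symm.trans
              (Category.comp_id _).symm)
      all_goals rfl
    | succ n =>
      rw [quasiIsoAt_iff_exactAt', HomologicalComplex.exactAt_iff' _ (n + 1 + 1) (n + 1) n
        (by simp) (by simp)]
      · refine (ShortComplex.ShortExact.moduleCat_exact_iff_function_exact _).2 ?_
        simp only [HomologicalComplex.sc', HomologicalComplex.shortComplexFunctor',
          ChainComplex.of_d]
        exact hd n
      · apply ChainComplex.exactAt_succ_single_obj⟩

end ResolutionOfExact

section Augmentation

variable {k H : Type u} [Field k] [Ring H] [HopfAlgebra k H] {R : UniversalRForm k H}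
variable {A : Type u} [Ring A] [Algebra k A] [Coalgebra k A] {B : BraidedHopfAlgebra R A}
variable {M : Type u} [AddCommGroup M] [Module k M] [Module A M] [IsScalarTower k A M]

local notation "Δ" => comul (R := k)
local notation "ε" => counit (R := k)

/-- The bimodule map `M ⊗ A → A` given by an augmentation `M → k`. -/
def augmentation {ρ : M →ₗ[k] M ⊗[k] H} (hρ : IsHopfModule B ρ) (e : M →ₗ[k] k)
    (he : ∀ (a : A) m, e (a • m) = ε a * e m) (hc : IsColinear ρ (trivialCoaction H k) e) :
    ModuleCat.of (A ⊗[k] Aᵐᵒᵖ) (IndBimod hρ) ⟶ regularBimodule k A :=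
  letI : Module (A ⊗[k] Aᵐᵒᵖ) A := TensorProduct.Algebra.module
  haveI : IsScalarTower k (A ⊗[k] Aᵐᵒᵖ) A := ⟨fun c s x => by
    change TensorProduct.Algebra.moduleAux (c • s) x = c • TensorProduct.Algebra.moduleAux s x
    rw [map_smul]
    rfl⟩
  ModuleCat.ofHom (Y := A)
    { toFun := fun t => TensorProduct.lid k A (e.rTensor A ((IndBimod.of hρ).symm t))
      map_add' := fun s t => by simp only [map_add]
      map_smul' := fun s t => by
        refine IndBimod.map_smul_of hρ
          (f := fun t => (TensorProduct.lid k A).toLinearMap (e.rTensor A t)) (by fun_prop)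
          (fun a b p x => ?_) s t
        rw [TensorProduct.Algebra.smul_def]
        simp only [LinearMap.rTensor_tmul, LinearEquiv.coe_coe, TensorProduct.lid_tmul, he]
        -- Since `e` is colinear to the trivial comodule, the twist p₍₁₎ becomes 1 and acts
        -- trivially on a'.
        have h1 : ∀ a' : A, (sw (ρ p) fun p u => e p • (B.act a' u * x * b)) =
            e p • (a' * x * b) := fun a' => by
          have := hc.sw_apply p (F := fun c u => c • (B.act a' u * x * b))
            (by intros; fun_prop) (by intros; fun_prop)
          rw [sw_trivialCoaction, B.act_one] at this
          · exact this.symm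
          all_goals intros; fun_prop
        calc _ = sw (Δ a) fun a a' => ε a • e p • (a' * x * b) := sw_congr fun a a' => by
              rw [← h1, Lin.map_sw (g := fun t : A => ε a • t) (by fun_prop)]
              simp only [smul_smul]
          _ = e p • (a * x * b) := sw_counit_left (F := fun a' => e p • (a' * x * b)) a
              (by fun_prop)
          _ = _ := by
              rw [op_smul_eq_mul, smul_eq_mul, smul_mul_assoc, mul_smul_comm, mul_assoc] }

/-- The twist affects only the actions: the underlying maps are φ ⊗ A and e ⊗ A, exact by flatness
over the field. -/
theorem augmentation_exact {ρ : M →ₗ[k] M ⊗[k] H} (hρ : IsHopfModule B ρ) (e : M →ₗ[k] k)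
    (he : ∀ (a : A) m, e (a • m) = ε a * e m) (hc : IsColinear ρ (trivialCoaction H k) e)
    {N : Type u} [AddCommGroup N] [Module k N] [Module A N] [IsScalarTower k A N]
    {σ : N →ₗ[k] N ⊗[k] H} (hσ : IsHopfModule B σ) (φ : N →ₗ[A] M)
    (hφ : IsColinear σ ρ (φ.restrictScalars k)) (h : Function.Exact (φ.restrictScalars k) e) :
    Function.Exact (IndBimod.map (hρ := hσ) (hσ := hρ) φ hφ) (augmentation hρ e he hc).hom := by
  intro t
  obtain ⟨t, rfl⟩ := (IndBimod.of hρ).surjective t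
  have h0 : TensorProduct.lid k A (e.rTensor A t) = 0 ↔ e.rTensor A t = 0 :=
    LinearEquiv.map_eq_zero_iff _
  exact Iff.trans h0 (Module.Flat.rTensor_exact A h t)

theorem augmentation_surjective {ρ : M →ₗ[k] M ⊗[k] H} (hρ : IsHopfModule B ρ) (e : M →ₗ[k] k)
    (he : ∀ (a : A) m, e (a • m) = ε a * e m) (hc : IsColinear ρ (trivialCoaction H k) e)
    (h : Function.Surjective e) : Function.Surjective (augmentation hρ e he hc).hom := by
  intro x
  obtain ⟨p, hp⟩ := h 1
  have h1 : ∀ y : A, TensorProduct.lid k A (e.rTensor A (p ⊗ₜ[k] y)) = y := fun y => by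
    rw [LinearMap.rTensor_tmul, hp, TensorProduct.lid_tmul, one_smul]
  exact ⟨IndBimod.of hρ (p ⊗ₜ[k] x), h1 x⟩

end Augmentation

section Resolution

variable {k H : Type u} [Field k] [Ring H] [HopfAlgebra k H] {R : UniversalRForm k H}
variable {A : Type u} [Ring A] [Algebra k A] [Coalgebra k A] {B : BraidedHopfAlgebra R A}

variable (B) in
/-- The identity map from the trivial module to `k`. -/
def trivialModuleForm : trivialModule B →ₗ[k] k where
  toFun x := x
  map_add' _ _ := rfl
  map_smul' c x := by
    -- The scalars of `k` act on the trivial module through `A`, hence by ε(c · 1) = c.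
    change counit (R := k) (algebraMap k A c) * _ = _
    rw [Algebra.algebraMap_eq_smul_one, map_smul, B.counit_one]
    simp
    rfl

theorem trivialModuleForm_smul (a : A) (x : trivialModule B) :
    trivialModuleForm B (a • x) = counit (R := k) a * trivialModuleForm B x := rfl

namespace FiniteRelProjResolution

variable (P : FiniteRelProjResolution B (trivialModule B) (trivialCoaction H (trivialModule B)))

/-- The augmentation `P₀ → k`. -/
def form : P.complex.X 0 →ₗ[k] k :=
  trivialModuleForm B ∘ₗ
    ((show P.complex.X 0 ⟶ trivialModule B from P.π.f 0).hom.restrictScalars k)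

theorem form_smul (a : A) (m : P.complex.X 0) :
    P.form (a • m) = counit (R := k) a * P.form m := by
  refine Eq.trans ?_ (trivialModuleForm_smul (B := B) a _)
  exact congrArg (trivialModuleForm B) (map_smul (show P.complex.X 0 ⟶ trivialModule B from
    P.π.f 0).hom a m)

theorem form_colinear : IsColinear (P.coact 0) (trivialCoaction H k) P.form := by
  have h := P.π_colinear
  unfold IsColinear at h ⊢
  rw [form, LinearMap.rTensor_comp, LinearMap.comp_assoc, ← h]
  rfl

theorem exact_d (n : ℕ) : Function.Exact ((P.complex.d (n + 2) (n + 1)).hom.restrictScalars k)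
    ((P.complex.d (n + 1) n).hom.restrictScalars k) :=
  (ShortComplex.ShortExact.moduleCat_exact_iff_function_exact _).1
    (P.toProjectiveResolution.exact_succ n)

theorem exact_form : Function.Exact ((P.complex.d 1 0).hom.restrictScalars k) P.form :=
  (ShortComplex.ShortExact.moduleCat_exact_iff_function_exact _).1
    P.toProjectiveResolution.exact₀

theorem form_surjective : Function.Surjective P.form :=
  (ModuleCat.epi_iff_surjective (P.toProjectiveResolution.π.f 0)).1 inferInstance

/-- The terms of the bimodule resolution of `A` given by `P`. -/
def bimodX (n : ℕ) : ModuleCat.{u} (A ⊗[k] Aᵐᵒᵖ) :=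
  ModuleCat.of (A ⊗[k] Aᵐᵒᵖ) (IndBimod (P.isHopfModule n))

/-- The differentials of the bimodule resolution of `A` given by `P`. -/
def bimodD (n : ℕ) : P.bimodX (n + 1) ⟶ P.bimodX n :=
  ModuleCat.ofHom (IndBimod.map (hρ := P.isHopfModule (n + 1)) (hσ := P.isHopfModule n)
    (P.complex.d (n + 1) n).hom (P.d_colinear n))

/-- The resolution `P ⊗ A` of the bimodule `A`. -/
def bimodResolution : ProjectiveResolution (regularBimodule k A) :=
  resolutionOfExact P.bimodX P.bimodD
    (augmentation (P.isHopfModule 0) P.form P.form_smul P.form_colinear)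
    (fun n => IndBimod.projective (P.isHopfModule n) (P.isFiniteRelProjective n))
    (fun n => Module.Flat.rTensor_exact A (P.exact_d n))
    (augmentation_exact _ _ _ _ _ _ (P.d_colinear 0) P.exact_form)
    (augmentation_surjective _ _ _ _ P.form_surjective)

theorem bimodResolution_d (n : ℕ) : P.bimodResolution.complex.d (n + 1) n = P.bimodD n :=
  ChainComplex.of_d P.bimodX P.bimodD n

end FiniteRelProjResolution

end Resolution

end

section

/-! ### Vanishing in Ext⁰, factorization of linear maps, sub- and quotient comodules -/

section ExtZero

open CochainComplex HomComplex Abelian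

variable {C : Type*} [Category* C] [Abelian C] [HasExt C] {X Y : C}

theorem extMk_zero_eq_zero_iff (P : ProjectiveResolution X) (f : P.complex.X 0 ⟶ Y)
    (hf : P.complex.d 1 0 ≫ f = 0) : P.extMk f 1 rfl hf = 0 ↔ f = 0 := by
  simp only [← P.extEquivCohomologyClass.apply_eq_iff_eq,
    ProjectiveResolution.extEquivCohomologyClass_extMk,
    ProjectiveResolution.extEquivCohomologyClass_zero, CohomologyClass.mk_eq_zero_iff]
  rw [Cocycle.toSingleMk_mem_coboundaries_iff _ _ _ _ _ 1 (by simp)]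
  -- A cochain bounding f would live on the term of cohomological degree 1 of the resolution, which
  -- is zero. So there are no coboundaries in degree 0.
  have h0 : Limits.IsZero (P.cochainComplex.X 1) :=
    CochainComplex.isZero_of_isStrictlyLE _ 0 _
  constructor
  · rintro ⟨g, hg⟩
    rw [h0.eq_of_src g 0, Limits.comp_zero] at hg
    rw [← cancel_epi (P.cochainComplexXIso (-(0 : ℕ)) 0 rfl).hom, ← hg, Limits.comp_zero]
  · rintro rfl
    exact ⟨0, by simp⟩

end ExtZero

section LinearAlgebra

variable {k : Type u} [Field k]
variable {V W X : Type u} [AddCommGroup V] [Module k V] [AddCommGroup W] [Module k W]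
  [AddCommGroup X] [Module k X]

/-- A linear map that vanishes on the kernel of a surjective map factors through it. -/
theorem exists_factor_surjective (κ : V →ₗ[k] W) (hκ : Function.Surjective κ) (f : V →ₗ[k] X)
    (h : ∀ v, κ v = 0 → f v = 0) : ∃ g : W →ₗ[k] X, ∀ v, g (κ v) = f v := by
  refine ⟨(LinearMap.ker κ).liftQ f h ∘ₗ (κ.quotKerEquivOfSurjective hκ).symm.toLinearMap,
    fun v => ?_⟩
  have e : (κ.quotKerEquivOfSurjective hκ).symm (κ v) = Submodule.Quotient.mk v := by
    rw [LinearEquiv.symm_apply_eq]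
    rfl
  rw [LinearMap.comp_apply, LinearEquiv.coe_coe, e]
  exact Submodule.liftQ_apply _ _ _

/-- A linear map with values in the image of an injective map factors through it. -/
theorem exists_factor_injective (ι : W →ₗ[k] X) (hι : Function.Injective ι) (f : V →ₗ[k] X)
    (h : ∀ v, ∃ w, ι w = f v) : ∃ g : V →ₗ[k] W, ∀ v, ι (g v) = f v := by
  refine ⟨(LinearEquiv.ofInjective ι hι).symm.toLinearMap ∘ₗ
    f.codRestrict (LinearMap.range ι) h, fun v => ?_⟩
  rw [LinearMap.comp_apply, LinearEquiv.coe_coe, ← LinearEquiv.ofInjective_apply (h := hι),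
    LinearEquiv.apply_symm_apply]
  rfl

/-- Both targets are quotients of G by the same subgroup. Here G will be the group of cocycles
tensored with `A`. -/
theorem exists_addEquiv_of_ker_eq {G K L : Type*} [AddCommGroup G] [AddCommGroup K]
    [AddCommGroup L] (μ : G →+ K) (hμ : Function.Surjective μ) (ν : G →+ L)
    (hν : Function.Surjective ν) (h : ∀ x, ν x = 0 ↔ μ x = 0) :
    ∃ e : K ≃+ L, ∀ x, e (μ x) = ν x := by
  have hk : μ.ker = ν.ker := by
    ext x
    exact (h x).symm
  refine ⟨(QuotientAddGroup.quotientKerEquivOfSurjective μ hμ).symm.trans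
    ((QuotientAddGroup.quotientAddEquivOfEq hk).trans
      (QuotientAddGroup.quotientKerEquivOfSurjective ν hν)), fun x => ?_⟩
  have e : (QuotientAddGroup.quotientKerEquivOfSurjective μ hμ).symm (μ x) = (x : G ⧸ μ.ker) := by
    rw [AddEquiv.symm_apply_eq]
    rfl
  rw [AddEquiv.trans_apply, e]
  rfl

end LinearAlgebra

section Comodule

variable {k H : Type u} [Field k] [Ring H] [HopfAlgebra k H]
variable {V W : Type u} [AddCommGroup V] [Module k V] [AddCommGroup W] [Module k W]

local notation "Δ" => comul (R := k)
local notation "ε" => counit (R := k)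

theorem IsRightCoaction.of_surjective {ρ : V →ₗ[k] V ⊗[k] H} {σ : W →ₗ[k] W ⊗[k] H}
    (hρ : IsRightCoaction ρ) (f : V →ₗ[k] W) (hf : IsColinear ρ σ f)
    (hs : Function.Surjective f) : IsRightCoaction σ := by
  refine .of_sw (fun w => ?_) fun w => ?_
  · obtain ⟨v, rfl⟩ := hs w
    rw [hf.sw_apply, hf.sw_apply]
    · calc (sw (ρ v) fun x h => sw (σ (f x)) fun y h' => y ⊗ₜ[k] (h' ⊗ₜ[k] h))
          = sw (ρ v) fun x h => sw (ρ x) fun x h' => f x ⊗ₜ[k] (h' ⊗ₜ[k] h) :=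
            sw_congr fun x h => hf.sw_apply x (by intros; fun_prop) (by intros; fun_prop)
        _ = _ := hρ.sw_coassoc v (F := fun x h' h => f x ⊗ₜ[k] (h' ⊗ₜ[k] h))
          (by intros; fun_prop) (by intros; fun_prop) (by intros; fun_prop)
    all_goals intros; fun_prop
  · obtain ⟨v, rfl⟩ := hs w
    rw [hf.sw_apply]
    · exact hρ.sw_counit (F := fun x => f x) v (by fun_prop)
    all_goals intros; fun_prop

theorem IsRightCoaction.of_injective {ρ : V →ₗ[k] V ⊗[k] H} {σ : W →ₗ[k] W ⊗[k] H}
    (hσ : IsRightCoaction σ) (f : V →ₗ[k] W) (hf : IsColinear ρ σ f)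
    (hi : Function.Injective f) : IsRightCoaction ρ := by
  refine .of_sw (fun v => ?_) fun v => hi ?_
  · apply Module.Flat.rTensor_preserves_injective_linearMap (M := H ⊗[k] H) f hi
    rw [(Lin.coe (f.rTensor (H ⊗[k] H))).map_sw, (Lin.coe (f.rTensor (H ⊗[k] H))).map_sw]
    simp only [(Lin.coe (f.rTensor (H ⊗[k] H))).map_sw, LinearMap.rTensor_tmul]
    calc (sw (ρ v) fun x h => sw (ρ x) fun x h' => f x ⊗ₜ[k] (h' ⊗ₜ[k] h))
        = sw (ρ v) fun x h => sw (σ (f x)) fun y h' => y ⊗ₜ[k] (h' ⊗ₜ[k] h) :=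
          sw_congr fun x h =>
            (hf.sw_apply x (F := fun y h' => y ⊗ₜ[k] (h' ⊗ₜ[k] h)) (by intros; fun_prop)
              (by intros; fun_prop)).symm
      _ = sw (σ (f v)) fun y h => sw (σ y) fun y h' => y ⊗ₜ[k] (h' ⊗ₜ[k] h) :=
          (hf.sw_apply v (F := fun y h => sw (σ y) fun y h' => y ⊗ₜ[k] (h' ⊗ₜ[k] h))
            (by intros; fun_prop) (by intros; fun_prop)).symm
      _ = sw (σ (f v)) fun y h => sw (Δ h) fun h h' => y ⊗ₜ[k] (h ⊗ₜ[k] h') :=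
          hσ.sw_coassoc _ (by intros; fun_prop) (by intros; fun_prop) (by intros; fun_prop)
      _ = _ := hf.sw_apply v (F := fun y h => sw (Δ h) fun h h' => y ⊗ₜ[k] (h ⊗ₜ[k] h'))
            (by intros; fun_prop) (by intros; fun_prop)
  · rw [(Lin.coe f).map_sw]
    simp only [map_smul]
    rw [← hf.sw_apply v (F := fun x h => ε h • x)]
    · exact hσ.sw_counit (F := fun x => x) (f v) (by fun_prop)
    all_goals intros; fun_prop

end Comodule

section HomMulRightMap

variable {k A M : Type u} [Field k] [Ring A] [Algebra k A] [AddCommGroup M] [Module A M]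

/-- Right multiplication by elements of `A` on `f : M → A`. -/
def homMulRightMap (f : M →ₗ[A] A) : A →ₗ[k] M →ₗ[A] A where
  toFun a := homMulRight f a
  map_add' a b := by ext; simp [mul_add]
  map_smul' c a := by ext; simp

end HomMulRightMap

/-! ### The twisted formula for an arbitrary comodule, and its naturality -/

section TwistedElement

variable {k H : Type u} [Field k] [Ring H] [HopfAlgebra k H] {R : UniversalRForm k H}
variable {A : Type u} [Ring A] [Algebra k A] [Coalgebra k A] (B : BraidedHopfAlgebra R A)
variable {V W : Type u} [AddCommGroup V] [Module k V] [AddCommGroup W] [Module k W]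
variable {M : Type u} [AddCommGroup M] [Module k M] [Module A M] [IsScalarTower k A M]

local notation "Δ" => comul (R := k)
local notation "S" => HopfAlgebra.antipode k (A := H)

/-- The element `r(a₍₁₎)₍₀₎ ⊗ b a' S²(a₍₂₎₍₀₎) r(a₍₂₎₍₁₎, S(a₍₂₎₍₂₎) S(r(a₍₁₎)₍₁₎))`. -/
def twistedElement (δ : V →ₗ[k] V ⊗[k] H) (r : A →ₗ[k] V) (a' a b : A) : V ⊗[k] A :=
  twistContract B V a' b (TensorProduct.map (δ ∘ₗ r)
    ((comul (R := k) (A := H)).lTensor A ∘ₗ B.coact) (comul (R := k) a))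

/-- By coassociativity one leg of the coaction of a₂ pairs with x in `r` to form the action ◁, so
the formula of the theorem is the one with S²(x ◁ -). -/
theorem twistedElement_eq_sw (δ : V →ₗ[k] V ⊗[k] H) (r : A →ₗ[k] V) (a' a b : A) :
    twistedElement B δ r a' a b = sw (Δ a) fun a₁ a₂ => sw (δ (r a₁)) fun g h =>
      sw (B.coact a₂) fun x v => g ⊗ₜ[k] (b * a' * B.antipode (B.antipode
        (B.act x (S v * S h)))) := by
  have hL : Lin k fun t => twistContract B V a' b (TensorProduct.map (δ ∘ₗ r)
    ((comul (R := k) (A := H)).lTensor A ∘ₗ B.coact) t) := by fun_prop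
  rw [twistedElement, hL.tensor_eq]
  refine sw_congr fun a₁ a₂ => ?_
  rw [TensorProduct.map_tmul, LinearMap.comp_apply, LinearMap.comp_apply]
  have h1 : Lin k fun t : V ⊗[k] H => twistContract B V a' b
    (t ⊗ₜ (comul (R := k) (A := H)).lTensor A (B.coact a₂)) := by fun_prop
  rw [h1.tensor_eq]
  refine sw_congr fun g h => ?_
  have h2 : Lin k fun t : A ⊗[k] H => twistContract B V a' b
    ((g ⊗ₜ h) ⊗ₜ (comul (R := k) (A := H)).lTensor A t) := by fun_prop
  rw [h2.tensor_eq]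
  calc _ = sw (B.coact a₂) fun x v => sw (Δ v) fun u v =>
        R.r (u ⊗ₜ (S v * S h)) • (g ⊗ₜ[k] (b * a' * B.antipode (B.antipode x))) :=
        sw_congr fun x v => by
          have h3 : Lin k fun t : H ⊗[k] H => twistContract B V a' b
            ((g ⊗ₜ h) ⊗ₜ (x ⊗ₜ t)) := by fun_prop
          rw [LinearMap.lTensor_tmul, h3.tensor_eq]
          exact sw_congr fun u v => twistContract_tmul B V a' b g h x u v
    _ = sw (B.coact a₂) fun x v => sw (B.coact x) fun x u =>
        R.r (u ⊗ₜ (S v * S h)) • (g ⊗ₜ[k] (b * a' * B.antipode (B.antipode x))) :=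
        (B.isRightCoaction.sw_coassoc a₂ (F := fun x u v =>
          R.r (u ⊗ₜ (S v * S h)) • (g ⊗ₜ[k] (b * a' * B.antipode (B.antipode x))))
          (by intros; fun_prop) (by intros; fun_prop) (by intros; fun_prop)).symm
    _ = _ := sw_congr fun x v =>
        (B.map_act (fun x => g ⊗ₜ[k] (b * a' * B.antipode (B.antipode x))) (by fun_prop) x _).symm

/-- Naturality in the comodule carries the formula from cochains to cocycles and on to Ext classes.
-/
theorem rTensor_twistedElement {δ : V →ₗ[k] V ⊗[k] H} {δ' : W →ₗ[k] W ⊗[k] H} (f : V →ₗ[k] W)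
    (hf : IsColinear δ δ' f) (r : A →ₗ[k] V) (a' a b : A) :
    f.rTensor A (twistedElement B δ r a' a b) = twistedElement B δ' (f ∘ₗ r) a' a b := by
  rw [twistedElement_eq_sw, twistedElement_eq_sw, (Lin.coe (f.rTensor A)).map_sw]
  refine sw_congr fun a₁ a₂ => ?_
  rw [(Lin.coe (f.rTensor A)).map_sw, LinearMap.comp_apply, hf.sw_apply]
  · refine sw_congr fun g h => ?_
    rw [(Lin.coe (f.rTensor A)).map_sw]
    rfl
  all_goals intros; fun_prop

theorem twistedElement_homMulRightMap (δ : (M →ₗ[A] A) →ₗ[k] (M →ₗ[A] A) ⊗[k] H)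
    (f : M →ₗ[A] A) (y a b : A) :
    twistedElement B δ (homMulRightMap f) y a b = twistedMul B δ f y a b :=
  twistedElement_eq_sw B δ _ y a b

end TwistedElement

end

section

section Sum

variable {k : Type u} [Field k] {V W X : Type u} [AddCommGroup V] [Module k V] [AddCommGroup W]
  [Module k W] [AddCommGroup X] [Module k X]

theorem exists_eq_sum_tmul (t : V ⊗[k] W) :
    ∃ (m : ℕ) (v : Fin m → V) (w : Fin m → W), t = ∑ i, v i ⊗ₜ[k] w i := by
  obtain ⟨l, rfl⟩ := exists_rep t
  refine ⟨l.length, fun i => l[i].1, fun i => l[i].2, ?_⟩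
  rw [← List.sum_ofFn]
  congr 1
  exact (List.ofFn_getElem_eq_map l fun p => p.1 ⊗ₜ[k] p.2).symm

theorem sw_sum_tmul {F : V → W → X} (h1 : ∀ w, Lin k fun v => F v w) (h2 : ∀ v, Lin k (F v))
    {m : ℕ} (v : Fin m → V) (w : Fin m → W) :
    sw (∑ i, v i ⊗ₜ[k] w i) F = ∑ i, F (v i) (w i) := by
  have hs : Lin k fun t : V ⊗[k] W => sw t F := by fun_prop
  rw [← hs.toLinearMap_apply, map_sum]
  refine Finset.sum_congr rfl fun i _ => ?_
  rw [hs.toLinearMap_apply, sw_tmul]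
  · exact h1
  · exact h2

end Sum

/-! ### Cocycles and `Ext` -/

section Cocycles

variable {k A : Type u} [Field k] [Ring A] [Algebra k A] {M : ModuleCat.{u} A}
variable (Q : ProjectiveResolution M)

variable (k) in
/-- The differential `Hom_A(Q_n, A) → Hom_A(Q_{n+1}, A)`. -/
def dual (n : ℕ) : (Q.complex.X n →ₗ[A] A) →ₗ[k] (Q.complex.X (n + 1) →ₗ[A] A) :=
  LinearMap.lcomp k A (Q.complex.d (n + 1) n).hom

theorem dual_dual (n : ℕ) (f : Q.complex.X n →ₗ[A] A) :
    dual k Q (n + 1) (dual k Q n f) = 0 := by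
  refine LinearMap.ext fun x => ?_
  have h := congrArg (fun g => g.hom x) (Q.complex.d_comp_d (n + 2) (n + 1) n)
  simp only [ModuleCat.hom_comp, LinearMap.comp_apply] at h
  exact (congrArg f h).trans (map_zero f)

variable (k) in
/-- The cocycles of degree `n` of `Hom_A(Q, A)`. -/
def Cocycles (n : ℕ) : Type u := LinearMap.ker (dual k Q n)

namespace Cocycles

instance (n : ℕ) : AddCommGroup (Cocycles k Q n) :=
  inferInstanceAs (AddCommGroup (LinearMap.ker (dual k Q n)))

instance (n : ℕ) : Module k (Cocycles k Q n) :=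
  inferInstanceAs (Module k (LinearMap.ker (dual k Q n)))

/-- The inclusion of the cocycles into the cochains. -/
def val (n : ℕ) : Cocycles k Q n →ₗ[k] (Q.complex.X n →ₗ[A] A) :=
  (LinearMap.ker (dual k Q n)).subtype

theorem val_injective (n : ℕ) : Function.Injective (val (k := k) Q n) :=
  (LinearMap.ker (dual k Q n)).injective_subtype

theorem exact_val (n : ℕ) : Function.Exact (val (k := k) Q n) (dual k Q n) :=
  LinearMap.exact_subtype_ker_map (dual k Q n)

theorem dual_val (n : ℕ) (z : Cocycles k Q n) : dual k Q n (val Q n z) = 0 :=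
  (exact_val Q n _).2 ⟨z, rfl⟩

theorem rTensor_val_injective (V : Type u) [AddCommGroup V] [Module k V] (n : ℕ) :
    Function.Injective ((val (k := k) Q n).rTensor V) :=
  Module.Flat.rTensor_preserves_injective_linearMap _ (val_injective Q n)

theorem rTensor_exact_val (V : Type u) [AddCommGroup V] [Module k V] (n : ℕ) :
    Function.Exact ((val (k := k) Q n).rTensor V) ((dual k Q n).rTensor V) :=
  Module.Flat.rTensor_exact V (exact_val Q n)

theorem rTensor_dual_val (V : Type u) [AddCommGroup V] [Module k V] (n : ℕ)
    (t : Cocycles k Q n ⊗[k] V) : (dual k Q n).rTensor V ((val Q n).rTensor V t) = 0 :=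
  (rTensor_exact_val Q V n _).2 ⟨t, rfl⟩

theorem d_comp_val (n : ℕ) (z : Cocycles k Q n) :
    Q.complex.d (n + 1) n ≫ ModuleCat.ofHom (val Q n z) = 0 :=
  ModuleCat.hom_ext (dual_val Q n z)

theorem exists_val_eq {n : ℕ} {f : Q.complex.X n ⟶ ModuleCat.of A A}
    (hf : Q.complex.d (n + 1) n ≫ f = 0) : ∃ z : Cocycles k Q n, val Q n z = f.hom :=
  (exact_val Q n _).1 (congrArg ModuleCat.Hom.hom hf)

/-- The coboundary of a cochain, as a cocycle. -/
def ofCochain (n : ℕ) : (Q.complex.X n →ₗ[A] A) →ₗ[k] Cocycles k Q (n + 1) :=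
  (dual k Q n).codRestrict (LinearMap.ker (dual k Q (n + 1))) (dual_dual Q n)

theorem val_comp_ofCochain (n : ℕ) : val Q (n + 1) ∘ₗ ofCochain Q n = dual k Q n := rfl

theorem extMk_congr {n : ℕ} {f g : Q.complex.X n ⟶ ModuleCat.of A A} (h : f = g)
    (hf : Q.complex.d (n + 1) n ≫ f = 0) (hg : Q.complex.d (n + 1) n ≫ g = 0) :
    Q.extMk f (n + 1) rfl hf = Q.extMk g (n + 1) rfl hg := by
  subst h
  rfl

/-- The class of a cocycle. -/
def toExt (n : ℕ) : Cocycles k Q n →ₗ[k] Abelian.Ext M (ModuleCat.of A A) n where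
  toFun z := Q.extMk (ModuleCat.ofHom (val Q n z)) (n + 1) rfl (d_comp_val Q n z)
  map_add' y z := by
    rw [Q.add_extMk]
    exact extMk_congr Q rfl _ _
  map_smul' c z := by
    rw [RingHom.id_apply, Abelian.Ext.smul_eq_comp_mk₀, ProjectiveResolution.extMk_comp_mk₀]
    refine extMk_congr Q (ModuleCat.hom_ext (LinearMap.ext fun x => ?_)) _ _
    exact Algebra.smul_def c (val Q n z x)

theorem toExt_apply (n : ℕ) (z : Cocycles k Q n) :
    toExt Q n z = Q.extMk (ModuleCat.ofHom (val Q n z)) (n + 1) rfl (d_comp_val Q n z) := rfl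

theorem toExt_surjective (n : ℕ) : Function.Surjective (toExt (k := k) Q n) := fun x => by
  obtain ⟨f, hf, rfl⟩ := Q.extMk_surjective x (n + 1) rfl
  obtain ⟨z, hz⟩ := exists_val_eq (k := k) Q hf
  exact ⟨z, extMk_congr Q (ModuleCat.hom_ext hz) (d_comp_val Q n z) hf⟩

theorem toExt_zero_injective : Function.Injective (toExt (k := k) Q 0) := by
  refine (injective_iff_map_eq_zero _).2 fun z hz => val_injective Q 0 ?_
  rw [map_zero]
  exact congrArg ModuleCat.Hom.hom ((extMk_zero_eq_zero_iff Q _ (d_comp_val Q 0 z)).1 hz)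

/-- Positive degrees only; degree 0 is the injectivity of `toExt`. Later arguments split into the
same two cases. -/
theorem exact_ofCochain (n : ℕ) :
    Function.Exact (ofCochain (k := k) Q n) (toExt Q (n + 1)) := fun z => by
  refine (Q.extMk_eq_zero_iff _ (n + 2) rfl (d_comp_val Q (n + 1) z) n rfl).trans ?_
  constructor
  · rintro ⟨g, hg⟩
    exact ⟨g.hom, val_injective Q _ (congrArg ModuleCat.Hom.hom hg)⟩
  · rintro ⟨g, rfl⟩
    exact ⟨ModuleCat.ofHom g, rfl⟩

theorem rTensor_toExt_zero_injective (V : Type u) [AddCommGroup V] [Module k V] :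
    Function.Injective ((toExt (k := k) Q 0).rTensor V) :=
  Module.Flat.rTensor_preserves_injective_linearMap _ (toExt_zero_injective Q)

/-- Right exactness presents Ext ⊗ V as a quotient of cocycles tensored with V, and flatness lets
the relation be tested among cochains. -/
theorem rTensor_toExt_eq_zero_iff (V : Type u) [AddCommGroup V] [Module k V] (n : ℕ)
    (t : Cocycles k Q (n + 1) ⊗[k] V) : (toExt Q (n + 1)).rTensor V t = 0 ↔
      ∃ s, (dual k Q n).rTensor V s = (val Q (n + 1)).rTensor V t := by
  rw [rTensor_exact V (exact_ofCochain Q n) (toExt_surjective Q (n + 1)) t,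
    ← val_comp_ofCochain, LinearMap.rTensor_comp]
  constructor
  · rintro ⟨s, rfl⟩
    exact ⟨s, rfl⟩
  · rintro ⟨s, hs⟩
    exact ⟨s, rTensor_val_injective Q V _ hs⟩

/-! ### The coaction on `Ext` -/

section Coaction

variable {H : Type u} [Ring H] [HopfAlgebra k H]
variable {δ : ∀ n, (Q.complex.X n →ₗ[A] A) →ₗ[k] (Q.complex.X n →ₗ[A] A) ⊗[k] H}

/-- The coaction commutes with the differential, so it sends a cocycle into the kernel of d ⊗ H,
which is cocycles ⊗ H by flatness. This is why f₍₀₎ can be taken among cocycles. -/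
theorem exists_coaction (hδ : ∀ n, IsColinear (δ n) (δ (n + 1)) (dual k Q n)) (n : ℕ) :
    ∃ δZ : Cocycles k Q n →ₗ[k] Cocycles k Q n ⊗[k] H, IsColinear δZ (δ n) (val Q n) := by
  have h : ∀ z : Cocycles k Q n, (dual k Q n).rTensor H (δ n (val Q n z)) = 0 := fun z => by
    have h : δ (n + 1) (dual k Q n (val Q n z)) = (dual k Q n).rTensor H (δ n (val Q n z)) :=
      LinearMap.congr_fun (hδ n) (val Q n z)
    rw [← h, dual_val, map_zero]
  have h' : ∀ z : Cocycles k Q n, ∃ w : Cocycles k Q n ⊗[k] H,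
      (val Q n).rTensor H w = (δ n ∘ₗ val Q n) z := fun z => (rTensor_exact_val Q H n _).1 (h z)
  have h'' := exists_factor_injective (V := Cocycles k Q n) (W := Cocycles k Q n ⊗[k] H)
    (X := (Q.complex.X n →ₗ[A] A) ⊗[k] H) ((val (k := k) Q n).rTensor H)
    (rTensor_val_injective Q H n) (δ n ∘ₗ val Q n) h'
  exact h''.imp fun g hg => LinearMap.ext fun z => (hg z).symm

/-- The coaction of a coboundary d f is (d ⊗ H)(δ f), which has zero class, so the coaction descends
to the quotient. -/
theorem exists_ext_coaction (hδ : ∀ n, IsColinear (δ n) (δ (n + 1)) (dual k Q n)) (n : ℕ)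
    {δZ : Cocycles k Q n →ₗ[k] Cocycles k Q n ⊗[k] H} (hδZ : IsColinear δZ (δ n) (val Q n)) :
    ∃ δE : Abelian.Ext M (ModuleCat.of A A) n →ₗ[k] Abelian.Ext M (ModuleCat.of A A) n ⊗[k] H,
      IsColinear δZ δE (toExt Q n) := by
  obtain ⟨g, hg⟩ := exists_factor_surjective (toExt (k := k) Q n) (toExt_surjective Q n)
    ((toExt Q n).rTensor H ∘ₗ δZ) fun z hz => by
      rw [LinearMap.comp_apply]
      cases n with
      | zero =>
        rw [toExt_zero_injective Q (hz.trans (map_zero _).symm), map_zero, map_zero]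
      | succ n =>
        obtain ⟨f, rfl⟩ := (exact_ofCochain Q n z).1 hz
        refine (rTensor_toExt_eq_zero_iff Q H n _).2 ⟨δ n f, ?_⟩
        exact (LinearMap.congr_fun (hδ n) f).symm.trans
          (LinearMap.congr_fun hδZ (ofCochain Q n f))
  exact ⟨g, LinearMap.ext hg⟩

end Coaction

end Cocycles

end Cocycles

section Induced

variable {k H : Type u} [Field k] [Ring H] [HopfAlgebra k H] {R : UniversalRForm k H}
variable {A : Type u} [Ring A] [Algebra k A] [Coalgebra k A] {B : BraidedHopfAlgebra R A}

namespace FiniteRelProjResolution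

variable {M : ModuleCat.{u} A} {ρM : M →ₗ[k] M ⊗[k] H} (P : FiniteRelProjResolution B M ρM)
variable {T : H →ₗ[k] H}
  {δ : ∀ n, (P.complex.X n →ₗ[A] A) →ₗ[k] (P.complex.X n →ₗ[A] A) ⊗[k] H}

theorem dual_colinear (hδ : ∀ n, IsHomCoaction B T (P.coact n) (δ n)) (n : ℕ) :
    IsColinear (δ n) (δ (n + 1)) (dual k P.toProjectiveResolution n) :=
  LinearMap.ext fun f => (hδ n).apply_comp (hδ (n + 1)) _ (P.d_colinear n) f

theorem isInducedCoaction (hδ : ∀ n, IsHomCoaction B T (P.coact n) (δ n)) (n : ℕ)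
    {δZ : Cocycles k P.toProjectiveResolution n →ₗ[k]
      Cocycles k P.toProjectiveResolution n ⊗[k] H}
    (hδZ : IsColinear δZ (δ n) (Cocycles.val P.toProjectiveResolution n))
    {δE : Abelian.Ext M (ModuleCat.of A A) n →ₗ[k] Abelian.Ext M (ModuleCat.of A A) n ⊗[k] H}
    (hδE : IsColinear δZ δE (Cocycles.toExt P.toProjectiveResolution n)) :
    IsInducedCoaction T P n δE := by
  intro f hf
  obtain ⟨z, hz⟩ := Cocycles.exists_val_eq (k := k) P.toProjectiveResolution hf
  obtain ⟨m, v, w, hl⟩ := exists_eq_sum_tmul (δZ z)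
  refine ⟨m, fun i => ModuleCat.ofHom (Cocycles.val P.toProjectiveResolution n (v i)),
    w, fun i => Cocycles.d_comp_val _ n (v i), fun x => ?_, ?_⟩
  · refine Eq.trans ?_ (hδ n f.hom x)
    refine Eq.trans ?_ (congrArg (fun g => sw (δ n g) fun g h => g x ⊗ₜ[k] h) hz)
    refine Eq.trans ?_ (hδZ.sw_apply z (F := fun g h => g x ⊗ₜ[k] h) (by intros; fun_prop)
      (by intros; fun_prop)).symm
    refine Eq.trans ?_ (congrArg (fun t => sw t fun g h =>
      Cocycles.val P.toProjectiveResolution n g x ⊗ₜ[k] h) hl).symm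
    exact (sw_sum_tmul (F := fun g h => Cocycles.val P.toProjectiveResolution n g x ⊗ₜ[k] h)
      (by intros; fun_prop) (by intros; fun_prop) v w).symm
  · have e : P.toProjectiveResolution.extMk f (n + 1) rfl hf =
        Cocycles.toExt P.toProjectiveResolution n z :=
      Cocycles.extMk_congr _ (ModuleCat.hom_ext hz.symm) hf (Cocycles.d_comp_val _ n z)
    rw [e]
    refine (LinearMap.congr_fun hδE z).trans ?_
    rw [LinearMap.comp_apply, hl, map_sum]
    rfl

end FiniteRelProjResolution

end Induced

end

section

/-! ### Comparison of cohomologies, and right multiplication on cocycles -/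

section Comparison

variable {k A S : Type u} [Field k] [Ring A] [Algebra k A] [Ring S] [Algebra k S]
variable {M : ModuleCat.{u} A} {N : ModuleCat.{u} S}
variable (Q : ProjectiveResolution M) (Q' : ProjectiveResolution N)
variable {V : Type u} [AddCommGroup V] [Module k V]
variable {Φ : ∀ n, (Q.complex.X n →ₗ[A] A) ⊗[k] V →ₗ[k] (Q'.complex.X n →ₗ[S] S)}

theorem exists_cocycles_map
    (hΦ : ∀ n t, dual k Q' n (Φ n t) = Φ (n + 1) ((dual k Q n).rTensor V t)) (n : ℕ) :
    ∃ Λ : Cocycles k Q n ⊗[k] V →ₗ[k] Cocycles k Q' n,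
      ∀ t, Cocycles.val Q' n (Λ t) = Φ n ((Cocycles.val Q n).rTensor V t) := by
  have h : ∀ t : Cocycles k Q n ⊗[k] V, ∃ z : Cocycles k Q' n,
      Cocycles.val Q' n z = (Φ n ∘ₗ (Cocycles.val Q n).rTensor V) t := fun t => by
    refine (Cocycles.exact_val Q' n _).1 ?_
    rw [LinearMap.comp_apply, hΦ, Cocycles.rTensor_dual_val, map_zero]
  exact exists_factor_injective (V := Cocycles k Q n ⊗[k] V) (W := Cocycles k Q' n)
    (X := Q'.complex.X n →ₗ[S] S) (Cocycles.val Q' n) (Cocycles.val_injective Q' n)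
    (Φ n ∘ₗ (Cocycles.val Q n).rTensor V) h

/-- A preimage of a cocycle in degree n is a cocycle because Φ is injective in degree n + 1. -/
theorem cocycles_map_surjective
    (hΦ : ∀ n t, dual k Q' n (Φ n t) = Φ (n + 1) ((dual k Q n).rTensor V t))
    (hi : ∀ n, Function.Injective (Φ n)) (hs : ∀ n, Function.Surjective (Φ n)) {n : ℕ}
    {Λ : Cocycles k Q n ⊗[k] V →ₗ[k] Cocycles k Q' n}
    (hΛ : ∀ t, Cocycles.val Q' n (Λ t) = Φ n ((Cocycles.val Q n).rTensor V t)) :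
    Function.Surjective Λ := fun z => by
  obtain ⟨t, ht⟩ := hs n (Cocycles.val Q' n z)
  have h0 : (dual k Q n).rTensor V t = 0 := hi (n + 1) (by
    rw [← hΦ, ht, Cocycles.dual_val, map_zero])
  obtain ⟨s, rfl⟩ := (Cocycles.rTensor_exact_val Q V n t).1 h0
  exact ⟨s, Cocycles.val_injective Q' n ((hΛ s).trans ht)⟩

theorem toExt_cocycles_map_eq_zero_iff
    (hΦ : ∀ n t, dual k Q' n (Φ n t) = Φ (n + 1) ((dual k Q n).rTensor V t))
    (hi : ∀ n, Function.Injective (Φ n)) (hs : ∀ n, Function.Surjective (Φ n)) {n : ℕ}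
    {Λ : Cocycles k Q n ⊗[k] V →ₗ[k] Cocycles k Q' n}
    (hΛ : ∀ t, Cocycles.val Q' n (Λ t) = Φ n ((Cocycles.val Q n).rTensor V t))
    (t : Cocycles k Q n ⊗[k] V) :
    Cocycles.toExt Q' n (Λ t) = 0 ↔ (Cocycles.toExt Q n).rTensor V t = 0 := by
  cases n with
  | zero =>
    have h : Function.Injective Λ := fun s t h =>
      Cocycles.rTensor_val_injective Q V 0 (hi 0 (by rw [← hΛ, ← hΛ, h]))
    rw [map_eq_zero_iff _ (Cocycles.toExt_zero_injective Q'), map_eq_zero_iff _ h,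
      map_eq_zero_iff _ (Cocycles.rTensor_toExt_zero_injective Q V)]
  | succ n =>
    rw [Cocycles.rTensor_toExt_eq_zero_iff, Cocycles.exact_ofCochain Q' n (Λ t)]
    constructor
    · rintro ⟨g, hg⟩
      obtain ⟨s, rfl⟩ := hs n g
      refine ⟨s, hi (n + 1) ?_⟩
      rw [← hΦ, ← hΛ, ← hg]
      rfl
    · rintro ⟨s, hs⟩
      refine ⟨Φ n s, Cocycles.val_injective Q' _ ?_⟩
      rw [hΛ, ← hs, ← hΦ]
      rfl

/-- If the dual of `Q'` is the tensor product of the dual of `Q` with `V`, then so is its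
cohomology. -/
theorem exists_ext_addEquiv
    (hΦ : ∀ n t, dual k Q' n (Φ n t) = Φ (n + 1) ((dual k Q n).rTensor V t))
    (hi : ∀ n, Function.Injective (Φ n)) (hs : ∀ n, Function.Surjective (Φ n)) {n : ℕ}
    {Λ : Cocycles k Q n ⊗[k] V →ₗ[k] Cocycles k Q' n}
    (hΛ : ∀ t, Cocycles.val Q' n (Λ t) = Φ n ((Cocycles.val Q n).rTensor V t)) :
    ∃ e : Abelian.Ext M (ModuleCat.of A A) n ⊗[k] V ≃+ Abelian.Ext N (ModuleCat.of S S) n,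
      ∀ t, e ((Cocycles.toExt Q n).rTensor V t) = Cocycles.toExt Q' n (Λ t) :=
  exists_addEquiv_of_ker_eq ((Cocycles.toExt Q n).rTensor V).toAddMonoidHom
    (LinearMap.rTensor_surjective V (Cocycles.toExt_surjective Q n))
    (Cocycles.toExt Q' n ∘ₗ Λ).toAddMonoidHom
    ((Cocycles.toExt_surjective Q' n).comp (cocycles_map_surjective Q Q' hΦ hi hs hΛ))
    (toExt_cocycles_map_eq_zero_iff Q Q' hΦ hi hs hΛ)

end Comparison

section RightAction

variable {k A : Type u} [Field k] [Ring A] [Algebra k A] {M : ModuleCat.{u} A}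
variable (Q : ProjectiveResolution M)

namespace Cocycles

/-- Right multiplication by `a` on cocycles. -/
theorem exists_mulRight (n : ℕ) (z : Cocycles k Q n) (a : A) :
    ∃ z' : Cocycles k Q n, val Q n z' = homMulRight (val Q n z) a := by
  refine (exact_val Q n _).1 (LinearMap.ext fun x => ?_)
  have h := LinearMap.congr_fun (dual_val Q n z) x
  exact (congrArg (fun y => y * a) h).trans (zero_mul a)

theorem op_smul_toExt (n : ℕ) {z z' : Cocycles k Q n} {a : A}
    (h : val Q n z' = homMulRight (val Q n z) a) :
    MulOpposite.op a • toExt Q n z = toExt Q n z' := by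
  rw [op_smul_ext, toExt_apply, ProjectiveResolution.extMk_comp_mk₀]
  exact extMk_congr Q (ModuleCat.hom_ext h.symm) _ (d_comp_val Q n z')

/-- The map `a ↦ z · a` for a cocycle `z`. -/
theorem exists_mulRightMap (n : ℕ) (z : Cocycles k Q n) :
    ∃ r : A →ₗ[k] Cocycles k Q n, val Q n ∘ₗ r = homMulRightMap (val Q n z) ∧
      toExt Q n ∘ₗ r = extActionMap (toExt Q n z) := by
  have h := exists_factor_injective (V := A) (W := Cocycles k Q n)
    (X := Q.complex.X n →ₗ[A] A) (val Q n) (val_injective Q n) (homMulRightMap (val Q n z))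
    (exists_mulRight Q n z)
  obtain ⟨r, hr⟩ := h
  exact ⟨r, LinearMap.ext hr, LinearMap.ext fun a => (op_smul_toExt Q n (hr a)).symm⟩

end Cocycles

end RightAction

/-! ### The isomorphism of right A^e-modules -/

section Main

variable {k H : Type u} [Field k] [Ring H] [HopfAlgebra k H] {R : UniversalRForm k H}
variable {A : Type u} [Ring A] [Algebra k A] [Coalgebra k A] {B : BraidedHopfAlgebra R A}

namespace FiniteRelProjResolution

variable (P : FiniteRelProjResolution B (trivialModule B) (trivialCoaction H (trivialModule B)))
variable {T : H →ₗ[k] H}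
  {δ : ∀ n, (P.complex.X n →ₗ[A] A) →ₗ[k] (P.complex.X n →ₗ[A] A) ⊗[k] H}

/-- The isomorphism from `Hom_A(P_n, A) ⊗ A` to the dual of the bimodule resolution. -/
def bimodDual (hδ : ∀ n, IsHomCoaction B T (P.coact n) (δ n)) (hT : IsAntipodeInv T) (n : ℕ) :
    (P.toProjectiveResolution.complex.X n →ₗ[A] A) ⊗[k] A →ₗ[k]
      (P.bimodResolution.complex.X n →ₗ[A ⊗[k] Aᵐᵒᵖ] A ⊗[k] Aᵐᵒᵖ) :=
  phi (hδ n) hT (P.isHopfModule n)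

theorem dual_bimodDual (hδ : ∀ n, IsHomCoaction B T (P.coact n) (δ n)) (hT : IsAntipodeInv T)
    (n : ℕ) (t : (P.toProjectiveResolution.complex.X n →ₗ[A] A) ⊗[k] A) :
    dual k P.bimodResolution n (P.bimodDual hδ hT n t) =
      P.bimodDual hδ hT (n + 1) ((dual k P.toProjectiveResolution n).rTensor A t) := by
  refine Eq.trans ?_ (phi_comp (hδ n) hT (P.isHopfModule n) (hδ (n + 1)) (P.isHopfModule (n + 1))
    (P.complex.d (n + 1) n).hom (P.d_colinear n) t).symm
  exact congrArg (fun d : P.bimodX (n + 1) ⟶ P.bimodX n =>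
    phi (hδ n) hT (P.isHopfModule n) t ∘ₗ d.hom) (P.bimodResolution_d n)

theorem bimodDual_twistedElement (hδ : ∀ n, IsHomCoaction B T (P.coact n) (δ n))
    (hT : IsAntipodeInv T) (n : ℕ) (f : P.toProjectiveResolution.complex.X n →ₗ[A] A)
    (y a b : A) :
    P.bimodDual hδ hT n (twistedElement B (δ n) (homMulRightMap f) y a b) =
      homMulRight (P.bimodDual hδ hT n (f ⊗ₜ y)) (a ⊗ₜ MulOpposite.op b) := by
  refine (congrArg (phi (hδ n) hT (P.isHopfModule n))
    (twistedElement_homMulRightMap B (δ n) f y a b)).trans ?_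
  exact LinearMap.ext (phi_twistedMul (hδ n) hT (P.isHopfModule n) f y a b)

/-- The module structure is transported along the additive isomorphism e, so the module axioms and
linearity are automatic. What remains is that the transported action has the stated form, and this
is checked on classes of cocycles, where it is `phi_twistedMul`. -/
theorem exists_module_linearEquiv (hδ : ∀ n, IsHomCoaction B T (P.coact n) (δ n))
    (hT : IsAntipodeInv T) (n : ℕ)
    {δZ : Cocycles k P.toProjectiveResolution n →ₗ[k]
      Cocycles k P.toProjectiveResolution n ⊗[k] H}
    (hδZ : IsColinear δZ (δ n) (Cocycles.val P.toProjectiveResolution n))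
    {δE : Abelian.Ext (trivialModule B) (ModuleCat.of A A) n →ₗ[k]
      Abelian.Ext (trivialModule B) (ModuleCat.of A A) n ⊗[k] H}
    (hδE : IsColinear δZ δE (Cocycles.toExt P.toProjectiveResolution n)) :
    ∃ _ : Module (A ⊗[k] Aᵐᵒᵖ)ᵐᵒᵖ (Abelian.Ext (trivialModule B) (ModuleCat.of A A) n ⊗[k] A),
      (∀ (ξ : Abelian.Ext (trivialModule B) (ModuleCat.of A A) n) (a' a b : A),
        MulOpposite.op (a ⊗ₜ[k] MulOpposite.op b) • (ξ ⊗ₜ[k] a') =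
          twistedAction B δE ξ a' a b) ∧
      Nonempty (HochschildCohomology k A n ≃ₗ[(A ⊗[k] Aᵐᵒᵖ)ᵐᵒᵖ]
        Abelian.Ext (trivialModule B) (ModuleCat.of A A) n ⊗[k] A) := by
  have hΦ := P.dual_bimodDual hδ hT
  obtain ⟨Λ, hΛ⟩ := exists_cocycles_map P.toProjectiveResolution P.bimodResolution hΦ n
  obtain ⟨e, he⟩ := exists_ext_addEquiv P.toProjectiveResolution P.bimodResolution hΦ
    (fun n => phi_injective (hδ n) hT (P.isHopfModule n))
    (fun n => phi_surjective (hδ n) hT (P.isHopfModule n) (P.isFiniteRelProjective n)) hΛ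
  let := e.module (A ⊗[k] Aᵐᵒᵖ)ᵐᵒᵖ
  refine ⟨inferInstance, fun ξ a' a b => ?_, ⟨(e.linearEquiv (A ⊗[k] Aᵐᵒᵖ)ᵐᵒᵖ).symm⟩⟩
  obtain ⟨z, rfl⟩ := Cocycles.toExt_surjective (k := k) P.toProjectiveResolution n ξ
  obtain ⟨r, hr, hr'⟩ := Cocycles.exists_mulRightMap P.toProjectiveResolution n z
  refine (AddEquiv.symm_apply_eq e).2 ?_
  have h1 : e (Cocycles.toExt P.toProjectiveResolution n z ⊗ₜ[k] a') =
      Cocycles.toExt P.bimodResolution n (Λ (z ⊗ₜ a')) := he (z ⊗ₜ a')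
  -- The twisted element of Ext is the class of the twisted element formed from cocycles.
  have h2 : twistedAction B δE (Cocycles.toExt P.toProjectiveResolution n z) a' a b =
      (Cocycles.toExt P.toProjectiveResolution n).rTensor A (twistedElement B δZ r a' a b) := by
    rw [rTensor_twistedElement B _ hδE, hr']
    rfl
  rw [h2, he]
  refine (congrArg (fun x => MulOpposite.op (a ⊗ₜ[k] MulOpposite.op b) • x) h1).trans ?_
  refine Cocycles.op_smul_toExt P.bimodResolution n ?_
  -- The inclusion of cocycles in cochains likewise preserves the formula, so the cochain identity
  -- for `phi` applies.
  have h3 := (rTensor_twistedElement B _ hδZ r a' a b).trans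
    (congrArg (fun r => twistedElement B (δ n) r a' a b) hr)
  rw [hΛ, hΛ]
  refine (congrArg (P.bimodDual hδ hT n) h3).trans ?_
  exact P.bimodDual_twistedElement hδ hT n _ a' a b

end FiniteRelProjResolution

end Main

end

end

end BraidedHoch

/-- `A` is a Hopf algebra in the braided category of comodules over the coquasitriangular Hopf
algebra `H`, and the trivial module has a resolution `P` by finite relative projective modules. -/
theorem theorem5p4 {k H A : Type u} [Field k] [Ring H] [HopfAlgebra k H]
    (R : BraidedHoch.UniversalRForm k H) [Ring A] [Algebra k A] [Coalgebra k A]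
    (B : BraidedHoch.BraidedHopfAlgebra R A)
    (P : BraidedHoch.FiniteRelProjResolution B (BraidedHoch.trivialModule B)
      (BraidedHoch.trivialCoaction H (BraidedHoch.trivialModule B))) :
    ∃ S : H ≃ₗ[k] H, S.toLinearMap = HopfAlgebra.antipode k ∧
      ∀ n : ℕ, ∃ δ : Abelian.Ext (BraidedHoch.trivialModule B) (ModuleCat.of A A) n →ₗ[k]
          Abelian.Ext (BraidedHoch.trivialModule B) (ModuleCat.of A A) n ⊗[k] H,
        BraidedHoch.IsRightCoaction δ ∧
        BraidedHoch.IsInducedCoaction S.symm.toLinearMap P n δ ∧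
        ∃ _ : Module (A ⊗[k] Aᵐᵒᵖ)ᵐᵒᵖ
            (Abelian.Ext (BraidedHoch.trivialModule B) (ModuleCat.of A A) n ⊗[k] A),
          (∀ (ξ : Abelian.Ext (BraidedHoch.trivialModule B) (ModuleCat.of A A) n) (a' a b : A),
            MulOpposite.op (a ⊗ₜ[k] MulOpposite.op b) • (ξ ⊗ₜ[k] a') =
              BraidedHoch.twistedAction B δ ξ a' a b) ∧
          Nonempty (BraidedHoch.HochschildCohomology k A n ≃ₗ[(A ⊗[k] Aᵐᵒᵖ)ᵐᵒᵖ]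
            Abelian.Ext (BraidedHoch.trivialModule B) (ModuleCat.of A A) n ⊗[k] A) := by
  let S : H ≃ₗ[k] H := LinearEquiv.ofBijective (HopfAlgebra.antipode k) R.antipode_bijective
  have hT : BraidedHoch.IsAntipodeInv S.symm.toLinearMap :=
    ⟨S.symm_apply_apply, S.apply_symm_apply⟩
  have hex : ∀ n, ∃ δ, BraidedHoch.IsHomCoaction B S.symm.toLinearMap (P.coact n) δ := fun n =>
    haveI := (P.isFiniteRelProjective n).finite
    haveI := (P.isFiniteRelProjective n).projective
    BraidedHoch.exists_isHomCoaction hT (P.isHopfModule n)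
  choose δ hδ using hex
  have hd := P.dual_colinear hδ
  refine ⟨S, rfl, fun n => ?_⟩
  obtain ⟨δZ, hδZ⟩ := BraidedHoch.Cocycles.exists_coaction P.toProjectiveResolution hd n
  obtain ⟨δE, hδE⟩ := BraidedHoch.Cocycles.exists_ext_coaction P.toProjectiveResolution hd n hδZ
  have := (P.isFiniteRelProjective n).finite
  have := (P.isFiniteRelProjective n).projective
  -- The comodule axioms hold on cochains, pass to the subspace of cocycles, and from there to the
  -- quotient Ext.
  have hn : BraidedHoch.IsRightCoaction (δ n) :=
    (hδ n).isRightCoaction hT (P.isHopfModule n).isRightCoaction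
  have hZ := hn.of_injective _ hδZ (BraidedHoch.Cocycles.val_injective P.toProjectiveResolution n)
  exact ⟨δE, hZ.of_surjective _ hδE
    (BraidedHoch.Cocycles.toExt_surjective P.toProjectiveResolution n),
    P.isInducedCoaction hδ n hδZ hδE, P.exists_module_linearEquiv hδ hT n hδZ hδE⟩
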